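/- Let $k$ be a commutative ring and let $H$ be a weak Hopf algebra over $k$ with bijective antipode $S$. That is, $H$ is a $k$-algebra and a $k$-coalgebra such that $\Delta(hk)=\Delta(h)\Delta(k)$, $$\Delta^2(1)=1_{(1)}\otimes 1_{(2)}1_{(1')}\otimes 1_{(2')}=1_{(1)}\otimes 1_{(1')}1_{(2)}\otimes 1_{(2')},\qquad \varepsilon(hkl)=\varepsilon(hk_{(1)})\varepsilon(k_{(2)}l)=\varepsilon(hk_{(2)})\varepsilon(k_{(1)}l),$$ and $S:H\to H$ is a bijective $k$-linear map with $S*\mathrm{id}=\varepsilon_s$, $\mathrm{id}*S=\varepsilon_t$, $S*\mathrm{id}*S=S$ for the convolution product, where $\varepsilon_t(h)=\varepsilon(1_{(1)}h)1_{(2)}$ and $\varepsilon_s(h)=1_{(1)}\varepsilon(h1_{(2)})$. The category ${}_H\mathcal M$ of left $H$-modules is monoidal. The tensor product is $M\otimes_t N=\Delta(1)(M\otimes_k N)$ with the diagonal action, the unit object is $H_t=\varepsilon_t(H)$ with action $h\rightharpoonup z=\varepsilon_t(hz)$, the associativity constraints are the natural ones, and the unit constraints are $l_M(1_{(1)}\rightharpoonup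 z\otimes 1_{(2)}m)=zm$ and $r_M(1_{(1)}m\otimes 1_{(2)}\rightharpoonup z)=\varepsilon(1_{(2)}z)1_{(1)}m$. A left-right Yetter-Drinfeld module is a left $H$-module $M$ with a right $H$-coaction $\rho(m)=m_{[0]}\otimes m_{[1]}\in M\otimes_t H$ such that $h_{(1)}m_{[0]}\otimes h_{(2)}m_{[1]}=(h_{(2)}m)_{[0]}\otimes (h_{(2)}m)_{[1]}h_{(1)}$. A left-left Yetter-Drinfeld module is a left $H$-module $M$ with a left $H$-coaction $\lambda(m)=m_{[-1]}\otimes m_{[0]}\in H\otimes_t M$ such that $h_{(1)}m_{[-1]}\otimes h_{(2)}m_{[0]}=(h_{(1)}m)_{[-1]}h_{(2)}\otimes (h_{(1)}m)_{[0]}$. With $H$-linear $H$-colinear maps as morphisms they form categories ${}_H\mathcal{YD}^H$ and ${}_H^H\mathcal{YD}$. For a monoidal category $\mathcal C$, the right center $\mathcal Z_r(\mathcal C)$ has as objects the pairs $(M,\tau_{-,M})$, where $\tau_{X,M}:X\otimes M\to M\otimes X$ is a natural isomorphism that is compatible with tensor products and with the unit object in the variable $X$; its braiding is $d_{M,N}=\tau_{M,N}$.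 The left center $\mathcal Z_l(\mathcal C)$ has as objects the pairs $(M,\sigma_{M,-})$ with natural isomorphisms $\sigma_{M,X}:M\otimes X\to X\otimes M$ of the same kind; its braiding is $c_{M,N}=\sigma_{M,N}$. Both have their usual braided monoidal structure. Then the following hold. 1. The category ${}_H\mathcal{YD}^H$ is isomorphic to the right center $\mathcal Z_r({}_H\mathcal M)$. An isomorphism, which is the identity on underlying $H$-modules and on morphisms, is $(M,\rho)\mapsto (M,\tau_{-,M})$ with $\tau_{V,M}(1_{(1)}v\otimes 1_{(2)}m)=m_{[0]}\otimes m_{[1]}v$. 2. There are braided monoidal structures on ${}_H\mathcal{YD}^H$ and on ${}_H^H\mathcal{YD}$ for which the isomorphism in 1 and the functor ${}_H^H\mathcal{YD}\to\mathcal Z_l({}_H\mathcal M)$, $(M,\lambda)\mapsto (M,\sigma_{M,-})$, $\sigma_{M,V}(1_{(1)}m\otimes 1_{(2)}v)=m_{[-1]}v\otimes m_{[0]}$ (the identity on underlying $H$-modules and on morphisms), are (strict) isomorphisms of braided monoidal categories. 3. For these structures, the functor $(M,\rho)\mapsto (M,\lambda)$ with $\lambda(m)=S(m_{[1]})\otimes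 m_{[0]}$, which is the identity on underlying $H$-modules and on morphisms, is a (strict) isomorphism of braided monoidal categories from ${}_H\mathcal{YD}^H$ to ${}_H^H\mathcal{YD}^{\rm in}$, that is, to ${}_H^H\mathcal{YD}$ with the inverse braiding $\tilde c_{M,N}=c_{N,M}^{-1}$. -/

import Mathlib

open CategoryTheory MonoidalCategory
open scoped TensorProduct

universe u v

set_option linter.unusedSectionVars false

noncomputable section

namespace WeakHopf

section Algebra

lemma exists_repr {k : Type u} {H : Type v} [CommRing k] [Ring H] [Algebra k H]
    (t : H ⊗[k] H) : ∃ S : Finset (H × H), t = ∑ i ∈ S, i.1 ⊗ₜ[k] i.2 :=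
  TensorProduct.exists_finset t

variable (k : Type u) (H : Type v) [CommRing k] [Ring H] [Algebra k H] [Coalgebra k H]

/-- `H`, a `k`-algebra and a `k`-coalgebra, is a weak bialgebra: the comultiplication is
multiplicative, `Δ²(1) = 1₍₁₎ ⊗ 1₍₂₎ 1₍₁'₎ ⊗ 1₍₂'₎ = 1₍₁₎ ⊗ 1₍₁'₎ 1₍₂₎ ⊗ 1₍₂'₎` and
`ε(abc) = ε(a b₍₁₎) ε(b₍₂₎ c) = ε(a b₍₂₎) ε(b₍₁₎ c)`. -/
class WeakBialgebra : Prop where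
  comul_mul : ∀ a b : H,
    Coalgebra.comul (R := k) (a * b) = Coalgebra.comul (R := k) a * Coalgebra.comul (R := k) b
  comul_one_left :
    TensorProduct.assoc k H H H
        ((Coalgebra.comul (R := k)).rTensor H (Coalgebra.comul (R := k) (1 : H))) =
      TensorProduct.assoc k H H H (Coalgebra.comul (R := k) (1 : H) ⊗ₜ[k] (1 : H)) *
        ((1 : H) ⊗ₜ[k] Coalgebra.comul (R := k) (1 : H))
  comul_one_right :
    TensorProduct.assoc k H H H
        ((Coalgebra.comul (R := k)).rTensor H (Coalgebra.comul (R := k) (1 : H))) =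
      ((1 : H) ⊗ₜ[k] Coalgebra.comul (R := k) (1 : H)) *
        TensorProduct.assoc k H H H (Coalgebra.comul (R := k) (1 : H) ⊗ₜ[k] (1 : H))
  counit_mul_left : ∀ a b c : H,
    Coalgebra.counit (R := k) (a * b * c) =
      LinearMap.mul' k k (TensorProduct.map
        (Coalgebra.counit (R := k) ∘ₗ LinearMap.mulLeft k a)
        (Coalgebra.counit (R := k) ∘ₗ LinearMap.mulRight k c) (Coalgebra.comul (R := k) b))
  counit_mul_right : ∀ a b c : H,
    Coalgebra.counit (R := k) (a * b * c) =
      LinearMap.mul' k k (TensorProduct.map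
        (Coalgebra.counit (R := k) ∘ₗ LinearMap.mulRight k c)
        (Coalgebra.counit (R := k) ∘ₗ LinearMap.mulLeft k a) (Coalgebra.comul (R := k) b))

/-- `x ⊗ y ↦ ε(x) y`. -/
def counitL : H ⊗[k] H →ₗ[k] H :=
  (TensorProduct.lid k H).toLinearMap ∘ₗ (Coalgebra.counit (R := k)).rTensor H

/-- `x ⊗ y ↦ ε(y) x`. -/
def counitR : H ⊗[k] H →ₗ[k] H :=
  (TensorProduct.rid k H).toLinearMap ∘ₗ (Coalgebra.counit (R := k)).lTensor H

/-- The target map `ε_t(h) = ε(1₍₁₎ h) 1₍₂₎`. -/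
def epsT : H →ₗ[k] H :=
  counitL k H ∘ₗ LinearMap.mulLeft k (Coalgebra.comul (R := k) (1 : H)) ∘ₗ
    (TensorProduct.mk k H H).flip 1

/-- The source map `ε_s(h) = 1₍₁₎ ε(h 1₍₂₎)`. -/
def epsS : H →ₗ[k] H :=
  counitR k H ∘ₗ LinearMap.mulRight k (Coalgebra.comul (R := k) (1 : H)) ∘ₗ
    TensorProduct.mk k H H 1

/-- The source map of the opposite weak bialgebra, `ε̄_s(h) = ε(1₍₂₎ h) 1₍₁₎`. -/
def epsSbar : H →ₗ[k] H :=
  counitR k H ∘ₗ LinearMap.mulLeft k (Coalgebra.comul (R := k) (1 : H)) ∘ₗ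
    TensorProduct.mk k H H 1

/-- A weak Hopf algebra: a weak bialgebra with an antipode `S` such that
`S * id = ε_s`, `id * S = ε_t` and `S * id * S = S` for the convolution product. -/
class WeakHopfAlgebra : Type (max u v) extends WeakBialgebra k H where
  antipode : H →ₗ[k] H
  antipode_mul_id : ∀ h : H,
    LinearMap.mul' k H (antipode.rTensor H (Coalgebra.comul (R := k) h)) = epsS k H h
  id_mul_antipode : ∀ h : H,
    LinearMap.mul' k H (antipode.lTensor H (Coalgebra.comul (R := k) h)) = epsT k H h
  antipode_mul_id_mul_antipode : ∀ h : H,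
    LinearMap.mul' k H (TensorProduct.map
      (LinearMap.mul' k H ∘ₗ antipode.rTensor H ∘ₗ Coalgebra.comul (R := k)) antipode
        (Coalgebra.comul (R := k) h)) = antipode h

variable {k H}

@[simp] lemma counitL_tmul (x y : H) :
    counitL k H (x ⊗ₜ y) = Coalgebra.counit (R := k) x • y := by simp [counitL]

@[simp] lemma counitR_tmul (x y : H) :
    counitR k H (x ⊗ₜ y) = Coalgebra.counit (R := k) y • x := by simp [counitR]

lemma counitL_comul (h : H) : counitL k H (Coalgebra.comul (R := k) h) = h := by
  simp [counitL, Coalgebra.rTensor_counit_comul]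

lemma counitR_comul (h : H) : counitR k H (Coalgebra.comul (R := k) h) = h := by
  simp [counitR, Coalgebra.lTensor_counit_comul]

lemma epsT_apply (h : H) :
    epsT k H h = counitL k H (Coalgebra.comul (R := k) (1 : H) * (h ⊗ₜ 1)) := by simp [epsT]

lemma epsS_apply (h : H) :
    epsS k H h = counitR k H ((1 ⊗ₜ h) * Coalgebra.comul (R := k) (1 : H)) := by simp [epsS]

lemma epsSbar_apply (h : H) :
    epsSbar k H h = counitR k H (Coalgebra.comul (R := k) (1 : H) * (1 ⊗ₜ h)) := by
  simp [epsSbar]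

variable [WeakBialgebra k H]

lemma comul_mul (a b : H) :
    Coalgebra.comul (R := k) (a * b) = Coalgebra.comul (R := k) a * Coalgebra.comul (R := k) b :=
  WeakBialgebra.comul_mul a b

lemma comul_one_coassoc : 
    (Coalgebra.comul (R := k)).lTensor H (Coalgebra.comul (R := k) (1 : H)) = 
    TensorProduct.assoc k H H H
        ((Coalgebra.comul (R := k)).rTensor H (Coalgebra.comul (R := k) (1 : H))) := 
  (Coalgebra.coassoc_apply (R := k) (1 : H)).symm

/-- `h ε_t(g) = ε(h₍₁₎ g) h₍₂₎`. -/
lemma mul_epsT (h g : H) :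
    h * epsT k H g = counitL k H (Coalgebra.comul (R := k) h * (g ⊗ₜ 1)) := by
  obtain ⟨S, hS⟩ := exists_repr (k := k) (Coalgebra.comul (R := k) (1 : H))
  obtain ⟨T, hT⟩ := exists_repr (k := k) (Coalgebra.comul (R := k) h)
  let Ψ : H ⊗[k] (H ⊗[k] H) →ₗ[k] H := (TensorProduct.lid k H).toLinearMap ∘ₗ
    TensorProduct.map (Coalgebra.counit (R := k) ∘ₗ LinearMap.mulRight k g)
      (counitL k H ∘ₗ LinearMap.mulLeft k (Coalgebra.comul (R := k) h))
  have key := congrArg Ψ (comul_one_coassoc (k := k) (H := H))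
  rw [WeakBialgebra.comul_one_right] at key
  have e1 : Ψ ((Coalgebra.comul (R := k)).lTensor H (Coalgebra.comul (R := k) (1 : H))) =
      h * epsT k H g := by
    rw [epsT_apply, hS]
    simp [Ψ, Finset.sum_mul, Finset.mul_sum, ← comul_mul, counitL_comul]
  have e2 : Ψ (((1 : H) ⊗ₜ[k] Coalgebra.comul (R := k) (1 : H)) *
        TensorProduct.assoc k H H H (Coalgebra.comul (R := k) (1 : H) ⊗ₜ[k] (1 : H))) =
      ∑ i ∈ S, Coalgebra.counit (R := k) (i.1 * g) •
        counitL k H (Coalgebra.comul (R := k) h * (i.2 ⊗ₜ 1)) := by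
    nth_rw 2 [hS]
    simp [Ψ, TensorProduct.sum_tmul, Finset.mul_sum, ← mul_assoc, ← comul_mul]
  have e3 : ∀ p : H, Coalgebra.counit (R := k) (p * g) = ∑ i ∈ S,
      Coalgebra.counit (R := k) (i.1 * g) * Coalgebra.counit (R := k) (p * i.2) := by
    intro p
    have := WeakBialgebra.counit_mul_right (k := k) p 1 g
    rw [hS] at this
    simpa using this
  rw [← e1, key, e2, hT]
  simp only [Finset.sum_mul, map_sum, Algebra.TensorProduct.tmul_mul_tmul, counitL_tmul, mul_one,
    Finset.smul_sum, smul_smul]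
  rw [Finset.sum_comm]
  exact Finset.sum_congr rfl fun j _ => by rw [e3, Finset.sum_smul]

/-- `ε(g 1₍₁₎) 1₍₂₎ h = ε(g h₍₁₎) h₍₂₎`. -/
lemma counitL_mul_comul_one_mul (g h : H) :
    counitL k H ((g ⊗ₜ 1) * Coalgebra.comul (R := k) (1 : H)) * h =
      counitL k H ((g ⊗ₜ 1) * Coalgebra.comul (R := k) h) := by
  obtain ⟨S, hS⟩ := exists_repr (k := k) (Coalgebra.comul (R := k) (1 : H))
  obtain ⟨T, hT⟩ := exists_repr (k := k) (Coalgebra.comul (R := k) h)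
  let Ψ : H ⊗[k] (H ⊗[k] H) →ₗ[k] H := (TensorProduct.lid k H).toLinearMap ∘ₗ
    TensorProduct.map (Coalgebra.counit (R := k) ∘ₗ LinearMap.mulLeft k g)
      (counitL k H ∘ₗ LinearMap.mulRight k (Coalgebra.comul (R := k) h))
  have key := congrArg Ψ (comul_one_coassoc (k := k) (H := H))
  rw [WeakBialgebra.comul_one_left] at key
  have e1 : Ψ ((Coalgebra.comul (R := k)).lTensor H (Coalgebra.comul (R := k) (1 : H))) =
      counitL k H ((g ⊗ₜ 1) * Coalgebra.comul (R := k) (1 : H)) * h := by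
    rw [hS]
    simp [Ψ, Finset.sum_mul, Finset.mul_sum, ← comul_mul, counitL_comul]
  have e2 : Ψ (TensorProduct.assoc k H H H (Coalgebra.comul (R := k) (1 : H) ⊗ₜ[k] (1 : H)) *
      ((1 : H) ⊗ₜ[k] Coalgebra.comul (R := k) (1 : H))) =
      ∑ i ∈ S, Coalgebra.counit (R := k) (g * i.1) •
        counitL k H ((i.2 ⊗ₜ 1) * Coalgebra.comul (R := k) h) := by
    nth_rw 1 [hS]
    simp [Ψ, TensorProduct.sum_tmul, Finset.sum_mul, mul_assoc, ← comul_mul]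
  have e3 : ∀ p : H, Coalgebra.counit (R := k) (g * p) = ∑ i ∈ S,
      Coalgebra.counit (R := k) (g * i.1) * Coalgebra.counit (R := k) (i.2 * p) := by
    intro p
    have := WeakBialgebra.counit_mul_left (k := k) g 1 p
    rw [hS] at this
    simpa using this
  rw [← e1, key, e2, hT]
  simp only [Finset.mul_sum, map_sum, Algebra.TensorProduct.tmul_mul_tmul, counitL_tmul, one_mul,
    Finset.smul_sum, smul_smul]
  rw [Finset.sum_comm]
  exact Finset.sum_congr rfl fun j _ => by rw [e3, Finset.sum_smul]

/-- `h ε̄_s(g) = h₍₁₎ ε(h₍₂₎ g)`. -/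
lemma mul_epsSbar (h g : H) :
    h * epsSbar k H g = counitR k H (Coalgebra.comul (R := k) h * (1 ⊗ₜ g)) := by
  obtain ⟨S, hS⟩ := exists_repr (k := k) (Coalgebra.comul (R := k) (1 : H))
  obtain ⟨T, hT⟩ := exists_repr (k := k) (Coalgebra.comul (R := k) h)
  let Φ : (H ⊗[k] H) ⊗[k] H →ₗ[k] H := (TensorProduct.rid k H).toLinearMap ∘ₗ
    TensorProduct.map (counitR k H ∘ₗ LinearMap.mulLeft k (Coalgebra.comul (R := k) h))
      (Coalgebra.counit (R := k) ∘ₗ LinearMap.mulRight k g)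
  let Ψ : H ⊗[k] (H ⊗[k] H) →ₗ[k] H := Φ ∘ₗ (TensorProduct.assoc k H H H).symm.toLinearMap
  have key := congrArg Ψ (WeakBialgebra.comul_one_left (k := k) (H := H))
  have e1 : Ψ (TensorProduct.assoc k H H H
        ((Coalgebra.comul (R := k)).rTensor H (Coalgebra.comul (R := k) (1 : H)))) =
      h * epsSbar k H g := by
    rw [epsSbar_apply, hS]
    simp [Ψ, Φ, Finset.sum_mul, Finset.mul_sum, ← comul_mul, counitR_comul]
  have e2 : Ψ (TensorProduct.assoc k H H H (Coalgebra.comul (R := k) (1 : H) ⊗ₜ[k] (1 : H)) *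
      ((1 : H) ⊗ₜ[k] Coalgebra.comul (R := k) (1 : H))) =
      ∑ i ∈ S, Coalgebra.counit (R := k) (i.2 * g) •
        counitR k H (Coalgebra.comul (R := k) h * (1 ⊗ₜ i.1)) := by
    have e4 : ∀ (w : H ⊗[k] H) (a b : H), (TensorProduct.assoc k H H H).symm
        (TensorProduct.assoc k H H H (w ⊗ₜ[k] (1 : H)) * ((1 : H) ⊗ₜ[k] (a ⊗ₜ[k] b))) =
        (w * (1 ⊗ₜ a)) ⊗ₜ b := by
      intro w a b
      induction w with
      | zero => simp
      | tmul x y => simp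
      | add x y hx hy => simp only [TensorProduct.add_tmul, map_add, add_mul, hx, hy]
    nth_rw 2 [hS]
    simp only [Ψ, LinearMap.comp_apply, TensorProduct.tmul_sum, Finset.mul_sum, map_sum,
      LinearEquiv.coe_coe, e4]
    simp [Φ, ← mul_assoc, ← comul_mul]
  have e3 : ∀ p : H, Coalgebra.counit (R := k) (p * g) = ∑ i ∈ S,
      Coalgebra.counit (R := k) (i.2 * g) * Coalgebra.counit (R := k) (p * i.1) := by
    intro p
    have := WeakBialgebra.counit_mul_left (k := k) p 1 g
    rw [hS] at this
    simpa [mul_comm] using this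
  rw [← e1, key, e2, hT]
  simp only [Finset.sum_mul, map_sum, Algebra.TensorProduct.tmul_mul_tmul, counitR_tmul, mul_one,
    Finset.smul_sum, smul_smul]
  rw [Finset.sum_comm]
  exact Finset.sum_congr rfl fun j _ => by rw [e3, Finset.sum_smul]

lemma counit_mul_epsT (h g : H) :
    Coalgebra.counit (R := k) (h * epsT k H g) = Coalgebra.counit (R := k) (h * g) := by
  obtain ⟨S, hS⟩ := exists_repr (k := k) (Coalgebra.comul (R := k) (1 : H))
  have := WeakBialgebra.counit_mul_right (k := k) h 1 g
  rw [hS] at this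
  rw [epsT_apply, hS]
  simp [Finset.sum_mul, Finset.mul_sum] at this ⊢
  rw [this]

lemma epsT_mul_epsT (h g : H) : epsT k H (h * epsT k H g) = epsT k H (h * g) := by
  obtain ⟨S, hS⟩ := exists_repr (k := k) (Coalgebra.comul (R := k) (1 : H))
  rw [epsT_apply, epsT_apply (h * g), hS]
  simp [Finset.sum_mul, ← mul_assoc, counit_mul_epsT]

lemma counitL_mul (t : H ⊗[k] H) (y : H) :
    counitL k H t * y = counitL k H (t * (1 ⊗ₜ y)) := by
  obtain ⟨T, rfl⟩ := exists_repr t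
  simp [Finset.sum_mul]

lemma counitR_mul (t : H ⊗[k] H) (y : H) :
    counitR k H t * y = counitR k H (t * (y ⊗ₜ 1)) := by
  obtain ⟨T, rfl⟩ := exists_repr t
  simp [Finset.sum_mul]

variable (k) in
lemma epsT_one : epsT k H 1 = 1 := by
  rw [epsT_apply, ← Algebra.TensorProduct.one_def, mul_one, counitL_comul]

lemma epsT_idem (h : H) : epsT k H (epsT k H h) = epsT k H h := by
  simpa using epsT_mul_epsT (k := k) 1 h

variable (k) in
lemma epsSbar_one : epsSbar k H 1 = 1 := by
  rw [epsSbar_apply, ← Algebra.TensorProduct.one_def, mul_one, counitR_comul]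

lemma epsSbar_epsT (h : H) : epsSbar k H (epsT k H h) = epsSbar k H h := by
  obtain ⟨S, hS⟩ := exists_repr (k := k) (Coalgebra.comul (R := k) (1 : H))
  rw [epsSbar_apply, epsSbar_apply h, hS]
  simp [Finset.sum_mul, counit_mul_epsT]

/-- `ε_t(h₍₁₎ g) h₍₂₎ = h ε_t(g)`. -/
lemma epsT_comul_mul (h g : H) :
    LinearMap.mul' k H ((epsT k H ∘ₗ LinearMap.mulRight k g).rTensor H
      (Coalgebra.comul (R := k) h)) = h * epsT k H g := by
  have h1 : ∀ t : H ⊗[k] H,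
      LinearMap.mul' k H ((epsT k H ∘ₗ LinearMap.mulRight k g).rTensor H t) =
        counitL k H (Coalgebra.comul (R := k) (1 : H) * t * (g ⊗ₜ 1)) := by
    intro t
    obtain ⟨T, rfl⟩ := exists_repr t
    simp [epsT_apply, Finset.sum_mul, Finset.mul_sum, counitL_mul, mul_assoc]
  rw [h1, ← comul_mul, one_mul, mul_epsT]

/-- `ε̄_s(h₍₂₎ g) h₍₁₎ = h ε̄_s(g)`. -/
lemma epsSbar_comul_mul (h g : H) :
    LinearMap.mul' k H (TensorProduct.comm k H H
      ((epsSbar k H ∘ₗ LinearMap.mulRight k g).lTensor H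
      (Coalgebra.comul (R := k) h))) = h * epsSbar k H g := by
  have h1 : ∀ t : H ⊗[k] H,
      LinearMap.mul' k H (TensorProduct.comm k H H
        ((epsSbar k H ∘ₗ LinearMap.mulRight k g).lTensor H t)) =
        counitR k H (Coalgebra.comul (R := k) (1 : H) * t * (1 ⊗ₜ g)) := by
    intro t
    obtain ⟨T, rfl⟩ := exists_repr t
    simp [epsSbar_apply, Finset.sum_mul, Finset.mul_sum, counitR_mul, mul_assoc]
  rw [h1, ← comul_mul, one_mul, mul_epsSbar]

/-- `Δ(z) = 1₍₁₎ z ⊗ 1₍₂₎` for `z = ε_t(g)`. -/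
lemma comul_epsT (g : H) :
    Coalgebra.comul (R := k) (epsT k H g) =
      Coalgebra.comul (R := k) (1 : H) * (epsT k H g ⊗ₜ 1) := by
  obtain ⟨S, hS⟩ := exists_repr (k := k) (Coalgebra.comul (R := k) (1 : H))
  let Ψ : H ⊗[k] (H ⊗[k] H) →ₗ[k] H ⊗[k] H := (TensorProduct.lid k (H ⊗[k] H)).toLinearMap ∘ₗ
    (Coalgebra.counit (R := k) ∘ₗ LinearMap.mulRight k g).rTensor _
  have key := congrArg Ψ (comul_one_coassoc (k := k) (H := H))
  rw [WeakBialgebra.comul_one_right] at key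
  have e1 : Ψ ((Coalgebra.comul (R := k)).lTensor H (Coalgebra.comul (R := k) (1 : H))) =
      Coalgebra.comul (R := k) (epsT k H g) := by
    rw [epsT_apply, hS]
    simp [Ψ, Finset.sum_mul]
  have e2 : Ψ (((1 : H) ⊗ₜ[k] Coalgebra.comul (R := k) (1 : H)) *
        TensorProduct.assoc k H H H (Coalgebra.comul (R := k) (1 : H) ⊗ₜ[k] (1 : H))) =
      Coalgebra.comul (R := k) (1 : H) * (epsT k H g ⊗ₜ 1) := by
    have h1 : epsT k H g = ∑ i ∈ S, Coalgebra.counit (R := k) (i.1 * g) • i.2 := by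
      rw [epsT_apply, hS]
      simp [Finset.sum_mul]
    rw [h1]
    nth_rw 2 [hS]
    simp [Ψ, TensorProduct.sum_tmul, Finset.mul_sum, ← TensorProduct.smul_tmul']
  rw [← e1, key, e2]

/-- `1₍₁₎ ε̄_s(g) ⊗ 1₍₂₎ = 1₍₁₎ ⊗ 1₍₂₎ ε_t(g)`. -/
lemma comul_one_mul_epsSbar (g : H) :
    Coalgebra.comul (R := k) (1 : H) * (epsSbar k H g ⊗ₜ 1) =
      Coalgebra.comul (R := k) (1 : H) * (1 ⊗ₜ epsT k H g) := by
  let Ψ : H ⊗[k] (H ⊗[k] H) →ₗ[k] H ⊗[k] H :=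
    (counitL k H ∘ₗ LinearMap.mulRight k (g ⊗ₜ 1)).lTensor H
  have e1 : ∀ t : H ⊗[k] H, Ψ ((Coalgebra.comul (R := k)).lTensor H t) =
      t * (1 ⊗ₜ epsT k H g) := by
    intro t
    obtain ⟨T, rfl⟩ := exists_repr t
    simp [Ψ, Finset.sum_mul, mul_epsT]
  have e2 : ∀ t : (H ⊗[k] H) ⊗[k] H, Ψ (TensorProduct.assoc k H H H t) =
      (counitR k H ∘ₗ LinearMap.mulRight k (1 ⊗ₜ g)).rTensor H t := by
    intro t
    induction t with
    | zero => simp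
    | add x y hx hy => simp only [map_add, hx, hy]
    | tmul x c =>
      induction x with
      | zero => simp
      | add x y hx hy => simp only [TensorProduct.add_tmul, map_add, hx, hy]
      | tmul a b => simp [Ψ, TensorProduct.smul_tmul]
  have e3 : ∀ t : H ⊗[k] H, Ψ (TensorProduct.assoc k H H H
      ((Coalgebra.comul (R := k)).rTensor H t)) = t * (epsSbar k H g ⊗ₜ 1) := by
    intro t
    obtain ⟨T, rfl⟩ := exists_repr t
    simp [e2, Finset.sum_mul, mul_epsSbar]
  rw [← e1, ← e3, comul_one_coassoc]


/-- `ε_t(1₍₁₎) ⊗ 1₍₂₎ h = ε_t(h₍₁₎) ⊗ h₍₂₎`. -/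
lemma epsT_comul_one_mul (h : H) :
    (epsT k H).rTensor H (Coalgebra.comul (R := k) (1 : H) * (1 ⊗ₜ h)) =
      (epsT k H).rTensor H (Coalgebra.comul (R := k) h) := by
  obtain ⟨S, hS⟩ := exists_repr (k := k) (Coalgebra.comul (R := k) (1 : H))
  have h1 : ∀ x : H, epsT k H x =
      ∑ i ∈ S, Coalgebra.counit (R := k) (i.1 * x) • i.2 := by
    intro x
    rw [epsT_apply, hS]
    simp [Finset.sum_mul]
  have h2 : ∀ t : H ⊗[k] H, (epsT k H).rTensor H t =
      ∑ i ∈ S, i.2 ⊗ₜ counitL k H ((i.1 ⊗ₜ 1) * t) := by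
    intro t
    obtain ⟨T, rfl⟩ := exists_repr t
    simp only [map_sum, LinearMap.rTensor_tmul, h1, Finset.mul_sum, TensorProduct.sum_tmul,
      TensorProduct.tmul_sum, Algebra.TensorProduct.tmul_mul_tmul, counitL_tmul, one_mul,
      TensorProduct.smul_tmul]
    rw [Finset.sum_comm]
  rw [h2, h2]
  refine Finset.sum_congr rfl fun i _ => ?_
  rw [← mul_assoc, ← counitL_mul, counitL_mul_comul_one_mul]

/-- `ε_t(1₍₁₎) ⊗ 1₍₂₎ z = ε_t(1₍₁₎ z) ⊗ 1₍₂₎` for `z = ε_t(g)`. -/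
lemma epsT_comul_one_mul' (g : H) :
    (epsT k H).rTensor H (Coalgebra.comul (R := k) (1 : H) * (1 ⊗ₜ epsT k H g)) =
      (epsT k H).rTensor H (Coalgebra.comul (R := k) (1 : H) * (epsT k H g ⊗ₜ 1)) := by
  rw [epsT_comul_one_mul, comul_epsT]

end Algebra

section Modules

variable (k : Type u) (H : Type v) [CommRing k] [Ring H] [Algebra k H]

/-- A left `H`-module: a `k`-module with a compatible left action of the `k`-algebra `H`. -/
structure LMod where
  carrier : Type v
  [isAddCommGroup : AddCommGroup carrier]
  [isModuleBase : Module k carrier]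
  [isModule : Module H carrier]
  [isScalarTower : IsScalarTower k H carrier]

namespace LMod

variable {k H}

instance : CoeSort (LMod k H) (Type v) := ⟨LMod.carrier⟩

attribute [instance] isAddCommGroup isModuleBase isModule isScalarTower

/-- Morphisms are the left `H`-linear maps. -/
@[ext]
structure Hom (M N : LMod k H) where
  toLin : M →ₗ[H] N

instance : Category (LMod k H) where
  Hom M N := Hom M N
  id M := ⟨LinearMap.id⟩
  comp f g := ⟨g.toLin ∘ₗ f.toLin⟩

/-- The `k`-linear map underlying a morphism. -/
def klin {M N : LMod k H} (f : M ⟶ N) : M →ₗ[k] N := f.toLin.restrictScalars k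

@[simp] lemma klin_id (M : LMod k H) : klin (𝟙 M) = LinearMap.id := rfl

@[simp] lemma klin_comp {M N P : LMod k H} (f : M ⟶ N) (g : N ⟶ P) :
    klin (f ≫ g) = klin g ∘ₗ klin f := rfl

@[simp] lemma klin_smul {M N : LMod k H} (f : M ⟶ N) (h : H) (m : M) :
    klin f (h • m) = h • klin f m := f.toLin.map_smul h m

lemma hom_ext {M N : LMod k H} {f g : M ⟶ N} (w : ∀ m, klin f m = klin g m) : f = g :=
  Hom.ext (LinearMap.ext w)

/-- A `k`-linear map commuting with the action of `H`, as a morphism. -/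
def mkHom {M N : LMod k H} (f : M →ₗ[k] N) (hf : ∀ (h : H) (m : M), f (h • m) = h • f m) :
    M ⟶ N :=
  ⟨{ toFun := f, map_add' := f.map_add, map_smul' := hf }⟩

@[simp] lemma klin_mkHom {M N : LMod k H} (f : M →ₗ[k] N)
    (hf : ∀ (h : H) (m : M), f (h • m) = h • f m) : klin (mkHom f hf) = f := rfl

/-- Isomorphisms from mutually inverse `k`-linear maps, one of which is `H`-linear. -/
def mkIso {M N : LMod k H} (f : M →ₗ[k] N) (g : N →ₗ[k] M)
    (hf : ∀ (h : H) (m : M), f (h • m) = h • f m) (hgf : ∀ m, g (f m) = m)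
    (hfg : ∀ n, f (g n) = n) : M ≅ N where
  hom := mkHom f hf
  inv := mkHom g fun h n => by
    conv_lhs => rw [← hfg n]
    rw [← hf, hgf]
  hom_inv_id := hom_ext hgf
  inv_hom_id := hom_ext hfg

variable (k H) in
/-- The left regular module. -/
abbrev regular : LMod k H := ⟨H⟩

end LMod

open LMod

/-- The action of `H ⊗ H` on `M ⊗ N`. -/
def tensorAct (M N : LMod k H) : H ⊗[k] H →ₐ[k] Module.End k (M ⊗[k] N) :=
  (Module.endTensorEndAlgHom (R := k) (S := k) (A := k)).comp
    (Algebra.TensorProduct.map (Algebra.lsmul k k M) (Algebra.lsmul k k N))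

variable {k H}

@[simp] lemma tensorAct_tmul (M N : LMod k H) (a b : H) (m : M) (n : N) :
    tensorAct k H M N (a ⊗ₜ b) (m ⊗ₜ n) = (a • m) ⊗ₜ (b • n) := rfl

/-- The `k`-linear map `h ↦ h m`. -/
def orbit (M : LMod k H) (m : M) : H →ₗ[k] M :=
  (LinearMap.toSpanSingleton H M m).restrictScalars k

@[simp] lemma orbit_apply (M : LMod k H) (m : M) (h : H) : orbit M m h = h • m := rfl

lemma tensorAct_apply_tmul (M N : LMod k H) (t : H ⊗[k] H) (m : M) (n : N) :
    tensorAct k H M N t (m ⊗ₜ n) = TensorProduct.map (orbit M m) (orbit N n) t := by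
  obtain ⟨T, rfl⟩ := exists_repr t
  simp [LinearMap.sum_apply]

lemma map_tensorAct {M M' N N' : LMod k H} (f : M ⟶ M') (g : N ⟶ N') (t : H ⊗[k] H)
    (x : M ⊗[k] N) :
    TensorProduct.map (klin f) (klin g) (tensorAct k H M N t x) =
      tensorAct k H M' N' t (TensorProduct.map (klin f) (klin g) x) := by
  obtain ⟨T, rfl⟩ := exists_repr t
  induction x with
  | zero => simp
  | add x y hx hy => simp only [map_add, hx, hy]
  | tmul m n => simp [LinearMap.sum_apply]

variable [Coalgebra k H]

/-- `M ⊗_t N = Δ(1)(M ⊗ N)`, a `k`-submodule of `M ⊗ N`. -/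
def tensorT (M N : LMod k H) : Submodule k (M ⊗[k] N) :=
  LinearMap.range (tensorAct k H M N (Coalgebra.comul (R := k) (1 : H)))

/-- The `k`-module `M ⊗_t N`, as a type. -/
def TensorT (M N : LMod k H) : Type v := ↥(tensorT M N)

instance (M N : LMod k H) : AddCommGroup (TensorT M N) :=
  inferInstanceAs (AddCommGroup ↥(tensorT M N))

instance (M N : LMod k H) : Module k (TensorT M N) :=
  inferInstanceAs (Module k ↥(tensorT M N))

/-- The inclusion `M ⊗_t N → M ⊗ N`. -/
def incl (M N : LMod k H) : TensorT M N →ₗ[k] M ⊗[k] N := (tensorT M N).subtype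

lemma incl_injective (M N : LMod k H) : Function.Injective (incl M N) :=
  (tensorT M N).injective_subtype

/-- The projection `M ⊗ N → M ⊗_t N`, `m ⊗ n ↦ 1₍₁₎ m ⊗ 1₍₂₎ n`. -/
def proj (M N : LMod k H) : M ⊗[k] N →ₗ[k] TensorT M N :=
  (tensorAct k H M N (Coalgebra.comul (R := k) (1 : H))).rangeRestrict

lemma incl_proj (M N : LMod k H) (x : M ⊗[k] N) :
    incl M N (proj M N x) = tensorAct k H M N (Coalgebra.comul (R := k) (1 : H)) x := rfl

lemma proj_surjective (M N : LMod k H) : Function.Surjective (proj M N) :=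
  LinearMap.surjective_rangeRestrict _

/-- The element `1₍₁₎ m ⊗ 1₍₂₎ n` of `M ⊗_t N`. -/
def tm {M N : LMod k H} (m : M) (n : N) : TensorT M N := proj M N (m ⊗ₜ n)

lemma tensorT_hom_ext {M N : LMod k H} {P : Type*} [AddCommGroup P] [Module k P]
    {f g : TensorT M N →ₗ[k] P} (w : ∀ m n, f (tm m n) = g (tm m n)) : f = g := by
  have : f ∘ₗ proj M N = g ∘ₗ proj M N := TensorProduct.ext' w
  ext x
  obtain ⟨y, rfl⟩ := proj_surjective M N x
  exact LinearMap.congr_fun this y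

variable [WeakBialgebra k H]

lemma tensorAct_comul_mul (M N : LMod k H) (a b : H) (x : M ⊗[k] N) :
    tensorAct k H M N (Coalgebra.comul (R := k) (a * b)) x =
      tensorAct k H M N (Coalgebra.comul (R := k) a)
        (tensorAct k H M N (Coalgebra.comul (R := k) b) x) := by
  rw [comul_mul, map_mul]; rfl

lemma proj_incl (M N : LMod k H) (x : TensorT M N) : proj M N (incl M N x) = x := by
  obtain ⟨y, rfl⟩ := proj_surjective M N x
  apply incl_injective
  rw [incl_proj, incl_proj, ← tensorAct_comul_mul, one_mul]

/-- The diagonal action `h (m ⊗ n) = h₍₁₎ m ⊗ h₍₂₎ n` of `H` on `M ⊗_t N`. -/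
instance (M N : LMod k H) : SMul H (TensorT M N) where
  smul h x := ⟨tensorAct k H M N (Coalgebra.comul (R := k) h) (incl M N x), by
    refine ⟨tensorAct k H M N (Coalgebra.comul (R := k) h) (incl M N x), ?_⟩
    rw [← tensorAct_comul_mul, one_mul]⟩

lemma incl_smul (M N : LMod k H) (h : H) (x : TensorT M N) :
    incl M N (h • x) = tensorAct k H M N (Coalgebra.comul (R := k) h) (incl M N x) := rfl

instance (M N : LMod k H) : Module H (TensorT M N) where
  one_smul x := by
    apply incl_injective
    rw [incl_smul, ← incl_proj, proj_incl]
  mul_smul a b x := by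
    apply incl_injective
    simp only [incl_smul, tensorAct_comul_mul]
  smul_zero a := by
    apply incl_injective
    rw [incl_smul, map_zero, map_zero]
  smul_add a x y := by
    apply incl_injective
    rw [incl_smul, map_add, map_add, map_add, incl_smul, incl_smul]
  add_smul a b x := by
    apply incl_injective
    rw [incl_smul, map_add, map_add, map_add, incl_smul, incl_smul, LinearMap.add_apply]
  zero_smul x := by
    apply incl_injective
    rw [incl_smul, map_zero, map_zero, map_zero, LinearMap.zero_apply]

instance (M N : LMod k H) : IsScalarTower k H (TensorT M N) where
  smul_assoc r a x := by
    apply incl_injective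
    rw [incl_smul, map_smul, map_smul, map_smul, incl_smul, LinearMap.smul_apply]

lemma smul_proj (M N : LMod k H) (h : H) (x : M ⊗[k] N) :
    h • proj M N x = proj M N (tensorAct k H M N (Coalgebra.comul (R := k) h) x) := by
  apply incl_injective
  rw [incl_smul, incl_proj, incl_proj, ← tensorAct_comul_mul, ← tensorAct_comul_mul, mul_one,
    one_mul]

/-- The object `M ⊗_t N`. -/
abbrev tensorObj (M N : LMod k H) : LMod k H := ⟨TensorT M N⟩

/-- The map `f ⊗_t g`. -/
def tensorLin {M M' N N' : LMod k H} (f : M ⟶ M') (g : N ⟶ N') :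
    TensorT M N →ₗ[k] TensorT M' N' :=
  proj M' N' ∘ₗ TensorProduct.map (klin f) (klin g) ∘ₗ incl M N

lemma tensorLin_smul {M M' N N' : LMod k H} (f : M ⟶ M') (g : N ⟶ N') (h : H)
    (x : TensorT M N) : tensorLin f g (h • x) = h • tensorLin f g x := by
  simp only [tensorLin, LinearMap.comp_apply]
  rw [incl_smul, map_tensorAct, smul_proj]

@[simp] lemma tensorLin_tm {M M' N N' : LMod k H} (f : M ⟶ M') (g : N ⟶ N') (m : M) (n : N) :
    tensorLin f g (tm m n) = tm (klin f m) (klin g n) := by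
  simp only [tensorLin, LinearMap.comp_apply]
  rw [tm, incl_proj, map_tensorAct, ← incl_proj, proj_incl]; rfl

/-- The morphism `f ⊗_t g`. -/
def tensorMap {M M' N N' : LMod k H} (f : M ⟶ M') (g : N ⟶ N') :
    tensorObj M N ⟶ tensorObj M' N' :=
  mkHom (tensorLin f g) (tensorLin_smul f g)

lemma tm_smul (M N : LMod k H) (a b : H) (m : M) (n : N) :
    (tm (a • m) (b • n) : TensorT M N) = proj M N (tensorAct k H M N (a ⊗ₜ b) (m ⊗ₜ n)) := rfl

lemma smul_tm {M N : LMod k H} (h : H) (m : M) (n : N) :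
    h • (tm m n : TensorT M N) =
      proj M N (TensorProduct.map (orbit M m) (orbit N n) (Coalgebra.comul (R := k) h)) := by
  rw [tm, smul_proj, tensorAct_apply_tmul]

lemma incl_smul_tm {M N : LMod k H} (h : H) (m : M) (n : N) :
    incl M N (h • (tm m n : TensorT M N)) =
      TensorProduct.map (orbit M m) (orbit N n) (Coalgebra.comul (R := k) h) := by
  rw [tm, smul_proj, incl_proj, ← tensorAct_comul_mul, one_mul, tensorAct_apply_tmul]

/-- `(m ⊗ n) ⊗ p ↦ m ⊗ (n ⊗ p)`, from `(M ⊗_t N) ⊗_t P` to `M ⊗_t (N ⊗_t P)`. -/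
def assocLin (M N P : LMod k H) :
    TensorT (tensorObj M N) P →ₗ[k] TensorT M (tensorObj N P) :=
  proj M (tensorObj N P) ∘ₗ (proj N P).lTensor M ∘ₗ
    (TensorProduct.assoc k M N P).toLinearMap ∘ₗ (incl M N).rTensor P ∘ₗ incl (tensorObj M N) P

/-- `m ⊗ (n ⊗ p) ↦ (m ⊗ n) ⊗ p`, from `M ⊗_t (N ⊗_t P)` to `(M ⊗_t N) ⊗_t P`. -/
def assocInvLin (M N P : LMod k H) :
    TensorT M (tensorObj N P) →ₗ[k] TensorT (tensorObj M N) P :=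
  proj (tensorObj M N) P ∘ₗ (proj M N).rTensor P ∘ₗ
    (TensorProduct.assoc k M N P).symm.toLinearMap ∘ₗ (incl N P).lTensor M ∘ₗ
      incl M (tensorObj N P)

lemma orbit_tm {M N : LMod k H} (m : M) (n : N) :
    orbit (tensorObj M N) (tm m n : TensorT M N) = proj M N ∘ₗ
      TensorProduct.map (orbit M m) (orbit N n) ∘ₗ Coalgebra.comul (R := k) := by
  ext h
  exact smul_tm h m n

lemma incl_orbit_tm {M N : LMod k H} (m : M) (n : N) :
    incl M N ∘ₗ orbit (tensorObj M N) (tm m n : TensorT M N) =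
      TensorProduct.map (orbit M m) (orbit N n) ∘ₗ Coalgebra.comul (R := k) := by
  ext h
  exact incl_smul_tm h m n

lemma incl_tm {M N : LMod k H} (m : M) (n : N) :
    incl M N (tm m n) = TensorProduct.map (orbit M m) (orbit N n)
      (Coalgebra.comul (R := k) (1 : H)) := by
  rw [tm, incl_proj, tensorAct_apply_tmul]

lemma assoc_map_comul {A B C : LMod k H} (f : H →ₗ[k] A) (g : H →ₗ[k] B) (l : H →ₗ[k] C)
    (h : H) :
    TensorProduct.assoc k A B C (TensorProduct.map
        (TensorProduct.map f g ∘ₗ Coalgebra.comul (R := k)) l (Coalgebra.comul (R := k) h)) =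
      TensorProduct.map f (TensorProduct.map g l ∘ₗ Coalgebra.comul (R := k))
        (Coalgebra.comul (R := k) h) := by
  have e1 : ∀ t : (H ⊗[k] H) ⊗[k] H, TensorProduct.assoc k A B C
      (TensorProduct.map (TensorProduct.map f g) l t) =
      TensorProduct.map f (TensorProduct.map g l) (TensorProduct.assoc k H H H t) := by
    intro t
    have : (TensorProduct.assoc k A B C).toLinearMap ∘ₗ
        TensorProduct.map (TensorProduct.map f g) l =
        TensorProduct.map f (TensorProduct.map g l) ∘ₗ
          (TensorProduct.assoc k H H H).toLinearMap := by
      ext; rfl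
    exact LinearMap.congr_fun this t
  have e2 : TensorProduct.map (TensorProduct.map f g ∘ₗ Coalgebra.comul (R := k)) l
      (Coalgebra.comul (R := k) h) = TensorProduct.map (TensorProduct.map f g) l
        ((Coalgebra.comul (R := k)).rTensor H (Coalgebra.comul (R := k) h)) := by
    rw [LinearMap.rTensor, TensorProduct.map_map, LinearMap.comp_id]
  have e3 : TensorProduct.map f (TensorProduct.map g l ∘ₗ Coalgebra.comul (R := k))
      (Coalgebra.comul (R := k) h) = TensorProduct.map f (TensorProduct.map g l)
        ((Coalgebra.comul (R := k)).lTensor H (Coalgebra.comul (R := k) h)) := by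
    rw [LinearMap.lTensor, TensorProduct.map_map, LinearMap.comp_id]
  rw [e2, e1, e3, Coalgebra.coassoc_apply]

lemma assocLin_tm {M N P : LMod k H} (m : M) (n : N) (p : P) :
    assocLin M N P (tm (tm m n : TensorT M N) p) = tm m (tm n p : TensorT N P) := by
  simp only [assocLin, LinearMap.comp_apply]
  rw [incl_tm, LinearMap.rTensor, TensorProduct.map_map, incl_orbit_tm, LinearMap.id_comp]
  erw [assoc_map_comul]
  rw [LinearMap.lTensor, TensorProduct.map_map, LinearMap.id_comp, ← orbit_tm, ← incl_tm, proj_incl]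

lemma assocInvLin_tm {M N P : LMod k H} (m : M) (n : N) (p : P) :
    assocInvLin M N P (tm m (tm n p : TensorT N P)) = tm (tm m n : TensorT M N) p := by
  simp only [assocInvLin, LinearMap.comp_apply]
  rw [incl_tm, LinearMap.lTensor, TensorProduct.map_map, incl_orbit_tm, LinearMap.id_comp, ← assoc_map_comul]
  erw [LinearEquiv.symm_apply_apply]
  rw [LinearMap.rTensor, TensorProduct.map_map, LinearMap.id_comp, ← orbit_tm, ← incl_tm, proj_incl]

lemma assocLin_proj {M N P : LMod k H} (x : (M ⊗[k] N) ⊗[k] P) :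
    assocLin M N P (proj (tensorObj M N) P ((proj M N).rTensor P x)) =
      proj M (tensorObj N P) ((proj N P).lTensor M (TensorProduct.assoc k M N P x)) := by
  have : assocLin M N P ∘ₗ proj (tensorObj M N) P ∘ₗ (proj M N).rTensor P =
      proj M (tensorObj N P) ∘ₗ (proj N P).lTensor M ∘ₗ
        (TensorProduct.assoc k M N P).toLinearMap := by
    ext m n p
    exact assocLin_tm m n p
  exact LinearMap.congr_fun this x

lemma tensorT_hom_ext₃ {M N P : LMod k H} {Q : Type*} [AddCommGroup Q] [Module k Q]
    {f g : TensorT (tensorObj M N) P →ₗ[k] Q}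
    (w : ∀ m n p, f (tm (tm m n : TensorT M N) p) = g (tm (tm m n : TensorT M N) p)) : f = g := by
  have : f ∘ₗ proj (tensorObj M N) P ∘ₗ (proj M N).rTensor P =
      g ∘ₗ proj (tensorObj M N) P ∘ₗ (proj M N).rTensor P := by
    ext m n p
    exact w m n p
  ext x
  obtain ⟨y, rfl⟩ := proj_surjective (tensorObj M N) P x
  obtain ⟨z, rfl⟩ := LinearMap.rTensor_surjective P (proj_surjective M N) y
  exact LinearMap.congr_fun this z

lemma assocLin_smul {M N P : LMod k H} (h : H) (x : TensorT (tensorObj M N) P) :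
    assocLin M N P (h • x) = h • assocLin M N P x := by
  have : assocLin M N P ∘ₗ (Algebra.lsmul k k (TensorT (tensorObj M N) P) h) =
      (Algebra.lsmul k k (TensorT M (tensorObj N P)) h) ∘ₗ assocLin M N P := by
    refine tensorT_hom_ext₃ fun m n p => ?_
    simp only [LinearMap.comp_apply, Algebra.lsmul_coe]
    rw [assocLin_tm, smul_tm, smul_tm, orbit_tm, orbit_tm]
    have e1 : TensorProduct.map (proj M N ∘ₗ TensorProduct.map (orbit M m) (orbit N n) ∘ₗ
        Coalgebra.comul (R := k)) (orbit P p) (Coalgebra.comul (R := k) h) =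
        (proj M N).rTensor P (TensorProduct.map (TensorProduct.map (orbit M m) (orbit N n) ∘ₗ
          Coalgebra.comul (R := k)) (orbit P p) (Coalgebra.comul (R := k) h)) := by
      rw [LinearMap.rTensor, TensorProduct.map_map, LinearMap.id_comp]
    have e2 : TensorProduct.map (orbit M m) (proj N P ∘ₗ TensorProduct.map (orbit N n)
        (orbit P p) ∘ₗ Coalgebra.comul (R := k)) (Coalgebra.comul (R := k) h) =
        (proj N P).lTensor M (TensorProduct.map (orbit M m)
          (TensorProduct.map (orbit N n) (orbit P p) ∘ₗ
          Coalgebra.comul (R := k)) (Coalgebra.comul (R := k) h)) := by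
      rw [LinearMap.lTensor, TensorProduct.map_map, LinearMap.id_comp]
    rw [e2, ← assoc_map_comul]
    erw [e1]
    exact assocLin_proj _
  exact LinearMap.congr_fun this x

end Modules

section Monoidal

open LMod

variable (k : Type u) (H : Type v) [CommRing k] [Ring H] [Algebra k H] [Coalgebra k H]

/-- The target space `H_t = Im(ε_t)`, as a type. -/
def TargetSpace : Type v := ↥(LinearMap.range (epsT k H))

instance : AddCommGroup (TargetSpace k H) :=
  inferInstanceAs (AddCommGroup ↥(LinearMap.range (epsT k H)))

instance : Module k (TargetSpace k H) :=
  inferInstanceAs (Module k ↥(LinearMap.range (epsT k H)))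

/-- The inclusion of the target space in `H`. -/
def tIncl : TargetSpace k H →ₗ[k] H := (LinearMap.range (epsT k H)).subtype

lemma tIncl_injective : Function.Injective (tIncl k H) :=
  (LinearMap.range (epsT k H)).injective_subtype

/-- The target map with values in the target space. -/
def tProj : H →ₗ[k] TargetSpace k H := (epsT k H).rangeRestrict

variable {k H}

@[simp] lemma tIncl_tProj (h : H) : tIncl k H (tProj k H h) = epsT k H h := rfl

lemma tProj_surjective : Function.Surjective (tProj k H) :=
  LinearMap.surjective_rangeRestrict _

/-- The action `h ⇀ z = ε_t(h z)` of `H` on `H_t`. -/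
instance : SMul H (TargetSpace k H) where
  smul h z := tProj k H (h * tIncl k H z)

lemma targetSpace_smul (h : H) (z : TargetSpace k H) : h • z = tProj k H (h * tIncl k H z) := rfl

variable [WeakBialgebra k H]

@[simp] lemma tProj_tIncl (z : TargetSpace k H) : tProj k H (tIncl k H z) = z := by
  obtain ⟨h, rfl⟩ := tProj_surjective z
  exact tIncl_injective k H (by simp [epsT_idem])

@[simp] lemma epsT_tIncl (z : TargetSpace k H) : epsT k H (tIncl k H z) = tIncl k H z := by
  rw [← tIncl_tProj, tProj_tIncl]

instance : Module H (TargetSpace k H) where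
  one_smul z := by rw [targetSpace_smul, one_mul, tProj_tIncl]
  mul_smul a b z := by
    apply tIncl_injective
    simp only [targetSpace_smul, tIncl_tProj, epsT_mul_epsT, mul_assoc]
  smul_zero a := by simp [targetSpace_smul]
  smul_add a x y := by simp [targetSpace_smul, mul_add]
  add_smul a b x := by simp [targetSpace_smul, add_mul]
  zero_smul x := by simp [targetSpace_smul]

instance : IsScalarTower k H (TargetSpace k H) where
  smul_assoc r a x := by simp [targetSpace_smul]

variable (k H) in
/-- The unit object `H_t`. -/
abbrev unitObj : LMod k H := ⟨TargetSpace k H⟩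

lemma orbit_unitObj (z : TargetSpace k H) (h : H) :
    orbit (unitObj k H) z h = tProj k H (h * tIncl k H z) := rfl

lemma tProj_epsT (h : H) : tProj k H (epsT k H h) = tProj k H h :=
  tIncl_injective k H (epsT_idem h)

variable (k H) in
/-- The element `1 = ε_t(1)` of `H_t`. -/
def tOne : TargetSpace k H := tProj k H 1

@[simp] lemma tIncl_tOne : tIncl k H (tOne k H) = 1 := epsT_one k

lemma smul_tOne (h : H) : h • tOne k H = tProj k H h := by
  rw [targetSpace_smul, tIncl_tOne, mul_one]

/-- `z ⊗ m ↦ z m`, from `H_t ⊗_t M` to `M`. -/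
def leftUnitLin (M : LMod k H) : TensorT (unitObj k H) M →ₗ[k] M :=
  TensorProduct.lift ((Algebra.lsmul k k M).toLinearMap ∘ₗ tIncl k H) ∘ₗ incl (unitObj k H) M

/-- `m ⊗ z ↦ ε̄_s(z) m`, from `M ⊗_t H_t` to `M`. -/
def rightUnitLin (M : LMod k H) : TensorT M (unitObj k H) →ₗ[k] M :=
  TensorProduct.lift ((Algebra.lsmul k k M).toLinearMap ∘ₗ epsSbar k H ∘ₗ tIncl k H).flip ∘ₗ
    incl M (unitObj k H)

/-- `m ↦ ε_t(1₍₁₎) ⊗ 1₍₂₎ m`. -/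
def leftUnitInvLin (M : LMod k H) : M →ₗ[k] TensorT (unitObj k H) M :=
  proj (unitObj k H) M ∘ₗ TensorProduct.mk k (TargetSpace k H) M (tOne k H)

/-- `m ↦ 1₍₁₎ m ⊗ 1₍₂₎`. -/
def rightUnitInvLin (M : LMod k H) : M →ₗ[k] TensorT M (unitObj k H) :=
  proj M (unitObj k H) ∘ₗ (TensorProduct.mk k M (TargetSpace k H)).flip (tOne k H)

lemma leftUnitInvLin_apply (M : LMod k H) (m : M) :
    leftUnitInvLin M m = (tm (tOne k H) m : TensorT (unitObj k H) M) := rfl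

lemma rightUnitInvLin_apply (M : LMod k H) (m : M) :
    rightUnitInvLin M m = (tm m (tOne k H) : TensorT M (unitObj k H)) := rfl

lemma leftUnitLin_smul_tm (M : LMod k H) (h : H) (z : TargetSpace k H) (m : M) :
    leftUnitLin M (h • (tm z m : TensorT (unitObj k H) M)) = (h * tIncl k H z) • m := by
  rw [leftUnitLin, LinearMap.comp_apply, incl_smul_tm]
  have h1 : ∀ t : H ⊗[k] H, TensorProduct.lift ((Algebra.lsmul k k M).toLinearMap ∘ₗ tIncl k H)
      (TensorProduct.map (tProj k H ∘ₗ LinearMap.mulRight k (tIncl k H z)) (orbit M m) t) =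
      LinearMap.mul' k H ((epsT k H ∘ₗ LinearMap.mulRight k (tIncl k H z)).rTensor H t) • m := by
    intro t
    obtain ⟨T, rfl⟩ := exists_repr t
    simp [Finset.sum_smul, mul_smul]
  refine (h1 _).trans ?_
  rw [epsT_comul_mul, epsT_tIncl]

lemma rightUnitLin_smul_tm (M : LMod k H) (h : H) (m : M) (z : TargetSpace k H) :
    rightUnitLin M (h • (tm m z : TensorT M (unitObj k H))) =
      (h * epsSbar k H (tIncl k H z)) • m := by
  rw [rightUnitLin, LinearMap.comp_apply, incl_smul_tm]
  have h1 : ∀ t : H ⊗[k] H,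
      TensorProduct.lift ((Algebra.lsmul k k M).toLinearMap ∘ₗ epsSbar k H ∘ₗ tIncl k H).flip
        (TensorProduct.map (orbit M m) (tProj k H ∘ₗ LinearMap.mulRight k (tIncl k H z)) t) =
      LinearMap.mul' k H (TensorProduct.comm k H H
        ((epsSbar k H ∘ₗ LinearMap.mulRight k (tIncl k H z)).lTensor H t)) • m := by
    intro t
    obtain ⟨T, rfl⟩ := exists_repr t
    simp [Finset.sum_smul, mul_smul, epsSbar_epsT]
  refine (h1 _).trans ?_
  rw [epsSbar_comul_mul]

@[simp] lemma leftUnitLin_tm (M : LMod k H) (z : TargetSpace k H) (m : M) :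
    leftUnitLin M (tm z m : TensorT (unitObj k H) M) = tIncl k H z • m := by
  simpa using leftUnitLin_smul_tm M 1 z m

@[simp] lemma rightUnitLin_tm (M : LMod k H) (m : M) (z : TargetSpace k H) :
    rightUnitLin M (tm m z : TensorT M (unitObj k H)) = epsSbar k H (tIncl k H z) • m := by
  simpa using rightUnitLin_smul_tm M 1 m z

lemma leftUnitLin_smul (M : LMod k H) (h : H) (x : TensorT (unitObj k H) M) :
    leftUnitLin M (h • x) = h • leftUnitLin M x := by
  have : leftUnitLin M ∘ₗ Algebra.lsmul k k (TensorT (unitObj k H) M) h =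
      Algebra.lsmul k k M h ∘ₗ leftUnitLin M := by
    refine tensorT_hom_ext fun z m => ?_
    simp only [LinearMap.comp_apply, Algebra.lsmul_coe]
    rw [leftUnitLin_smul_tm, leftUnitLin_tm, mul_smul]
  exact LinearMap.congr_fun this x

lemma rightUnitLin_smul (M : LMod k H) (h : H) (x : TensorT M (unitObj k H)) :
    rightUnitLin M (h • x) = h • rightUnitLin M x := by
  have : rightUnitLin M ∘ₗ Algebra.lsmul k k (TensorT M (unitObj k H)) h =
      Algebra.lsmul k k M h ∘ₗ rightUnitLin M := by
    refine tensorT_hom_ext fun m z => ?_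
    simp only [LinearMap.comp_apply, Algebra.lsmul_coe]
    rw [rightUnitLin_smul_tm, rightUnitLin_tm, mul_smul]
  exact LinearMap.congr_fun this x

/-- `ε̄_s(z) m ⊗_t n = m ⊗_t z n`. -/
lemma tm_epsSbar_smul {M N : LMod k H} (m : M) (n : N) (z : TargetSpace k H) :
    (tm (epsSbar k H (tIncl k H z) • m) n : TensorT M N) = tm m (tIncl k H z • n) := by
  apply incl_injective
  have h1 : ∀ (a b : H), incl M N (tm (a • m) (b • n)) =
      tensorAct k H M N (Coalgebra.comul (R := k) (1 : H) * (a ⊗ₜ b)) (m ⊗ₜ n) := by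
    intro a b
    rw [map_mul]; rfl
  have h2 := h1 (epsSbar k H (tIncl k H z)) 1
  have h3 := h1 1 (tIncl k H z)
  rw [one_smul] at h2 h3
  rw [h2, h3, comul_one_mul_epsSbar, epsT_tIncl]

lemma tm_tOne_smul {M : LMod k H} (m : M) (z : TargetSpace k H) :
    (tm (tOne k H) (tIncl k H z • m) : TensorT (unitObj k H) M) = tm z m := by
  apply incl_injective
  have h1 : ∀ t : H ⊗[k] H, ∀ (x : TargetSpace k H) (b : H),
      TensorProduct.map (tProj k H ∘ₗ LinearMap.mulRight k (tIncl k H x)) (orbit M (b • m)) t =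
      TensorProduct.map (tProj k H ∘ₗ tIncl k H ∘ₗ tProj k H) (orbit M m)
        (t * (tIncl k H x ⊗ₜ b)) := by
    intro t x b
    obtain ⟨T, rfl⟩ := exists_repr t
    simp [Finset.sum_mul, mul_smul, tProj_epsT]
  have h2 : ∀ t : H ⊗[k] H,
      TensorProduct.map (tProj k H ∘ₗ tIncl k H ∘ₗ tProj k H) (orbit M m) t =
      TensorProduct.map (tProj k H) (orbit M m) ((epsT k H).rTensor H t) := by
    intro t
    rw [LinearMap.rTensor, TensorProduct.map_map, LinearMap.comp_id]; rfl
  have h3 := h1 (Coalgebra.comul (R := k) (1 : H)) z 1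
  rw [one_smul] at h3
  rw [incl_tm, incl_tm]
  refine (h1 _ _ _).trans (Eq.trans ?_ h3.symm)
  rw [tIncl_tOne, h2, h2]
  have := epsT_comul_one_mul' (k := k) (tIncl k H z)
  rw [epsT_tIncl] at this
  rw [this]

/-- The associativity constraint. -/
def assocIso (M N P : LMod k H) :
    tensorObj (tensorObj M N) P ≅ tensorObj M (tensorObj N P) :=
  mkIso (assocLin M N P) (assocInvLin M N P) assocLin_smul
    (fun x => by
      have : assocInvLin M N P ∘ₗ assocLin M N P = LinearMap.id :=
        tensorT_hom_ext₃ fun m n p => by simp [assocLin_tm, assocInvLin_tm]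
      exact LinearMap.congr_fun this x)
    (fun x => by
      obtain ⟨y, rfl⟩ := proj_surjective M (tensorObj N P) x
      obtain ⟨z, rfl⟩ := LinearMap.lTensor_surjective M (proj_surjective N P) y
      have : assocLin M N P ∘ₗ assocInvLin M N P ∘ₗ proj M (tensorObj N P) ∘ₗ
          (proj N P).lTensor M = proj M (tensorObj N P) ∘ₗ (proj N P).lTensor M := by
        ext m n p
        change assocLin M N P (assocInvLin M N P (tm m (tm n p : TensorT N P))) =
          tm m (tm n p : TensorT N P)
        rw [assocInvLin_tm, assocLin_tm]
      exact LinearMap.congr_fun this z)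

/-- The left unit constraint. -/
def leftUnitIso (M : LMod k H) : tensorObj (unitObj k H) M ≅ M :=
  mkIso (leftUnitLin M) (leftUnitInvLin M) (leftUnitLin_smul M)
    (fun x => by
      have : leftUnitInvLin M ∘ₗ leftUnitLin M = LinearMap.id :=
        tensorT_hom_ext fun z m => by
          simp only [LinearMap.comp_apply, leftUnitLin_tm, leftUnitInvLin_apply, LinearMap.id_apply]
          exact tm_tOne_smul m z
      exact LinearMap.congr_fun this x)
    (fun m => by rw [leftUnitInvLin_apply, leftUnitLin_tm, tIncl_tOne, one_smul])

/-- The right unit constraint. -/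
def rightUnitIso (M : LMod k H) : tensorObj M (unitObj k H) ≅ M :=
  mkIso (rightUnitLin M) (rightUnitInvLin M) (rightUnitLin_smul M)
    (fun x => by
      have : rightUnitInvLin M ∘ₗ rightUnitLin M = LinearMap.id :=
        tensorT_hom_ext fun m z => by
          simp only [LinearMap.comp_apply, rightUnitLin_tm, rightUnitInvLin_apply,
            LinearMap.id_apply]
          rw [tm_epsSbar_smul (N := unitObj k H), targetSpace_smul, tIncl_tOne, mul_one,
            tProj_tIncl]
      exact LinearMap.congr_fun this x)
    (fun m => by rw [rightUnitInvLin_apply, rightUnitLin_tm, tIncl_tOne, epsSbar_one, one_smul])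

instance : MonoidalCategoryStruct (LMod k H) where
  tensorObj := tensorObj
  whiskerLeft M _ _ f := tensorMap (𝟙 M) f
  whiskerRight f N := tensorMap f (𝟙 N)
  tensorHom f g := tensorMap f g
  tensorUnit := unitObj k H
  associator := assocIso
  leftUnitor := leftUnitIso
  rightUnitor := rightUnitIso

lemma klin_tensorMap_tm {M M' N N' : LMod k H} (f : M ⟶ M') (g : N ⟶ N') (m : M) (n : N) :
    klin (tensorMap f g) (tm m n) = (tm (klin f m) (klin g n) : TensorT M' N') :=
  tensorLin_tm f g m n

lemma klin_assocIso_tm {M N P : LMod k H} (m : M) (n : N) (p : P) :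
    klin (assocIso M N P).hom (tm (tm m n : TensorT M N) p) = tm m (tm n p : TensorT N P) :=
  assocLin_tm m n p

lemma klin_leftUnitIso_tm (M : LMod k H) (z : TargetSpace k H) (m : M) :
    klin (leftUnitIso M).hom (tm z m : TensorT (unitObj k H) M) = tIncl k H z • m :=
  leftUnitLin_tm M z m

lemma klin_rightUnitIso_tm (M : LMod k H) (m : M) (z : TargetSpace k H) :
    klin (rightUnitIso M).hom (tm m z : TensorT M (unitObj k H)) =
      epsSbar k H (tIncl k H z) • m :=
  rightUnitLin_tm M m z

lemma hom_ext₂ {M N P : LMod k H} {f g : M ⊗ N ⟶ P}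
    (w : ∀ (m : M) (n : N), klin f (tm m n : TensorT M N) = klin g (tm m n : TensorT M N)) :
    f = g :=
  LMod.hom_ext (LinearMap.congr_fun (tensorT_hom_ext (f := klin f) (g := klin g) w))

lemma hom_ext₃ {M N P Q : LMod k H} {f g : (M ⊗ N) ⊗ P ⟶ Q}
    (w : ∀ (m : M) (n : N) (p : P),
      klin f (tm (tm m n : TensorT M N) p : TensorT (tensorObj M N) P) =
        klin g (tm (tm m n : TensorT M N) p : TensorT (tensorObj M N) P)) :
    f = g :=
  LMod.hom_ext (LinearMap.congr_fun (tensorT_hom_ext₃ (f := klin f) (g := klin g) w))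

lemma hom_ext₄ {M N P Q R : LMod k H} {f g : ((M ⊗ N) ⊗ P) ⊗ Q ⟶ R}
    (w : ∀ (m : M) (n : N) (p : P) (q : Q),
      klin f (tm (tm (tm m n : TensorT M N) p : TensorT (tensorObj M N) P) q :
        TensorT (tensorObj (tensorObj M N) P) Q) =
      klin g (tm (tm (tm m n : TensorT M N) p : TensorT (tensorObj M N) P) q :
        TensorT (tensorObj (tensorObj M N) P) Q)) :
    f = g := by
  refine hom_ext₃ (M := tensorObj M N) fun x p q => ?_
  obtain ⟨y, rfl⟩ := proj_surjective M N x
  induction y with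
  | zero => simp [tm]
  | tmul m n => exact w m n p q
  | add x y hx hy =>
    simp only [tm, map_add, TensorProduct.add_tmul] at hx hy ⊢
    rw [hx, hy]

/-- The monoidal category of left `H`-modules, with tensor product `⊗_t` and unit object `H_t`. -/
instance : MonoidalCategory (LMod k H) where
  tensorHom_def {M M' N N'} f g := hom_ext₂ fun m n => by
    change tensorLin f g (tm m n) = tensorLin (𝟙 M') g (tensorLin f (𝟙 N) (tm m n))
    simp
  id_tensorHom_id M N := hom_ext₂ fun m n => by
    change tensorLin (𝟙 M) (𝟙 N) (tm m n) = tm m n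
    simp
  tensorHom_comp_tensorHom f g f' g' := hom_ext₂ fun m n => by
    change tensorLin f' g' (tensorLin f g (tm m n)) = tensorLin (f ≫ f') (g ≫ g') (tm m n)
    simp
  whiskerLeft_id M N := hom_ext₂ fun m n => by
    change tensorLin (𝟙 M) (𝟙 N) (tm m n) = tm m n
    simp
  id_whiskerRight M N := hom_ext₂ fun m n => by
    change tensorLin (𝟙 M) (𝟙 N) (tm m n) = tm m n
    simp
  associator_naturality f g h := hom_ext₃ fun m n p => by
    change assocLin _ _ _ (tensorLin (tensorMap f g) h (tm (tm m n) p)) =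
      tensorLin f (tensorMap g h) (assocLin _ _ _ (tm (tm m n) p))
    rw [tensorLin_tm, klin_tensorMap_tm, assocLin_tm, assocLin_tm, tensorLin_tm,
      klin_tensorMap_tm]
  leftUnitor_naturality {M N} f := hom_ext₂ fun z m => by
    change leftUnitLin N (tensorLin (𝟙 (unitObj k H)) f (tm z m)) =
      klin f (leftUnitLin M (tm z m))
    rw [tensorLin_tm, leftUnitLin_tm, leftUnitLin_tm, klin_smul]
    rfl
  rightUnitor_naturality {M N} f := hom_ext₂ fun m z => by
    change rightUnitLin N (tensorLin f (𝟙 (unitObj k H)) (tm m z)) =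
      klin f (rightUnitLin M (tm m z))
    rw [tensorLin_tm, rightUnitLin_tm, rightUnitLin_tm, klin_smul]
    rfl
  pentagon M N P Q := hom_ext₄ fun m n p q => by
    change tensorLin (𝟙 M) (assocIso N P Q).hom (assocLin M (tensorObj N P) Q
        (tensorLin (assocIso M N P).hom (𝟙 Q) (tm (tm (tm m n) p) q))) =
      assocLin M N (tensorObj P Q) (assocLin (tensorObj M N) P Q (tm (tm (tm m n) p) q))
    rw [tensorLin_tm, klin_assocIso_tm, assocLin_tm, assocLin_tm, tensorLin_tm, assocLin_tm,
      klin_id, klin_id, LinearMap.id_apply, LinearMap.id_apply, klin_assocIso_tm]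
  triangle M N := hom_ext₃ fun m z n => by
    change tensorLin (𝟙 M) (leftUnitIso N).hom (assocLin M (unitObj k H) N (tm (tm m z) n)) =
      tensorLin (rightUnitIso M).hom (𝟙 N) (tm (tm m z) n)
    rw [assocLin_tm, tensorLin_tm, tensorLin_tm, klin_leftUnitIso_tm, klin_rightUnitIso_tm,
      tm_epsSbar_smul]
    rfl

end Monoidal

section RightCenter

universe v₁ u₁

/-- A right half-braiding on `X`: a natural family of isomorphisms `τ_U : U ⊗ X ≅ X ⊗ U`,
compatible with tensor products and with the unit object. -/
structure RightHalfBraiding {C : Type u₁} [Category.{v₁} C] [MonoidalCategory C] (X : C) where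
  τ : ∀ U : C, U ⊗ X ≅ X ⊗ U
  naturality : ∀ {U U' : C} (f : U ⟶ U'), (f ▷ X) ≫ (τ U').hom = (τ U).hom ≫ (X ◁ f)
  unit : (τ (𝟙_ C)).hom = (λ_ X).hom ≫ (ρ_ X).inv
  monoidal : ∀ U U' : C,
    (α_ U U' X).inv ≫ (τ (U ⊗ U')).hom ≫ (α_ X U U').inv =
      (U ◁ (τ U').hom) ≫ (α_ U X U').inv ≫ ((τ U).hom ▷ U')

/-- The objects of the right center `Z_r(C)`. (The left center `Z_l(C)` is Mathlib's
`CategoryTheory.Center`.) -/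
structure RightCenter (C : Type u₁) [Category.{v₁} C] [MonoidalCategory C] where
  X : C
  hb : RightHalfBraiding X

namespace RightCenter

variable {C : Type u₁} [Category.{v₁} C] [MonoidalCategory C]

/-- A morphism in the right center. -/
@[ext]
structure Hom (M N : RightCenter C) where
  f : M.X ⟶ N.X
  comm : ∀ U : C, (U ◁ f) ≫ (N.hb.τ U).hom = (M.hb.τ U).hom ≫ (f ▷ U)

instance : Category (RightCenter C) where
  Hom M N := Hom M N
  id M := ⟨𝟙 M.X, fun U => by simp⟩
  comp f g := ⟨f.f ≫ g.f, fun U => by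
    rw [MonoidalCategory.whiskerLeft_comp, Category.assoc, g.comm, ← Category.assoc, f.comm,
      Category.assoc, comp_whiskerRight]⟩

@[simp] lemma id_f (M : RightCenter C) : Hom.f (𝟙 M) = 𝟙 M.X := rfl

@[simp] lemma comp_f {M N P : RightCenter C} (f : M ⟶ N) (g : N ⟶ P) :
    (f ≫ g).f = f.f ≫ g.f := rfl

lemma ext' {M N : RightCenter C} {f g : M ⟶ N} (w : f.f = g.f) : f = g := Hom.ext w

variable (C) in
/-- The forgetful functor. -/
def forget : RightCenter C ⥤ C where
  obj M := M.X
  map f := f.f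

instance : (forget C).Faithful where
  map_injective w := ext' w

/-- An isomorphism in `C` compatible with the half-braidings is an isomorphism in the center. -/
def isoMk {M N : RightCenter C} (e : M.X ≅ N.X)
    (he : ∀ U : C, (U ◁ e.hom) ≫ (N.hb.τ U).hom = (M.hb.τ U).hom ≫ (e.hom ▷ U)) : M ≅ N where
  hom := ⟨e.hom, he⟩
  inv := ⟨e.inv, fun U => by
    rw [← cancel_epi (U ◁ e.hom), ← cancel_mono (e.hom ▷ U)]
    simp [he]⟩
  hom_inv_id := ext' e.hom_inv_id
  inv_hom_id := ext' e.inv_hom_id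

lemma monoidal' {X : C} (b : RightHalfBraiding X) (U U' : C) :
    (b.τ (U ⊗ U')).hom = (α_ U U' X).hom ≫ (U ◁ (b.τ U').hom) ≫ (α_ U X U').inv ≫
      ((b.τ U).hom ▷ U') ≫ (α_ X U U').hom := by
  have := b.monoidal U U'
  rw [Iso.inv_comp_eq, Iso.comp_inv_eq] at this
  simpa using this

/-- The tensor product of two right half-braidings. -/
def tensorHB {X Y : C} (a : RightHalfBraiding X) (b : RightHalfBraiding Y) :
    RightHalfBraiding (X ⊗ Y) where
  τ U := (α_ U X Y).symm ≪≫ whiskerRightIso (a.τ U) Y ≪≫ α_ X U Y ≪≫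
    whiskerLeftIso X (b.τ U) ≪≫ (α_ X Y U).symm
  naturality {U U'} f := by
    simp only [Iso.trans_hom, Iso.symm_hom, whiskerRightIso_hom, whiskerLeftIso_hom]
    calc
      _ = 𝟙 _ ⊗≫ ((f ▷ X ≫ (a.τ U').hom) ▷ Y) ⊗≫ X ◁ (b.τ U').hom ⊗≫ 𝟙 _ := by monoidal
      _ = 𝟙 _ ⊗≫ (a.τ U).hom ▷ Y ⊗≫ X ◁ (f ▷ Y ≫ (b.τ U').hom) ⊗≫ 𝟙 _ := by
        rw [a.naturality]; monoidal
      _ = _ := by rw [b.naturality]; monoidal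
  unit := by
    simp only [Iso.trans_hom, Iso.symm_hom, whiskerRightIso_hom, whiskerLeftIso_hom, a.unit,
      b.unit]
    monoidal
  monoidal U U' := by
    simp only [Iso.trans_hom, Iso.symm_hom, whiskerRightIso_hom, whiskerLeftIso_hom, monoidal']
    calc
      _ = 𝟙 _ ⊗≫ U ◁ (a.τ U').hom ▷ Y ⊗≫ ((a.τ U).hom ▷ (U' ⊗ Y) ≫
          (X ⊗ U) ◁ (b.τ U').hom) ⊗≫ X ◁ (b.τ U).hom ▷ U' ⊗≫ 𝟙 _ := by monoidal
      _ = _ := by rw [← whisker_exchange]; monoidal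

/-- The right half-braiding of the unit object. -/
def unitHB : RightHalfBraiding (𝟙_ C) where
  τ U := ρ_ U ≪≫ (λ_ U).symm
  naturality f := by simp
  unit := by simp only [Iso.trans_hom, Iso.symm_hom, unitors_equal, unitors_inv_equal]
  monoidal U U' := by
    simp only [Iso.trans_hom, Iso.symm_hom]
    monoidal

/-- The tensor product of two objects. -/
def tensor (M N : RightCenter C) : RightCenter C := ⟨M.X ⊗ N.X, tensorHB M.hb N.hb⟩

lemma whiskerLeft_comm (M : RightCenter C) {N N' : RightCenter C} (f : N ⟶ N') (U : C) :
    (U ◁ M.X ◁ f.f) ≫ ((tensorHB M.hb N'.hb).τ U).hom =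
      ((tensorHB M.hb N.hb).τ U).hom ≫ ((M.X ◁ f.f) ▷ U) := by
  simp only [tensorHB, Iso.trans_hom, Iso.symm_hom, whiskerRightIso_hom,
    whiskerLeftIso_hom]
  calc
    _ = 𝟙 _ ⊗≫ ((U ⊗ M.X) ◁ f.f ≫ (M.hb.τ U).hom ▷ N'.X) ⊗≫ M.X ◁ (N'.hb.τ U).hom ⊗≫
        𝟙 _ := by monoidal
    _ = 𝟙 _ ⊗≫ (M.hb.τ U).hom ▷ N.X ⊗≫ M.X ◁ (U ◁ f.f ≫ (N'.hb.τ U).hom) ⊗≫ 𝟙 _ := by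
      rw [whisker_exchange]; monoidal
    _ = _ := by rw [f.comm]; monoidal

lemma whiskerRight_comm {M M' : RightCenter C} (f : M ⟶ M') (N : RightCenter C) (U : C) :
    (U ◁ f.f ▷ N.X) ≫ ((tensorHB M'.hb N.hb).τ U).hom =
      ((tensorHB M.hb N.hb).τ U).hom ≫ ((f.f ▷ N.X) ▷ U) := by
  simp only [tensorHB, Iso.trans_hom, Iso.symm_hom, whiskerRightIso_hom,
    whiskerLeftIso_hom]
  calc
    _ = 𝟙 _ ⊗≫ (U ◁ f.f ≫ (M'.hb.τ U).hom) ▷ N.X ⊗≫ M'.X ◁ (N.hb.τ U).hom ⊗≫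
        𝟙 _ := by monoidal
    _ = 𝟙 _ ⊗≫ (M.hb.τ U).hom ▷ N.X ⊗≫ (f.f ▷ (U ⊗ N.X) ≫ M'.X ◁ (N.hb.τ U).hom) ⊗≫
        𝟙 _ := by
      rw [f.comm]; monoidal
    _ = _ := by rw [← whisker_exchange]; monoidal

lemma tensorHom_comm {M M' N N' : RightCenter C} (f : M ⟶ M') (g : N ⟶ N') (U : C) :
    (U ◁ (f.f ⊗ₘ g.f)) ≫ ((tensorHB M'.hb N'.hb).τ U).hom =
      ((tensorHB M.hb N.hb).τ U).hom ≫ ((f.f ⊗ₘ g.f) ▷ U) := by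
  rw [MonoidalCategory.tensorHom_def, MonoidalCategory.whiskerLeft_comp, Category.assoc,
    whiskerLeft_comm, ← Category.assoc, whiskerRight_comm, Category.assoc, ← comp_whiskerRight]

instance : MonoidalCategoryStruct (RightCenter C) where
  tensorObj M N := tensor M N
  whiskerLeft M {_ _} f := ⟨M.X ◁ f.f, whiskerLeft_comm M f⟩
  whiskerRight {_ _} f N := ⟨f.f ▷ N.X, whiskerRight_comm f N⟩
  tensorHom {M M' N N'} f g := ⟨f.f ⊗ₘ g.f, tensorHom_comm f g⟩
  tensorUnit := ⟨𝟙_ C, unitHB⟩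
  associator M N P := isoMk (α_ M.X N.X P.X) fun U => by
    simp only [tensor, tensorHB, Iso.trans_hom, Iso.symm_hom, whiskerRightIso_hom,
      whiskerLeftIso_hom]
    monoidal
  leftUnitor M := isoMk (λ_ M.X) fun U => by
    simp only [tensor, tensorHB, unitHB, Iso.trans_hom, Iso.symm_hom, whiskerRightIso_hom,
      whiskerLeftIso_hom]
    monoidal
  rightUnitor M := isoMk (ρ_ M.X) fun U => by
    simp only [tensor, tensorHB, unitHB, Iso.trans_hom, Iso.symm_hom, whiskerRightIso_hom,
      whiskerLeftIso_hom]
    monoidal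

instance : MonoidalCategory (RightCenter C) where
  tensorHom_def f g := ext' (MonoidalCategory.tensorHom_def f.f g.f)
  id_tensorHom_id M N := ext' (MonoidalCategory.id_tensorHom_id M.X N.X)
  tensorHom_comp_tensorHom f g f' g' :=
    ext' (MonoidalCategory.tensorHom_comp_tensorHom f.f g.f f'.f g'.f)
  whiskerLeft_id M N := ext' (MonoidalCategory.whiskerLeft_id M.X N.X)
  id_whiskerRight M N := ext' (MonoidalCategory.id_whiskerRight M.X N.X)
  associator_naturality f g h := ext' (MonoidalCategory.associator_naturality f.f g.f h.f)
  leftUnitor_naturality f := ext' (MonoidalCategory.leftUnitor_naturality f.f)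
  rightUnitor_naturality f := ext' (MonoidalCategory.rightUnitor_naturality f.f)
  pentagon M N P Q := ext' (MonoidalCategory.pentagon M.X N.X P.X Q.X)
  triangle M N := ext' (MonoidalCategory.triangle M.X N.X)

/-- The braiding `d_{M,N} = τ_{M,N}`, where `τ` is the half-braiding of `N`. -/
def braid (M N : RightCenter C) : M ⊗ N ≅ N ⊗ M :=
  isoMk (M := tensor M N) (N := tensor N M) (N.hb.τ M.X) fun U => by
    have h1 := N.hb.monoidal U M.X
    have h2 := N.hb.monoidal M.X U
    have h3 := N.hb.naturality (M.hb.τ U).hom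
    simp only [tensor, tensorHB, Iso.trans_hom, Iso.symm_hom, whiskerRightIso_hom,
      whiskerLeftIso_hom, Category.assoc]
    rw [← h2, ← reassoc_of% h1, Iso.inv_hom_id_assoc, Iso.hom_inv_id_assoc, ← reassoc_of% h3]

instance : BraidedCategory (RightCenter C) where
  braiding := braid
  braiding_naturality_right M {_ _} f := ext' (f.comm M.X)
  braiding_naturality_left f P := ext' (P.hb.naturality f.f)
  hexagon_forward M N P := ext' (by
    change (α_ M.X N.X P.X).hom ≫ ((tensorHB N.hb P.hb).τ M.X).hom ≫ (α_ N.X P.X M.X).hom =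
      ((N.hb.τ M.X).hom ▷ P.X) ≫ (α_ N.X M.X P.X).hom ≫ (N.X ◁ (P.hb.τ M.X).hom)
    simp [tensorHB])
  hexagon_reverse M N P := ext' (by
    change (α_ M.X N.X P.X).inv ≫ (P.hb.τ (M.X ⊗ N.X)).hom ≫ (α_ P.X M.X N.X).inv =
      (M.X ◁ (P.hb.τ N.X).hom) ≫ (α_ M.X P.X N.X).inv ≫ ((P.hb.τ M.X).hom ▷ N.X)
    exact P.hb.monoidal M.X N.X)

end RightCenter
end RightCenter

section YetterDrinfeld

open LMod

section Defs

variable {k : Type u} {H : Type v} [CommRing k] [Ring H] [Algebra k H] [Coalgebra k H]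

/-- A left-right Yetter-Drinfeld structure on a left `H`-module `M`: a right `H`-coaction
`ρ(m) = m₍₀₎ ⊗ m₍₁₎` with `ρ(m) ∈ M ⊗_t H` and
`h₍₁₎ m₍₀₎ ⊗ h₍₂₎ m₍₁₎ = (h₍₂₎ m)₍₀₎ ⊗ (h₍₂₎ m)₍₁₎ h₍₁₎`. -/
structure LRYDStr (M : LMod k H) where
  ρ : M →ₗ[k] M ⊗[k] H
  coassoc : ∀ m : M, TensorProduct.assoc k M H H (ρ.rTensor H (ρ m)) =
    (Coalgebra.comul (R := k)).lTensor M (ρ m)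
  counit : ∀ m : M, TensorProduct.rid k M ((Coalgebra.counit (R := k)).lTensor M (ρ m)) = m
  mem : ∀ m : M, ρ m ∈ tensorT M (regular k H)
  compat : ∀ (h : H) (m : M),
    tensorAct k H M (regular k H) (Coalgebra.comul (R := k) h) (ρ m) =
      (LinearMap.mul' k H).lTensor M (TensorProduct.assoc k M H H
        ((ρ ∘ₗ orbit M m).rTensor H
          (TensorProduct.comm k H H (Coalgebra.comul (R := k) h))))

/-- A left-left Yetter-Drinfeld structure on a left `H`-module `M`: a left `H`-coaction
`λ(m) = m₍₋₁₎ ⊗ m₍₀₎` with `λ(m) ∈ H ⊗_t M` and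
`h₍₁₎ m₍₋₁₎ ⊗ h₍₂₎ m₍₀₎ = (h₍₁₎ m)₍₋₁₎ h₍₂₎ ⊗ (h₍₁₎ m)₍₀₎`. -/
structure LLYDStr (M : LMod k H) where
  coact : M →ₗ[k] H ⊗[k] M
  coassoc : ∀ m : M, TensorProduct.assoc k H H M
      ((Coalgebra.comul (R := k)).rTensor M (coact m)) = coact.lTensor H (coact m)
  counit : ∀ m : M,
    TensorProduct.lid k M ((Coalgebra.counit (R := k)).rTensor M (coact m)) = m
  mem : ∀ m : M, coact m ∈ tensorT (regular k H) M
  compat : ∀ (h : H) (m : M),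
    tensorAct k H (regular k H) M (Coalgebra.comul (R := k) h) (coact m) =
      (LinearMap.mul' k H).rTensor M (TensorProduct.rightComm k H M H
        ((coact ∘ₗ orbit M m).rTensor H (Coalgebra.comul (R := k) h)))

variable (k H)

/-- Left-right Yetter-Drinfeld modules. -/
structure LRYD where
  X : LMod.{u, v} k H
  str : LRYDStr X

/-- Left-left Yetter-Drinfeld modules. -/
structure LLYD where
  X : LMod.{u, v} k H
  str : LLYDStr X

variable {k H}

/-- Morphisms of left-right Yetter-Drinfeld modules: `H`-linear and `H`-colinear maps. -/
@[ext]
structure LRYD.Hom (M N : LRYD k H) where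
  f : M.X ⟶ N.X
  colinear : ∀ m : M.X, N.str.ρ (klin f m) = (klin f).rTensor H (M.str.ρ m)

/-- Morphisms of left-left Yetter-Drinfeld modules: `H`-linear and `H`-colinear maps. -/
@[ext]
structure LLYD.Hom (M N : LLYD k H) where
  f : M.X ⟶ N.X
  colinear : ∀ m : M.X, N.str.coact (klin f m) = (klin f).lTensor H (M.str.coact m)

instance : Category (LRYD k H) where
  Hom M N := LRYD.Hom M N
  id M := ⟨𝟙 M.X, fun m => by simp⟩
  comp f g := ⟨f.f ≫ g.f, fun m => by
    rw [klin_comp, LinearMap.comp_apply, g.colinear, f.colinear, LinearMap.rTensor_comp]; rfl⟩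

instance : Category (LLYD k H) where
  Hom M N := LLYD.Hom M N
  id M := ⟨𝟙 M.X, fun m => by simp⟩
  comp f g := ⟨f.f ≫ g.f, fun m => by
    rw [klin_comp, LinearMap.comp_apply, g.colinear, f.colinear, LinearMap.lTensor_comp]; rfl⟩

end Defs

section Functors

variable {k : Type u} {H : Type v} [CommRing k] [Ring H] [Algebra k H] [Coalgebra k H]
  [WeakBialgebra k H]

/-- The functor `M ↦ (M, τ_{-,M})`, `f ↦ f`, given by a family of right half-braidings with
respect to which all morphisms of left-right Yetter-Drinfeld modules are morphisms of the
right center. -/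
def LRYD.toRightCenter (τ : ∀ M : LRYD k H, RightHalfBraiding M.X)
    (hτ : ∀ {M N : LRYD k H} (f : M ⟶ N) (U : LMod k H),
      (U ◁ f.f) ≫ ((τ N).τ U).hom = ((τ M).τ U).hom ≫ (f.f ▷ U)) :
    LRYD k H ⥤ RightCenter (LMod k H) where
  obj M := ⟨M.X, τ M⟩
  map f := ⟨f.f, hτ f⟩

/-- The functor `M ↦ (M, σ_{M,-})`, `f ↦ f`, given by a family of half-braidings with
respect to which all morphisms of left-left Yetter-Drinfeld modules are morphisms of the
left center. -/
def LLYD.toLeftCenter (σ : ∀ M : LLYD k H, HalfBraiding M.X)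
    (hσ : ∀ {M N : LLYD k H} (f : M ⟶ N) (U : LMod k H),
      (f.f ▷ U) ≫ ((σ N).β U).hom = ((σ M).β U).hom ≫ (U ◁ f.f)) :
    LLYD k H ⥤ Center (LMod k H) where
  obj M := ⟨M.X, σ M⟩
  map f := ⟨f.f, hσ f⟩

/-- The functor `(M, ρ) ↦ (M, λ)`, `f ↦ f`, given by a family of left-left Yetter-Drinfeld
structures with respect to which all morphisms of left-right Yetter-Drinfeld modules are
left colinear. -/
def LRYD.toLLYD (s : ∀ M : LRYD k H, LLYDStr M.X)
    (hs : ∀ {M N : LRYD k H} (f : M ⟶ N) (m : M.X),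
      (s N).coact (klin f.f m) = (klin f.f).lTensor H ((s M).coact m)) :
    LRYD k H ⥤ LLYD k H where
  obj M := ⟨M.X, s M⟩
  map f := ⟨f.f, hs f⟩

end Functors

end YetterDrinfeld

section Isomorphisms

universe v₁ v₂ u₁ u₂

/-- A functor that is an isomorphism of categories. -/
def IsCatIso {C : Type u₁} [Category.{v₁} C] {D : Type u₂} [Category.{v₂} D] (F : C ⥤ D) :
    Prop :=
  ∃ G : D ⥤ C, F ⋙ G = 𝟭 C ∧ G ⋙ F = 𝟭 D

/-- A functor that is an isomorphism of braided monoidal categories: an isomorphism of categories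
that preserves the unit object, the tensor product, the constraints and the braiding strictly. -/
structure IsBraidedMonoidalIso {C : Type u₁} [Category.{v₁} C] [MonoidalCategory C]
    {D : Type u₂} [Category.{v₂} D] [MonoidalCategory D]
    (bC : BraidedCategory C) (bD : BraidedCategory D) (F : C ⥤ D) : Prop where
  isCatIso : IsCatIso F
  strict : ∃ (hunit : 𝟙_ D = F.obj (𝟙_ C))
    (htensor : ∀ X Y : C, F.obj X ⊗ F.obj Y = F.obj (X ⊗ Y)) (_ : F.Braided),
    Functor.LaxMonoidal.ε F = eqToHom hunit ∧
      ∀ X Y : C, Functor.LaxMonoidal.μ F X Y = eqToHom (htensor X Y)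

end Isomorphisms

end WeakHopf

end

open WeakHopf WeakHopf.LMod

/-! A half-braiding amounts to a coaction. Every v ∈ V is the image of 1 under the H-linear map H →
V, h ↦ h v, so by naturality τ_{V,M} is determined by the elements τ_{H,M}(1 ⊗_t m) ∈ M ⊗_t H.
Calling such an element ρ(m) gives τ_{V,M}(v ⊗_t m) = m₍₀₎ ⊗ m₍₁₎ v (`RightHalfBraiding.incl_tm`).
In this dictionary the H-linearity of τ_{H,M} is the Yetter-Drinfeld condition, the tensor axiom at
the pair (H, H) is coassociativity, and the unit axiom is counitality. The left center is handled in
the same way.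

The substantial point is that the map defined by a coaction is invertible on ⊗_t. For a left-right
module the inverse is m ⊗ v ↦ S(m₍₁₎) v ⊗ m₍₀₎: by coassociativity the composites are, up to the
flip, m₍₀₎ ⊗ ε_s(m₍₁₎) v and m₍₀₎ ⊗ ε_t(m₍₁₎) v. On elements of the source and target spaces Δ is
known explicitly, and the Yetter-Drinfeld condition at these elements turns both composites into the
action of Δ(1) (`LRYDStr.lTensor_epsS`, `LRYDStr.lTensor_epsT`), which is the identity on ⊗_t. For a
left-left module the inverse involves S⁻¹, and ε̄_t, ε̄_s take the place of ε_s, ε_t. The identities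
for S⁻¹ follow by applying S, which needs antimultiplicativity (`anti_mul`). Here S is not a
convolution inverse of the identity, only a generalized one, so the usual uniqueness argument is run
with ε_s and ε_t as local units.

Finally, S(m₍₁₎) ⊗ m₍₀₎ is the value of τ_{H,M}⁻¹ at m ⊗_t 1, so λ is the coaction of the inverse
half-braiding. Inverting half-braidings is a strict functor from the left to the right center that
carries the reversed braiding to the braiding (`isStrictBraided_centerInverse`), and the functor to
the right center factors through it (`toRightCenterFunctor_eq`). The left-left category receives its
structure from the left center and the left-right category from the reversed left-left one.
Strictness over the right center is then a matter of composing strict functors. -/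

noncomputable section

namespace WeakHopf

/-! ### Source and target spaces of a weak bialgebra. -/

section WeakBialgebra

variable {k : Type u} {H : Type v} [CommRing k] [Ring H] [Algebra k H] [Coalgebra k H]

/-- The element `φ(1₍₂₎) 1₍₁₎`. -/
def sourceElt (φ : H →ₗ[k] k) : H :=
  TensorProduct.rid k H (φ.lTensor H (Coalgebra.comul (R := k) (1 : H)))

/-- The element `φ(1₍₁₎) 1₍₂₎`. -/
def targetElt (φ : H →ₗ[k] k) : H :=
  TensorProduct.lid k H (φ.rTensor H (Coalgebra.comul (R := k) (1 : H)))

/-- All four counital maps take values in slices of Δ(1) by a functional, so the formulas for Δ on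
their images need proof only for an arbitrary φ. -/
lemma epsT_eq_targetElt (h : H) :
    epsT k H h = targetElt (Coalgebra.counit (R := k) ∘ₗ LinearMap.mulRight k h) := by
  obtain ⟨S, hS⟩ := exists_repr (k := k) (Coalgebra.comul (R := k) (1 : H))
  simp [epsT_apply, targetElt, hS, Finset.sum_mul]

lemma epsS_eq_sourceElt (h : H) :
    epsS k H h = sourceElt (Coalgebra.counit (R := k) ∘ₗ LinearMap.mulLeft k h) := by
  obtain ⟨S, hS⟩ := exists_repr (k := k) (Coalgebra.comul (R := k) (1 : H))
  simp [epsS_apply, sourceElt, hS, Finset.mul_sum]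

lemma epsSbar_eq_sourceElt (h : H) :
    epsSbar k H h = sourceElt (Coalgebra.counit (R := k) ∘ₗ LinearMap.mulRight k h) := by
  obtain ⟨S, hS⟩ := exists_repr (k := k) (Coalgebra.comul (R := k) (1 : H))
  simp [epsSbar_apply, sourceElt, hS, Finset.sum_mul]

variable (k H) in
/-- The target map of the opposite weak bialgebra, `ε̄_t(h) = ε(h 1₍₁₎) 1₍₂₎`. -/
def epsTbar : H →ₗ[k] H :=
  counitL k H ∘ₗ LinearMap.mulRight k (Coalgebra.comul (R := k) (1 : H)) ∘ₗ
    (TensorProduct.mk k H H).flip 1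

lemma epsTbar_apply (h : H) :
    epsTbar k H h = counitL k H ((h ⊗ₜ 1) * Coalgebra.comul (R := k) (1 : H)) := by
  simp [epsTbar]

lemma epsTbar_eq_targetElt (h : H) :
    epsTbar k H h = targetElt (Coalgebra.counit (R := k) ∘ₗ LinearMap.mulLeft k h) := by
  obtain ⟨S, hS⟩ := exists_repr (k := k) (Coalgebra.comul (R := k) (1 : H))
  simp [epsTbar_apply, targetElt, hS, Finset.mul_sum]

variable [WeakBialgebra k H]

/-- Slicing the third leg commutes with applying Δ to the first. For t = Δ(1) the left side is a
slice of Δ²(1), to which either of the two axioms for Δ²(1) applies. -/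
lemma comul_sourceElt_aux (φ : H →ₗ[k] k) (t : H ⊗[k] H) :
    (TensorProduct.rid k H ∘ₗ φ.lTensor H).lTensor H (TensorProduct.assoc k H H H
      ((Coalgebra.comul (R := k)).rTensor H t)) =
      Coalgebra.comul (R := k) (TensorProduct.rid k H (φ.lTensor H t)) := by
  have e : ∀ s : (H ⊗[k] H) ⊗[k] H,
      (TensorProduct.rid k H ∘ₗ φ.lTensor H).lTensor H (TensorProduct.assoc k H H H s) =
      TensorProduct.rid k (H ⊗[k] H) (φ.lTensor (H ⊗[k] H) s) := by
    intro s
    have : (TensorProduct.rid k H ∘ₗ φ.lTensor H).lTensor H ∘ₗ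
        (TensorProduct.assoc k H H H).toLinearMap =
        (TensorProduct.rid k (H ⊗[k] H)).toLinearMap ∘ₗ φ.lTensor (H ⊗[k] H) := by
      ext a b c; simp
    exact LinearMap.congr_fun this s
  obtain ⟨T, rfl⟩ := exists_repr t
  simp [e]

/-- `Δ(x) = 1₍₁₎ ⊗ x 1₍₂₎` for `x = φ(1₍₂₎) 1₍₁₎`. -/
lemma comul_sourceElt (φ : H →ₗ[k] k) :
    Coalgebra.comul (R := k) (sourceElt φ) =
      ((1 : H) ⊗ₜ[k] sourceElt φ) * Coalgebra.comul (R := k) (1 : H) := by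
  obtain ⟨S, hS⟩ := exists_repr (k := k) (Coalgebra.comul (R := k) (1 : H))
  -- The two axioms for Δ²(1) differ in the order of the product in the middle leg: this one puts x
  -- to the left of 1₍₂₎, the other one, used in `comul_sourceElt'`, to the right.
  rw [sourceElt, ← comul_sourceElt_aux, WeakBialgebra.comul_one_right, hS]
  simp [TensorProduct.sum_tmul, TensorProduct.tmul_sum, Finset.mul_sum, Finset.sum_mul]

/-- `Δ(x) = 1₍₁₎ ⊗ 1₍₂₎ x` for `x = φ(1₍₂₎) 1₍₁₎`. -/
lemma comul_sourceElt' (φ : H →ₗ[k] k) :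
    Coalgebra.comul (R := k) (sourceElt φ) =
      Coalgebra.comul (R := k) (1 : H) * ((1 : H) ⊗ₜ[k] sourceElt φ) := by
  obtain ⟨S, hS⟩ := exists_repr (k := k) (Coalgebra.comul (R := k) (1 : H))
  rw [sourceElt, ← comul_sourceElt_aux, WeakBialgebra.comul_one_left, hS]
  simp [TensorProduct.sum_tmul, TensorProduct.tmul_sum, Finset.mul_sum, Finset.sum_mul,
    Finset.smul_sum]

lemma comul_targetElt_aux (φ : H →ₗ[k] k) (t : H ⊗[k] H) :
    TensorProduct.lid k (H ⊗[k] H) (φ.rTensor (H ⊗[k] H)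
      ((Coalgebra.comul (R := k)).lTensor H t)) =
      Coalgebra.comul (R := k) (TensorProduct.lid k H (φ.rTensor H t)) := by
  obtain ⟨T, rfl⟩ := exists_repr t
  simp

/-- `Δ(y) = 1₍₁₎ y ⊗ 1₍₂₎` for `y = φ(1₍₁₎) 1₍₂₎`. -/
lemma comul_targetElt (φ : H →ₗ[k] k) :
    Coalgebra.comul (R := k) (targetElt φ) =
      Coalgebra.comul (R := k) (1 : H) * (targetElt φ ⊗ₜ[k] (1 : H)) := by
  obtain ⟨S, hS⟩ := exists_repr (k := k) (Coalgebra.comul (R := k) (1 : H))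
  rw [targetElt, ← comul_targetElt_aux, comul_one_coassoc, WeakBialgebra.comul_one_right, hS]
  simp [TensorProduct.sum_tmul, TensorProduct.tmul_sum, Finset.mul_sum, Finset.sum_mul,
    TensorProduct.smul_tmul']

/-- `Δ(y) = y 1₍₁₎ ⊗ 1₍₂₎` for `y = φ(1₍₁₎) 1₍₂₎`. -/
lemma comul_targetElt' (φ : H →ₗ[k] k) :
    Coalgebra.comul (R := k) (targetElt φ) =
      (targetElt φ ⊗ₜ[k] (1 : H)) * Coalgebra.comul (R := k) (1 : H) := by
  obtain ⟨S, hS⟩ := exists_repr (k := k) (Coalgebra.comul (R := k) (1 : H))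
  rw [targetElt, ← comul_targetElt_aux, comul_one_coassoc, WeakBialgebra.comul_one_left, hS]
  simp [TensorProduct.sum_tmul, TensorProduct.tmul_sum, Finset.mul_sum, Finset.sum_mul,
    TensorProduct.smul_tmul']

/-- The source and the target spaces commute. -/
lemma sourceElt_mul_targetElt (φ ψ : H →ₗ[k] k) :
    sourceElt φ * targetElt ψ = targetElt ψ * sourceElt φ := by
  -- The two expressions for Δ(y) give 1₍₁₎ y ⊗ 1₍₂₎ = y 1₍₁₎ ⊗ 1₍₂₎; slicing the second leg by φ
  -- yields the commutation.
  have h := (comul_targetElt ψ).symm.trans (comul_targetElt' ψ)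
  obtain ⟨S, hS⟩ := exists_repr (k := k) (Coalgebra.comul (R := k) (1 : H))
  have := congrArg (fun t => TensorProduct.rid k H (φ.lTensor H t)) h
  rw [hS] at this
  rw [sourceElt, hS]
  simpa [Finset.mul_sum, Finset.sum_mul] using this

lemma epsS_mul_epsT (g h : H) : epsS k H g * epsT k H h = epsT k H h * epsS k H g := by
  rw [epsS_eq_sourceElt, epsT_eq_targetElt, sourceElt_mul_targetElt]

/-- `1₍₁₎ ⊗ ε_t(1₍₂₎) = 1₍₁₎ ⊗ 1₍₂₎`. -/
lemma lTensor_epsT_comul_one : (epsT k H).lTensor H (Coalgebra.comul (R := k) (1 : H)) =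
    Coalgebra.comul (R := k) (1 : H) := by
  obtain ⟨S, hS⟩ := exists_repr (k := k) (Coalgebra.comul (R := k) (1 : H))
  have h := (comul_one_coassoc (k := k) (H := H)).trans WeakBialgebra.comul_one_right
  -- Applying ε to the middle leg of Δ²(1) = 1₍₁₎ ⊗ 1₍₁'₎ 1₍₂₎ ⊗ 1₍₂'₎ gives Δ(1) by counitality,
  -- and 1₍₁₎ ⊗ ε_t(1₍₂₎) by the definition of ε_t.
  have := congrArg (fun t => (counitL k H).lTensor H t) h
  have e : ∀ t : H ⊗[k] H, (counitL k H).lTensor H ((Coalgebra.comul (R := k)).lTensor H t) =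
      t := by
    intro t
    obtain ⟨T, rfl⟩ := exists_repr t
    simp [counitL_comul]
  simp only [e] at this
  refine Eq.trans ?_ this.symm
  rw [hS]
  simp [epsT_apply, hS, TensorProduct.sum_tmul, TensorProduct.tmul_sum, Finset.mul_sum,
    Finset.sum_mul]

/-- `ε̄_s(1₍₁₎) ⊗ 1₍₂₎ = 1₍₁₎ ⊗ 1₍₂₎`. -/
lemma rTensor_epsSbar_comul_one :
    (epsSbar k H).rTensor H (Coalgebra.comul (R := k) (1 : H)) =
      Coalgebra.comul (R := k) (1 : H) := by
  obtain ⟨S, hS⟩ := exists_repr (k := k) (Coalgebra.comul (R := k) (1 : H))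
  have h := (comul_one_coassoc (k := k) (H := H)).trans WeakBialgebra.comul_one_left
  -- With the other order in the middle leg, ε(1₍₂₎ 1₍₁'₎) 1₍₁₎ is ε̄_s(1₍₁'₎).
  have := congrArg (fun t => (counitL k H).lTensor H t) h
  have e : ∀ t : H ⊗[k] H, (counitL k H).lTensor H ((Coalgebra.comul (R := k)).lTensor H t) =
      t := by
    intro t
    obtain ⟨T, rfl⟩ := exists_repr t
    simp [counitL_comul]
  simp only [e] at this
  refine Eq.trans ?_ this.symm
  rw [hS]
  simp [epsSbar_apply, hS, TensorProduct.sum_tmul, TensorProduct.tmul_sum, Finset.mul_sum,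
    Finset.sum_mul, TensorProduct.smul_tmul]

/-- This is weak multiplicativity of ε with middle argument 1: ε(h 1₍₂₎) ε(1₍₁₎ g) = ε(h g). -/
lemma counit_epsS_mul (h g : H) :
    Coalgebra.counit (R := k) (epsS k H h * g) = Coalgebra.counit (R := k) (h * g) := by
  obtain ⟨S, hS⟩ := exists_repr (k := k) (Coalgebra.comul (R := k) (1 : H))
  have := WeakBialgebra.counit_mul_right (k := k) h 1 g
  rw [hS] at this
  rw [epsS_apply, hS]
  simp [Finset.sum_mul, Finset.mul_sum, mul_comm] at this ⊢
  rw [this]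

lemma epsS_epsS_mul (h g : H) : epsS k H (epsS k H h * g) = epsS k H (h * g) := by
  obtain ⟨S, hS⟩ := exists_repr (k := k) (Coalgebra.comul (R := k) (1 : H))
  rw [epsS_apply, epsS_apply (h * g), hS]
  simp [Finset.mul_sum, mul_assoc, counit_epsS_mul]

/-- `ε_t ∘ ε̄_s = ε_t`. -/
lemma epsT_epsSbar (h : H) : epsT k H (epsSbar k H h) = epsT k H h := by
  obtain ⟨S, hS⟩ := exists_repr (k := k) (Coalgebra.comul (R := k) (1 : H))
  have e : ∀ p : H, Coalgebra.counit (R := k) (p * epsSbar k H h) =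
      Coalgebra.counit (R := k) (p * h) := by
    intro p
    have := WeakBialgebra.counit_mul_left (k := k) p 1 h
    rw [hS] at this
    rw [epsSbar_apply, hS]
    simp [Finset.sum_mul, Finset.mul_sum, mul_comm] at this ⊢
    rw [this]
  rw [epsT_apply, epsT_apply h, hS]
  simp [Finset.sum_mul, e]

/-- `ε_s ∘ ε̄_t = ε_s`. -/
lemma epsS_epsTbar (h : H) : epsS k H (epsTbar k H h) = epsS k H h := by
  obtain ⟨S, hS⟩ := exists_repr (k := k) (Coalgebra.comul (R := k) (1 : H))
  have e : ∀ p : H, Coalgebra.counit (R := k) (epsTbar k H h * p) =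
      Coalgebra.counit (R := k) (h * p) := by
    intro p
    have := WeakBialgebra.counit_mul_left (k := k) h 1 p
    rw [hS] at this
    rw [epsTbar_apply, hS]
    simp [Finset.sum_mul, Finset.mul_sum] at this ⊢
    rw [this]
  rw [epsS_apply, epsS_apply h, hS]
  simp [Finset.mul_sum, e]

variable (k) in
lemma epsS_one : epsS k H 1 = 1 := by
  rw [epsS_apply, ← Algebra.TensorProduct.one_def, one_mul, counitR_comul]

end WeakBialgebra

/-! ### Antimultiplicativity of the antipode and its values on the source and target spaces. -/

section Antipode

open WithConv

variable {k : Type u} {H : Type v} [CommRing k] [Ring H] [Algebra k H] [Coalgebra k H]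
  [WeakHopfAlgebra k H]

variable (k H) in
/-- The antipode. -/
abbrev anti : H →ₗ[k] H := WeakHopfAlgebra.antipode (k := k) (H := H)

/-- The antipode axioms are restated in the convolution algebra of H, where associativity of the
product is available. -/
lemma toConv_anti_mul_id : toConv (anti k H) * toConv LinearMap.id = toConv (epsS k H) := by
  ext h
  exact WeakHopfAlgebra.antipode_mul_id h

lemma toConv_id_mul_anti : toConv LinearMap.id * toConv (anti k H) = toConv (epsT k H) := by
  ext h
  exact WeakHopfAlgebra.id_mul_antipode h

lemma toConv_epsS_mul_anti : toConv (epsS k H) * toConv (anti k H) = toConv (anti k H) := by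
  rw [← toConv_anti_mul_id]
  ext h
  exact WeakHopfAlgebra.antipode_mul_id_mul_antipode h

lemma toConv_anti_mul_epsT : toConv (anti k H) * toConv (epsT k H) = toConv (anti k H) := by
  rw [← toConv_id_mul_anti, ← mul_assoc, toConv_anti_mul_id, toConv_epsS_mul_anti]

/-- `S(h₍₁₎) ε_t(h₍₂₎) = S(h)`. -/
lemma anti_mul_epsT (h : H) : LinearMap.mul' k H (TensorProduct.map (anti k H) (epsT k H)
    (Coalgebra.comul (R := k) h)) = anti k H h :=
  congrArg (fun f : WithConv (H →ₗ[k] H) => f.ofConv h) (toConv_anti_mul_epsT (k := k) (H := H))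

/-- `ε_s(h₍₁₎) S(h₍₂₎) = S(h)`. -/
lemma epsS_mul_anti (h : H) : LinearMap.mul' k H (TensorProduct.map (epsS k H) (anti k H)
    (Coalgebra.comul (R := k) h)) = anti k H h :=
  congrArg (fun f : WithConv (H →ₗ[k] H) => f.ofConv h) (toConv_epsS_mul_anti (k := k) (H := H))

/-- `ε_t(h g) = h₍₁₎ ε_t(g) S(h₍₂₎)`. -/
lemma epsT_mul (h g : H) : epsT k H (h * g) = LinearMap.mul' k H (TensorProduct.map
    (LinearMap.mulRight k (epsT k H g)) (anti k H) (Coalgebra.comul (R := k) h)) := by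
  -- For z = ε_t(g) one has ε_t(h g) = ε_t(h z), and Δ(h z) = Δ(h) Δ(1) (z ⊗ 1) = h₍₁₎ z ⊗ h₍₂₎;
  -- then ε_t = id * S applies.
  rw [← epsT_mul_epsT, ← WeakHopfAlgebra.id_mul_antipode, comul_mul, epsT_eq_targetElt g,
    comul_targetElt, ← mul_assoc, ← comul_mul, mul_one]
  obtain ⟨T, hT⟩ := exists_repr (k := k) (Coalgebra.comul (R := k) h)
  simp [hT, Finset.sum_mul]

/-- `ε_s(h g) = S(g₍₁₎) ε_s(h) g₍₂₎`. -/
lemma epsS_mul (h g : H) : epsS k H (h * g) = LinearMap.mul' k H (TensorProduct.map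
    (anti k H) (LinearMap.mulLeft k (epsS k H h)) (Coalgebra.comul (R := k) g)) := by
  rw [← epsS_epsS_mul, ← WeakHopfAlgebra.antipode_mul_id, comul_mul, epsS_eq_sourceElt h,
    comul_sourceElt, mul_assoc, ← comul_mul, one_mul]
  obtain ⟨T, hT⟩ := exists_repr (k := k) (Coalgebra.comul (R := k) g)
  simp [hT, Finset.mul_sum]

lemma toConv_mul_apply_tmul (f g : H ⊗[k] H →ₗ[k] H) (a b : H) :
    (toConv f * toConv g).ofConv (a ⊗ₜ b) = LinearMap.mul' k H (TensorProduct.map f g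
      (TensorProduct.tensorTensorTensorComm k H H H H
        (Coalgebra.comul (R := k) a ⊗ₜ Coalgebra.comul (R := k) b))) := rfl

variable (k H) in
/-- `h ⊗ g ↦ S(g) S(h)`. -/
def antiSwap : H ⊗[k] H →ₗ[k] H :=
  LinearMap.mul' k H ∘ₗ (TensorProduct.comm k H H).toLinearMap ∘ₗ
    TensorProduct.map (anti k H) (anti k H)

@[simp] lemma antiSwap_tmul (a b : H) : antiSwap k H (a ⊗ₜ b) = anti k H b * anti k H a := rfl

/-- In a₍₁₎ b₍₁₎ S(b₍₂₎) S(a₍₂₎) the inner product is ε_t(b), and a₍₁₎ ε_t(b) S(a₍₂₎) = ε_t(a b) by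
`epsT_mul`. -/
lemma mul_conv_antiSwap : toConv (LinearMap.mul' k H) * toConv (antiSwap k H) =
    toConv (epsT k H ∘ₗ LinearMap.mul' k H) := by
  apply ofConv_injective
  refine TensorProduct.ext' fun a b => ?_
  rw [toConv_mul_apply_tmul]
  obtain ⟨S, hS⟩ := exists_repr (k := k) (Coalgebra.comul (R := k) a)
  obtain ⟨T, hT⟩ := exists_repr (k := k) (Coalgebra.comul (R := k) b)
  have h1 := WeakHopfAlgebra.id_mul_antipode (k := k) b
  change _ = epsT k H (a * b)
  rw [epsT_mul, ← h1, hS, hT]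
  simp only [TensorProduct.sum_tmul, TensorProduct.tmul_sum, map_sum]
  rw [Finset.sum_comm]
  simp [Finset.mul_sum, Finset.sum_mul, mul_assoc]

/-- Mirror image of `mul_conv_antiSwap`: S(b₍₁₎) S(a₍₁₎) a₍₂₎ b₍₂₎ = S(b₍₁₎) ε_s(a) b₍₂₎ = ε_s(a b).
-/
lemma antiSwap_conv_mul : toConv (antiSwap k H) * toConv (LinearMap.mul' k H) =
    toConv (epsS k H ∘ₗ LinearMap.mul' k H) := by
  apply ofConv_injective
  refine TensorProduct.ext' fun a b => ?_
  rw [toConv_mul_apply_tmul]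
  obtain ⟨S, hS⟩ := exists_repr (k := k) (Coalgebra.comul (R := k) a)
  obtain ⟨T, hT⟩ := exists_repr (k := k) (Coalgebra.comul (R := k) b)
  have h1 := WeakHopfAlgebra.antipode_mul_id (k := k) a
  change _ = epsS k H (a * b)
  rw [epsS_mul, ← h1, hS, hT]
  simp [TensorProduct.sum_tmul, TensorProduct.tmul_sum, Finset.sum_mul, mul_assoc]

/-- Since Δ is multiplicative, precomposition with the multiplication respects convolution. It need
not respect the convolution units, because ε need not be multiplicative. -/
lemma comp_mul_conv (f g : H →ₗ[k] H) :
    toConv (f ∘ₗ LinearMap.mul' k H) * toConv (g ∘ₗ LinearMap.mul' k H) =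
      toConv ((toConv f * toConv g).ofConv ∘ₗ LinearMap.mul' k H) := by
  apply ofConv_injective
  refine TensorProduct.ext' fun a b => ?_
  rw [toConv_mul_apply_tmul]
  change _ = LinearMap.mul' k H (TensorProduct.map f g (Coalgebra.comul (R := k) (a * b)))
  rw [comul_mul]
  obtain ⟨S, hS⟩ := exists_repr (k := k) (Coalgebra.comul (R := k) a)
  obtain ⟨T, hT⟩ := exists_repr (k := k) (Coalgebra.comul (R := k) b)
  rw [hS, hT]
  simp [TensorProduct.sum_tmul, TensorProduct.tmul_sum, Finset.mul_sum, Finset.sum_mul]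

/-- `S(h₍₁₎) x ε_t(h₍₂₎) = S(h) x` for `x = ε_s(g)`. -/
lemma anti_mul_epsS_mul_epsT (g h : H) :
    LinearMap.mul' k H (TensorProduct.map (anti k H)
      (LinearMap.mulLeft k (epsS k H g) ∘ₗ epsT k H) (Coalgebra.comul (R := k) h)) =
      anti k H h * epsS k H g := by
  have h1 := anti_mul_epsT (k := k) h
  rw [← h1]
  obtain ⟨S, hS⟩ := exists_repr (k := k) (Coalgebra.comul (R := k) h)
  -- The source element ε_s(g) commutes with ε_t(h₍₂₎), so it moves to the right end and S * ε_t = S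
  -- remains.
  simp [hS, Finset.sum_mul, epsS_mul_epsT, mul_assoc]

/-- The left side equals (ε_s ∘ μ) * `antiSwap`, where μ is the multiplication; its value is
ε_s(a₍₁₎ b₍₁₎) S(b₍₂₎) S(a₍₂₎). Expanding ε_s by `epsS_mul` and commuting source past target gives
ε_s(x b₍₁₎) S(b₍₂₎) = S(b₍₁₎) ε_s(x) ε_t(b₍₂₎) = S(b) ε_s(x). With x = a₍₁₎, the identity ε_s * S =
S finishes the computation. -/
lemma antiSwap_conv_epsT : toConv (antiSwap k H) * toConv (epsT k H ∘ₗ LinearMap.mul' k H) =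
    toConv (antiSwap k H) := by
  rw [← mul_conv_antiSwap, ← mul_assoc]
  apply ofConv_injective
  refine TensorProduct.ext' fun a b => ?_
  rw [antiSwap_conv_mul, toConv_mul_apply_tmul]
  obtain ⟨S, hS⟩ := exists_repr (k := k) (Coalgebra.comul (R := k) a)
  -- expand `S(b₍₁₎) ε_s(x) b₍₂₎ S(b₍₃₎)` with the convolution product of `H`
  have h1 : ∀ x : H, LinearMap.mul' k H (TensorProduct.map
      (epsS k H ∘ₗ LinearMap.mulLeft k x) (anti k H) (Coalgebra.comul (R := k) b)) =
      anti k H b * epsS k H x := by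
    intro x
    have e1 : toConv (epsS k H ∘ₗ LinearMap.mulLeft k x) =
        toConv (anti k H) * toConv (LinearMap.mulLeft k (epsS k H x)) := by
      ext c
      exact epsS_mul x c
    have e2 : toConv (LinearMap.mulLeft k (epsS k H x)) * toConv (anti k H) =
        toConv (LinearMap.mulLeft k (epsS k H x) ∘ₗ epsT k H) := by
      ext c
      change LinearMap.mul' k H (TensorProduct.map _ _ _) = epsS k H x * epsT k H c
      rw [← WeakHopfAlgebra.id_mul_antipode]
      obtain ⟨T, hT⟩ := exists_repr (k := k) (Coalgebra.comul (R := k) c)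
      simp [hT, Finset.mul_sum, mul_assoc]
    change (toConv (epsS k H ∘ₗ LinearMap.mulLeft k x) * toConv (anti k H)).ofConv b = _
    rw [e1, mul_assoc, e2]
    exact anti_mul_epsS_mul_epsT x b
  have h2 : ∀ x y : H, LinearMap.mul' k H (TensorProduct.map (epsS k H ∘ₗ LinearMap.mul' k H)
      (antiSwap k H) (TensorProduct.tensorTensorTensorComm k H H H H
        ((x ⊗ₜ y) ⊗ₜ Coalgebra.comul (R := k) b))) = anti k H b * epsS k H x * anti k H y := by
    intro x y
    rw [← h1]
    obtain ⟨T, hT⟩ := exists_repr (k := k) (Coalgebra.comul (R := k) b)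
    simp [hT, TensorProduct.tmul_sum, Finset.sum_mul, mul_assoc]
  have h3 := epsS_mul_anti (k := k) a
  change _ = anti k H b * anti k H a
  rw [← h3, hS]
  simp only [TensorProduct.sum_tmul, map_sum, h2]
  simp [Finset.mul_sum, mul_assoc]

/-- The antipode is antimultiplicative. -/
theorem anti_mul (a b : H) : anti k H (a * b) = anti k H b * anti k H a := by
  -- Uniqueness of generalized inverses, with μ the multiplication: S∘μ = (ε_s∘μ) * (S∘μ) =
  -- `antiSwap` * μ * (S∘μ) = `antiSwap` * (ε_t∘μ) = `antiSwap`.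
  have h : toConv (anti k H ∘ₗ LinearMap.mul' k H) = toConv (antiSwap k H) := by
    have e1 := comp_mul_conv (k := k) (H := H) (epsS k H) (anti k H)
    rw [toConv_epsS_mul_anti] at e1
    have e2 := comp_mul_conv (k := k) (H := H) LinearMap.id (anti k H)
    rw [toConv_id_mul_anti, LinearMap.id_comp] at e2
    have e3 : toConv (anti k H ∘ₗ LinearMap.mul' k H) =
        toConv (epsS k H ∘ₗ LinearMap.mul' k H) * toConv (anti k H ∘ₗ LinearMap.mul' k H) :=
      e1.symm
    rw [e3, ← antiSwap_conv_mul, mul_assoc, e2]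
    exact antiSwap_conv_epsT
  exact congrArg (fun f : WithConv (H ⊗[k] H →ₗ[k] H) => f.ofConv (a ⊗ₜ b)) h

variable (k) in
/-- `S(1₍₁₎) 1₍₂₎ = 1`. -/
lemma anti_comul_one : LinearMap.mul' k H ((anti k H).rTensor H
    (Coalgebra.comul (R := k) (1 : H))) = 1 := by
  rw [WeakHopfAlgebra.antipode_mul_id, epsS_one]

/-- `S ∘ ε̄_t = ε_s`. -/
lemma anti_epsTbar (h : H) : anti k H (epsTbar k H h) = epsS k H h := by
  -- For y = ε̄_t(h), Δ(y) = 1₍₁₎ y ⊗ 1₍₂₎, so ε_s(h) = ε_s(y) = S(1₍₁₎ y) 1₍₂₎ = S(y) S(1₍₁₎) 1₍₂₎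
  -- = S(y).
  rw [← epsS_epsTbar, ← WeakHopfAlgebra.antipode_mul_id, epsTbar_eq_targetElt, comul_targetElt]
  obtain ⟨S, hS⟩ := exists_repr (k := k) (Coalgebra.comul (R := k) (1 : H))
  have h1 := anti_comul_one (k := k) (H := H)
  rw [hS] at h1 ⊢
  have h2 := congrArg (anti k H (targetElt (Coalgebra.counit (R := k) ∘ₗ
    LinearMap.mulLeft k h)) * ·) h1
  simpa [Finset.sum_mul, Finset.mul_sum, anti_mul, mul_assoc] using h2.symm

/-- `S ∘ ε̄_s = ε_t`. -/
lemma anti_epsSbar (h : H) : anti k H (epsSbar k H h) = epsT k H h := by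
  rw [← epsT_epsSbar, ← WeakHopfAlgebra.id_mul_antipode, epsSbar_eq_sourceElt, comul_sourceElt]
  obtain ⟨S, hS⟩ := exists_repr (k := k) (Coalgebra.comul (R := k) (1 : H))
  have h1 := WeakHopfAlgebra.id_mul_antipode (k := k) (1 : H)
  rw [epsT_one, hS] at h1
  rw [hS]
  have h2 := congrArg (· * anti k H (sourceElt (Coalgebra.counit (R := k) ∘ₗ
    LinearMap.mulRight k h))) h1
  simpa [Finset.sum_mul, Finset.mul_sum, anti_mul, mul_assoc] using h2.symm

variable (hS : Function.Bijective (anti k H))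

/-- The inverse of the antipode. -/
def antiInv : H →ₗ[k] H := (LinearEquiv.ofBijective (anti k H) hS).symm

@[simp] lemma anti_antiInv (h : H) : anti k H (antiInv hS h) = h :=
  (LinearEquiv.ofBijective (anti k H) hS).apply_symm_apply h

/-- `S⁻¹(h₍₂₎) h₍₁₎ = ε̄_t(h)`. -/
lemma antiInv_mul_comul (h : H) :
    LinearMap.mul' k H ((antiInv hS).rTensor H (TensorProduct.comm k H H
      (Coalgebra.comul (R := k) h))) = epsTbar k H h := by
  -- Under S the left side becomes S(h₍₁₎) h₍₂₎ = ε_s(h), which is also S(ε̄_t(h)).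
  apply hS.1
  rw [anti_epsTbar, ← WeakHopfAlgebra.antipode_mul_id]
  obtain ⟨T, hT⟩ := exists_repr (k := k) (Coalgebra.comul (R := k) h)
  simp [hT, anti_mul]

/-- `h₍₂₎ S⁻¹(h₍₁₎) = ε̄_s(h)`. -/
lemma comul_mul_antiInv (h : H) :
    LinearMap.mul' k H ((antiInv hS).lTensor H (TensorProduct.comm k H H
      (Coalgebra.comul (R := k) h))) = epsSbar k H h := by
  apply hS.1
  rw [anti_epsSbar, ← WeakHopfAlgebra.id_mul_antipode]
  obtain ⟨T, hT⟩ := exists_repr (k := k) (Coalgebra.comul (R := k) h)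
  simp [hT, anti_mul]

end Antipode

/-! ### Twists by a coaction, and their composition. -/

section Twist

variable {k : Type u} {H : Type v} [CommRing k] [Ring H] [Algebra k H]

/-- The action map `h ⊗ v ↦ h v`. -/
def actLin (V : LMod k H) : H ⊗[k] V →ₗ[k] V :=
  TensorProduct.lift (Algebra.lsmul k k V).toLinearMap

@[simp] lemma actLin_tmul (V : LMod k H) (h : H) (v : V) : actLin V (h ⊗ₜ v) = h • v := rfl

/-- The map `m ⊗ v ↦ m₍₀₎ ⊗ m₍₁₎ v`, where `θ(m) = m₍₀₎ ⊗ m₍₁₎`. -/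
def twist {M : LMod k H} (θ : M →ₗ[k] M ⊗[k] H) (V : LMod k H) : M ⊗[k] V →ₗ[k] M ⊗[k] V :=
  (actLin V).lTensor M ∘ₗ (TensorProduct.assoc k M H V).toLinearMap ∘ₗ θ.rTensor V

lemma twist_tmul {M : LMod k H} (θ : M →ₗ[k] M ⊗[k] H) (V : LMod k H) (m : M) (v : V) :
    twist θ V (m ⊗ₜ v) = (orbit V v).lTensor M (θ m) := by
  simp only [twist, LinearMap.comp_apply, LinearMap.rTensor_tmul]
  induction θ m with
  | zero => simp
  | add x y hx hy => simp only [TensorProduct.add_tmul, map_add, hx, hy]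
  | tmul a b => simp

/-- The map `m ↦ m₍₀₎₍₀₎ ⊗ m₍₀₎₍₁₎ m₍₁₎`, where the first coaction is `θ'` and the second `θ`. -/
def twistComp {M : LMod k H} (θ θ' : M →ₗ[k] M ⊗[k] H) : M →ₗ[k] M ⊗[k] H :=
  (LinearMap.mul' k H).lTensor M ∘ₗ (TensorProduct.assoc k M H H).toLinearMap ∘ₗ
    θ.rTensor H ∘ₗ θ'

/-- Composites of twists are twists, so the invertibility of the braidings reduces to identities
between maps M → M ⊗ H that do not involve V. -/
lemma twist_twist {M : LMod k H} (θ θ' : M →ₗ[k] M ⊗[k] H) (V : LMod k H) (x : M ⊗[k] V) :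
    twist θ V (twist θ' V x) = twist (twistComp θ θ') V x := by
  induction x with
  | zero => simp
  | add x y hx hy => simp only [map_add, hx, hy]
  | tmul m v =>
    rw [twist_tmul, twist_tmul]
    simp only [twistComp, LinearMap.comp_apply]
    induction θ' m with
    | zero => simp
    | add x y hx hy => simp only [map_add, hx, hy]
    | tmul a b =>
      simp only [LinearMap.lTensor_tmul, orbit_apply, twist_tmul, LinearMap.rTensor_tmul]
      induction θ a with
      | zero => simp
      | add x y hx hy => simp only [map_add, TensorProduct.add_tmul, hx, hy]
      | tmul c d => simp [mul_smul]

/-- Coassociativity turns the composite into the convolution product of a and b applied to the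
coaction. The comultiplication D is left open: it is Δ for right coactions, and Δ with its legs
exchanged for flipped left coactions. -/
lemma twistComp_of_coassoc {M : LMod k H} {κ : M →ₗ[k] M ⊗[k] H} {D : H →ₗ[k] H ⊗[k] H} {m : M}
    (hκ : TensorProduct.assoc k M H H (κ.rTensor H (κ m)) = D.lTensor M (κ m))
    (a b : H →ₗ[k] H) :
    twistComp (a.lTensor M ∘ₗ κ) (b.lTensor M ∘ₗ κ) m =
      (LinearMap.mul' k H ∘ₗ TensorProduct.map a b ∘ₗ D).lTensor M (κ m) := by
  have e1 : ∀ t : M ⊗[k] H, (a.lTensor M ∘ₗ κ).rTensor H (b.lTensor M t) =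
      TensorProduct.map (a.lTensor M) b (κ.rTensor H t) := by
    intro t
    induction t with
    | zero => simp
    | add x y hx hy => simp only [map_add, hx, hy]
    | tmul m h => simp
  have e2 : ∀ t : (M ⊗[k] H) ⊗[k] H, TensorProduct.assoc k M H H
      (TensorProduct.map (a.lTensor M) b t) =
      (TensorProduct.map a b).lTensor M (TensorProduct.assoc k M H H t) := by
    intro t
    have : (TensorProduct.assoc k M H H).toLinearMap ∘ₗ TensorProduct.map (a.lTensor M) b =
        (TensorProduct.map a b).lTensor M ∘ₗ (TensorProduct.assoc k M H H).toLinearMap := by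
      ext; rfl
    exact LinearMap.congr_fun this t
  simp only [twistComp, LinearMap.comp_apply, LinearEquiv.coe_coe]
  rw [e1, e2, hκ, LinearMap.lTensor_comp, LinearMap.lTensor_comp]
  rfl

/-- `y ↦ φ(t₍₁₎ y) t₍₀₎`. -/
def pairR {M : LMod k H} (φ : H →ₗ[k] k) (t : M ⊗[k] H) : H →ₗ[k] M :=
  (TensorProduct.rid k M).toLinearMap ∘ₗ (φ ∘ₗ LinearMap.mul' k H).lTensor M ∘ₗ
    (TensorProduct.assoc k M H H).toLinearMap ∘ₗ TensorProduct.mk k (M ⊗[k] H) H t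

/-- `x ↦ φ(x t₍₁₎) t₍₀₎`. -/
def pairL {M : LMod k H} (φ : H →ₗ[k] k) (t : M ⊗[k] H) : H →ₗ[k] M :=
  (TensorProduct.rid k M).toLinearMap ∘ₗ
    (φ ∘ₗ LinearMap.mul' k H ∘ₗ (TensorProduct.comm k H H).toLinearMap).lTensor M ∘ₗ
    (TensorProduct.assoc k M H H).toLinearMap ∘ₗ TensorProduct.mk k (M ⊗[k] H) H t

lemma pairR_apply {M : LMod k H} (φ : H →ₗ[k] k) (t : M ⊗[k] H) (y : H) :
    pairR φ t y = TensorProduct.rid k M (φ.lTensor M ((LinearMap.mulRight k y).lTensor M t)) := by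
  induction t with
  | zero => simp [pairR]
  | add s t hs ht => simp only [pairR, LinearMap.comp_apply, map_add, LinearMap.add_apply] at hs ht ⊢
                     rw [hs, ht]
  | tmul m h => simp [pairR]

lemma pairL_apply {M : LMod k H} (φ : H →ₗ[k] k) (t : M ⊗[k] H) (y : H) :
    pairL φ t y = TensorProduct.rid k M (φ.lTensor M ((LinearMap.mulLeft k y).lTensor M t)) := by
  induction t with
  | zero => simp [pairL]
  | add s t hs ht => simp only [pairL, LinearMap.comp_apply, map_add, LinearMap.add_apply] at hs ht ⊢
                     rw [hs, ht]
  | tmul m h => simp [pairL]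

lemma lTensor_orbit_tensorAct {M V : LMod k H} (v : V) (t : H ⊗[k] H) (x : M ⊗[k] H) :
    (orbit V v).lTensor M (tensorAct k H M (regular k H) t x) =
      tensorAct k H M V t ((orbit V v).lTensor M x) := by
  obtain ⟨T, rfl⟩ := exists_repr t
  induction x with
  | zero => simp
  | add x y hx hy => simp only [map_add, hx, hy]
  | tmul m n =>
    simp only [map_sum, LinearMap.sum_apply, LinearMap.lTensor_tmul, tensorAct_tmul]
    refine Finset.sum_congr rfl fun i _ => ?_
    change (i.1 • m) ⊗ₜ[k] ((i.2 * n) • v) = _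
    rw [mul_smul]
    rfl

lemma rTensor_orbit_tensorAct {M V : LMod k H} (v : V) (t : H ⊗[k] H) (x : H ⊗[k] M) :
    (orbit V v).rTensor M (tensorAct k H (regular k H) M t x) =
      tensorAct k H V M t ((orbit V v).rTensor M x) := by
  obtain ⟨T, rfl⟩ := exists_repr t
  induction x with
  | zero => simp
  | add x y hx hy => simp only [map_add, hx, hy]
  | tmul m n =>
    simp only [map_sum, LinearMap.sum_apply, LinearMap.rTensor_tmul, tensorAct_tmul]
    refine Finset.sum_congr rfl fun i _ => ?_
    change ((i.1 * m) • v) ⊗ₜ[k] (i.2 • n) = _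
    rw [mul_smul]
    rfl

variable [Coalgebra k H]

/-- From ε_s(h) = 1₍₁₎ ε(h 1₍₂₎), a counital map on the second leg of t becomes a pairing of t with
one leg of Δ(1). For t a coaction, the Yetter-Drinfeld condition evaluates this pairing. The next
three lemmas do the same for ε̄_t, ε_t and ε̄_s. -/
lemma lTensor_epsS {M : LMod k H} (t : M ⊗[k] H) : (epsS k H).lTensor M t =
    (pairR (Coalgebra.counit (R := k)) t).rTensor H
      (TensorProduct.comm k H H (Coalgebra.comul (R := k) (1 : H))) := by
  obtain ⟨S, hS⟩ := exists_repr (k := k) (Coalgebra.comul (R := k) (1 : H))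
  rw [hS]
  induction t with
  | zero => simp [pairR]
  | add s t hs ht =>
    simp only [map_sum, TensorProduct.comm_tmul, LinearMap.rTensor_tmul] at hs ht
    simp only [map_add, hs, ht, map_sum, TensorProduct.comm_tmul, LinearMap.rTensor_tmul, pairR,
      LinearMap.comp_apply, LinearMap.add_apply, TensorProduct.add_tmul, Finset.sum_add_distrib]
  | tmul m h => simp [pairR, epsS_apply, hS, Finset.mul_sum, TensorProduct.tmul_sum,
      TensorProduct.smul_tmul]

lemma lTensor_epsTbar {M : LMod k H} (t : M ⊗[k] H) : (epsTbar k H).lTensor M t =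
    (pairR (Coalgebra.counit (R := k)) t).rTensor H (Coalgebra.comul (R := k) (1 : H)) := by
  obtain ⟨S, hS⟩ := exists_repr (k := k) (Coalgebra.comul (R := k) (1 : H))
  rw [hS]
  induction t with
  | zero => simp [pairR]
  | add s t hs ht =>
    simp only [map_sum, LinearMap.rTensor_tmul] at hs ht
    simp only [map_add, hs, ht, map_sum, LinearMap.rTensor_tmul, pairR,
      LinearMap.comp_apply, LinearMap.add_apply, TensorProduct.add_tmul, Finset.sum_add_distrib]
  | tmul m h => simp [pairR, epsTbar_apply, hS, Finset.mul_sum, TensorProduct.tmul_sum,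
      TensorProduct.smul_tmul]

lemma lTensor_epsT {M : LMod k H} (t : M ⊗[k] H) : (epsT k H).lTensor M t =
    (pairL (Coalgebra.counit (R := k)) t).rTensor H (Coalgebra.comul (R := k) (1 : H)) := by
  obtain ⟨S, hS⟩ := exists_repr (k := k) (Coalgebra.comul (R := k) (1 : H))
  rw [hS]
  induction t with
  | zero => simp [pairL]
  | add s t hs ht =>
    simp only [map_sum, LinearMap.rTensor_tmul] at hs ht
    simp only [map_add, hs, ht, map_sum, LinearMap.rTensor_tmul, pairL,
      LinearMap.comp_apply, LinearMap.add_apply, TensorProduct.add_tmul, Finset.sum_add_distrib]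
  | tmul m h => simp [pairL, epsT_apply, hS, Finset.sum_mul, TensorProduct.tmul_sum,
      TensorProduct.smul_tmul]

lemma lTensor_epsSbar {M : LMod k H} (t : M ⊗[k] H) : (epsSbar k H).lTensor M t =
    (pairL (Coalgebra.counit (R := k)) t).rTensor H
      (TensorProduct.comm k H H (Coalgebra.comul (R := k) (1 : H))) := by
  obtain ⟨S, hS⟩ := exists_repr (k := k) (Coalgebra.comul (R := k) (1 : H))
  rw [hS]
  induction t with
  | zero => simp [pairL]
  | add s t hs ht =>
    simp only [map_sum, TensorProduct.comm_tmul, LinearMap.rTensor_tmul] at hs ht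
    simp only [map_add, hs, ht, map_sum, TensorProduct.comm_tmul, LinearMap.rTensor_tmul, pairL,
      LinearMap.comp_apply, LinearMap.add_apply, TensorProduct.add_tmul, Finset.sum_add_distrib]
  | tmul m h => simp [pairL, epsSbar_apply, hS, Finset.sum_mul, TensorProduct.tmul_sum,
      TensorProduct.smul_tmul]

end Twist

/-! ### Isomorphisms between truncated tensor products, and threefold products inside ⊗ over k. -/

section Iso

variable {k : Type u} {H : Type v} [CommRing k] [Ring H] [Algebra k H] [Coalgebra k H]
  [WeakBialgebra k H]

lemma tensorAct_comul_one_incl {A B : LMod k H} (y : TensorT A B) :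
    tensorAct k H A B (Coalgebra.comul (R := k) (1 : H)) (incl A B y) = incl A B y := by
  rw [← incl_proj, proj_incl]

lemma tensorAct_comul_one_of_mem {A B : LMod k H} {x : A ⊗[k] B} (hx : x ∈ tensorT A B) :
    tensorAct k H A B (Coalgebra.comul (R := k) (1 : H)) x = x :=
  tensorAct_comul_one_incl (⟨x, hx⟩ : TensorT A B)

lemma incl_mem {A B : LMod k H} (y : TensorT A B) : incl A B y ∈ tensorT A B := y.2

/-- The isomorphism `A ⊗_t B ≅ A' ⊗_t B'` given by `H`-linear maps `F`, `G` whose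
composites are the projections. -/
def crossIso {A B A' B' : LMod k H} (F : A ⊗[k] B →ₗ[k] A' ⊗[k] B')
    (G : A' ⊗[k] B' →ₗ[k] A ⊗[k] B)
    (hF : ∀ (h : H) (x : A ⊗[k] B), F (tensorAct k H A B (Coalgebra.comul (R := k) h) x) =
      tensorAct k H A' B' (Coalgebra.comul (R := k) h) (F x))
    (hGF : ∀ x, G (F x) = tensorAct k H A B (Coalgebra.comul (R := k) (1 : H)) x)
    (hFG : ∀ x, F (G x) = tensorAct k H A' B' (Coalgebra.comul (R := k) (1 : H)) x) :
    tensorObj A B ≅ tensorObj A' B' :=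
  -- F commutes with the action of Δ(1), so it maps A ⊗_t B into A' ⊗_t B' and the projection
  -- changes nothing.
  have hincl : ∀ y : TensorT A B,
      incl A' B' (proj A' B' (F (incl A B y))) = F (incl A B y) := fun y => by
    rw [incl_proj, ← hF, tensorAct_comul_one_incl]
  mkIso (proj A' B' ∘ₗ F ∘ₗ incl A B) (proj A B ∘ₗ G ∘ₗ incl A' B')
    (fun h y => by
      apply incl_injective
      simp only [LinearMap.comp_apply]
      rw [hincl, incl_smul, incl_smul, hincl, hF])
    (fun y => by
      simp only [LinearMap.comp_apply]
      rw [hincl, hGF, ← incl_proj, proj_incl, proj_incl])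
    (fun y => by
      apply incl_injective
      simp only [LinearMap.comp_apply]
      rw [hincl, incl_proj, hF, hFG, tensorAct_comul_one_incl, tensorAct_comul_one_incl])

lemma incl_crossIso_hom {A B A' B' : LMod k H} (F : A ⊗[k] B →ₗ[k] A' ⊗[k] B')
    (G : A' ⊗[k] B' →ₗ[k] A ⊗[k] B) (hF hGF hFG) (y : TensorT A B) :
    incl A' B' (klin (crossIso F G hF hGF hFG).hom y) = F (incl A B y) := by
  change incl A' B' (proj A' B' (F (incl A B y))) = _
  rw [incl_proj, ← hF, tensorAct_comul_one_incl]

/-- The factor Δ(1) stays, since nothing is assumed about G and the action of Δ(1). -/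
lemma incl_crossIso_inv {A B A' B' : LMod k H} (F : A ⊗[k] B →ₗ[k] A' ⊗[k] B')
    (G : A' ⊗[k] B' →ₗ[k] A ⊗[k] B) (hF hGF hFG) (y : TensorT A' B') :
    incl A B (klin (crossIso F G hF hGF hFG).inv y) =
      tensorAct k H A B (Coalgebra.comul (R := k) (1 : H)) (G (incl A' B' y)) := rfl

lemma incl_tensorLin {M M' N N' : LMod k H} (f : M ⟶ M') (g : N ⟶ N') (y : TensorT M N) :
    incl M' N' (tensorLin f g y) = TensorProduct.map (klin f) (klin g) (incl M N y) := by
  simp only [tensorLin, LinearMap.comp_apply]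
  rw [incl_proj, ← map_tensorAct, tensorAct_comul_one_incl]

lemma incl_tm' {M N : LMod k H} (m : M) (n : N) : incl M N (tm m n) =
    tensorAct k H M N (Coalgebra.comul (R := k) (1 : H)) (m ⊗ₜ n) := rfl

/-- The inclusion `(M ⊗_t N) ⊗_t P → (M ⊗ N) ⊗ P`. -/
def inclL (M N P : LMod k H) : TensorT (tensorObj M N) P →ₗ[k] (M ⊗[k] N) ⊗[k] P :=
  (incl M N).rTensor P ∘ₗ incl (tensorObj M N) P

/-- The inclusion `M ⊗_t (N ⊗_t P) → M ⊗ (N ⊗ P)`. -/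
def inclR (M N P : LMod k H) : TensorT M (tensorObj N P) →ₗ[k] M ⊗[k] (N ⊗[k] P) :=
  (incl N P).lTensor M ∘ₗ incl M (tensorObj N P)

/-- Over a general commutative ring, tensoring with P need not preserve injectivity; here the
inclusion is split by `proj M N`. -/
lemma inclL_injective (M N P : LMod k H) : Function.Injective (inclL M N P) := by
  intro x y hxy
  apply incl_injective
  have : (proj M N).rTensor P ∘ₗ (incl M N).rTensor P = LinearMap.id := by
    rw [← LinearMap.rTensor_comp, ← LinearMap.rTensor_id]
    congr 1
    ext y : 1
    exact proj_incl M N y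
  have h := congrArg ((proj M N).rTensor P) hxy
  simp only [inclL, LinearMap.comp_apply] at h
  rwa [← LinearMap.comp_apply, ← LinearMap.comp_apply ((proj M N).rTensor P), this] at h

/-- Inside the tensor product over k, both bracketings of m ⊗_t n ⊗_t p are Δ²(1) acting on m ⊗ n ⊗
p, by coassociativity. Hence the associator is the restriction of the ordinary one. -/
lemma inclL_assocInvLin (M N P : LMod k H) (w : TensorT M (tensorObj N P)) :
    inclL M N P (assocInvLin M N P w) =
      (TensorProduct.assoc k M N P).symm (inclR M N P w) := by
  obtain ⟨y, rfl⟩ := proj_surjective M (tensorObj N P) w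
  obtain ⟨z, rfl⟩ := LinearMap.lTensor_surjective M (proj_surjective N P) y
  have : inclL M N P ∘ₗ assocInvLin M N P ∘ₗ proj M (tensorObj N P) ∘ₗ (proj N P).lTensor M =
      (TensorProduct.assoc k M N P).symm.toLinearMap ∘ₗ inclR M N P ∘ₗ
        proj M (tensorObj N P) ∘ₗ (proj N P).lTensor M := by
    ext m n p
    change inclL M N P (assocInvLin M N P (tm m (tm n p : TensorT N P))) =
      (TensorProduct.assoc k M N P).symm (inclR M N P (tm m (tm n p : TensorT N P)))
    rw [assocInvLin_tm]
    simp only [inclL, inclR, LinearMap.comp_apply]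
    rw [incl_tm, incl_tm, LinearMap.rTensor, LinearMap.lTensor, TensorProduct.map_map,
      TensorProduct.map_map, incl_orbit_tm, incl_orbit_tm, LinearMap.id_comp, LinearMap.id_comp,
      ← assoc_map_comul, LinearEquiv.symm_apply_apply]
  exact LinearMap.congr_fun this z

lemma inclR_assocLin (M N P : LMod k H) (w : TensorT (tensorObj M N) P) :
    inclR M N P (assocLin M N P w) = TensorProduct.assoc k M N P (inclL M N P w) := by
  have h : assocInvLin M N P (assocLin M N P w) = w := by
    have : assocInvLin M N P ∘ₗ assocLin M N P = LinearMap.id :=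
      tensorT_hom_ext₃ fun m n p => by simp [assocLin_tm, assocInvLin_tm]
    exact LinearMap.congr_fun this w
  conv_rhs => rw [← h, inclL_assocInvLin, LinearEquiv.apply_symm_apply]

/-- The inclusion of `u ⊗_t y` in the tensor product over `k`, for `y ∈ N ⊗_t P`. -/
lemma assoc_symm_inclR_tm {M N P : LMod k H} (u : M) (y : TensorT N P) :
    (TensorProduct.assoc k M N P).symm (inclR M N P (tm u y)) =
      (tensorAct k H M N (Coalgebra.comul (R := k) (1 : H))).rTensor P
        ((TensorProduct.assoc k M N P).symm (u ⊗ₜ incl N P y)) := by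
  let L : N ⊗[k] P → H ⊗[k] (H ⊗[k] H) →ₗ[k] M ⊗[k] (N ⊗[k] P) := fun x =>
    TensorProduct.map (orbit M u) ((tensorAct k H N P).toLinearMap.flip x)
  have e1 : inclR M N P (tm u y) = L (incl N P y)
      ((Coalgebra.comul (R := k)).lTensor H (Coalgebra.comul (R := k) (1 : H))) := by
    simp only [inclR, LinearMap.comp_apply]
    rw [incl_tm, LinearMap.lTensor, TensorProduct.map_map, LinearMap.id_comp]
    simp only [L]
    rw [LinearMap.lTensor, TensorProduct.map_map, LinearMap.comp_id]
    rfl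
  have e2 : ∀ (s : H ⊗[k] (H ⊗[k] H)) (w : H ⊗[k] H) (x : N ⊗[k] P),
      L x (s * (1 ⊗ₜ w)) = L (tensorAct k H N P w x) s := by
    intro s w x
    induction s with
    | zero => simp
    | add a b ha hb => simp only [add_mul, map_add, ha, hb]
    | tmul a b => simp [L]
  have e3 : ∀ (t : H ⊗[k] H) (x : N ⊗[k] P), (TensorProduct.assoc k M N P).symm
      (L x (TensorProduct.assoc k H H H (t ⊗ₜ 1))) =
      (tensorAct k H M N t).rTensor P ((TensorProduct.assoc k M N P).symm (u ⊗ₜ x)) := by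
    intro t x
    obtain ⟨T, rfl⟩ := exists_repr t
    induction x with
    | zero => simp [L, TensorProduct.sum_tmul]
    | add a b ha hb =>
      simp only [L, map_add, TensorProduct.tmul_add, TensorProduct.map_add_right,
        LinearMap.add_apply] at ha hb ⊢
      rw [ha, hb]
    | tmul a b =>
      simp [L, TensorProduct.sum_tmul, LinearMap.sum_apply]
  -- In Δ²(1) = (Δ(1) ⊗ 1)(1 ⊗ Δ(1)) the right factor is absorbed by y ∈ N ⊗_t P, and only Δ(1) on
  -- the first two legs remains.
  rw [e1, comul_one_coassoc, WeakBialgebra.comul_one_left, e2, tensorAct_comul_one_incl, e3]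

/-- The inclusion of `y ⊗_t p` in the tensor product over `k`, for `y ∈ M ⊗_t N`. -/
lemma assoc_inclL_tm {M N P : LMod k H} (y : TensorT M N) (p : P) :
    TensorProduct.assoc k M N P (inclL M N P (tm y p)) =
      (tensorAct k H N P (Coalgebra.comul (R := k) (1 : H))).lTensor M
        (TensorProduct.assoc k M N P (incl M N y ⊗ₜ p)) := by
  let L : M ⊗[k] N → (H ⊗[k] H) ⊗[k] H →ₗ[k] (M ⊗[k] N) ⊗[k] P := fun x =>
    TensorProduct.map ((tensorAct k H M N).toLinearMap.flip x) (orbit P p)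
  have e1 : inclL M N P (tm y p) = L (incl M N y)
      ((Coalgebra.comul (R := k)).rTensor H (Coalgebra.comul (R := k) (1 : H))) := by
    simp only [inclL, LinearMap.comp_apply]
    rw [incl_tm, LinearMap.rTensor, TensorProduct.map_map, LinearMap.id_comp]
    simp only [L]
    rw [LinearMap.rTensor, TensorProduct.map_map, LinearMap.comp_id]
    rfl
  have e2 : ∀ (s : H ⊗[k] (H ⊗[k] H)) (w : H ⊗[k] H) (x : M ⊗[k] N),
      L x ((TensorProduct.assoc k H H H).symm (s * TensorProduct.assoc k H H H (w ⊗ₜ 1))) =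
        L (tensorAct k H M N w x) ((TensorProduct.assoc k H H H).symm s) := by
    intro s w x
    have e : ∀ a c d : H, (TensorProduct.assoc k H H H).symm
        ((a ⊗ₜ[k] (c ⊗ₜ[k] d)) * TensorProduct.assoc k H H H (w ⊗ₜ (1 : H))) =
        ((a ⊗ₜ c) * w) ⊗ₜ d := by
      intro a c d
      induction w with
      | zero => simp
      | tmul x y => simp
      | add x y hx hy => simp only [TensorProduct.add_tmul, map_add, mul_add, hx, hy]
    induction s with
    | zero => simp
    | add a b ha hb => simp only [add_mul, map_add, ha, hb]
    | tmul a b =>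
      induction b with
      | zero => simp
      | add c d hc hd => simp only [TensorProduct.tmul_add, add_mul, map_add, hc, hd]
      | tmul c d => simp [L, e]
  have e3 : ∀ (t : H ⊗[k] H) (x : M ⊗[k] N), TensorProduct.assoc k M N P
      (L x ((TensorProduct.assoc k H H H).symm (1 ⊗ₜ t))) =
      (tensorAct k H N P t).lTensor M (TensorProduct.assoc k M N P (x ⊗ₜ p)) := by
    intro t x
    obtain ⟨T, rfl⟩ := exists_repr t
    induction x with
    | zero => simp [L, TensorProduct.tmul_sum]
    | add a b ha hb =>
      simp only [L, map_add, TensorProduct.add_tmul, TensorProduct.map_add_left,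
        LinearMap.add_apply] at ha hb ⊢
      rw [ha, hb]
    | tmul a b =>
      simp [L, TensorProduct.tmul_sum, LinearMap.sum_apply]
  -- Here the other order is needed: in (1 ⊗ Δ(1))(Δ(1) ⊗ 1) the right factor is absorbed by y ∈ M
  -- ⊗_t N.
  have e4 : (Coalgebra.comul (R := k)).rTensor H (Coalgebra.comul (R := k) (1 : H)) =
      (TensorProduct.assoc k H H H).symm (((1 : H) ⊗ₜ[k] Coalgebra.comul (R := k) (1 : H)) *
        TensorProduct.assoc k H H H (Coalgebra.comul (R := k) (1 : H) ⊗ₜ[k] (1 : H))) := by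
    rw [LinearEquiv.eq_symm_apply, WeakBialgebra.comul_one_right]
  rw [e1, e4, e2, tensorAct_comul_one_incl, e3]

end Iso

/-! ### Left-right Yetter-Drinfeld modules and the source and target spaces. -/

section Right

variable {k : Type u} {H : Type v} [CommRing k] [Ring H] [Algebra k H]

/-- The second leg of Δ(1) is fixed by ε_t, so only the values of f on the image of ε_t matter. The
next lemma uses in the same way that the first leg is fixed by ε̄_s. -/
lemma rTensor_comm_comul_one_of_epsT {M : LMod k H} [Coalgebra k H] [WeakBialgebra k H]
    (f : H →ₗ[k] M) (m : M) (h : ∀ g : H, f (epsT k H g) = epsT k H g • m) :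
    f.rTensor H (TensorProduct.comm k H H (Coalgebra.comul (R := k) (1 : H))) =
      TensorProduct.comm k H M ((orbit M m).lTensor H (Coalgebra.comul (R := k) (1 : H))) := by
  have e : f ∘ₗ epsT k H = orbit M m ∘ₗ epsT k H := LinearMap.ext h
  have e1 : ∀ (f : H →ₗ[k] M) (w : H ⊗[k] H), f.rTensor H (TensorProduct.comm k H H
      ((epsT k H).lTensor H w)) =
      TensorProduct.comm k H M ((f ∘ₗ epsT k H).lTensor H w) := by
    intro f w
    obtain ⟨T, rfl⟩ := exists_repr w
    simp
  rw [← lTensor_epsT_comul_one, e1, e, LinearMap.lTensor_comp, LinearMap.comp_apply]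

lemma rTensor_comul_one_of_epsSbar {M : LMod k H} [Coalgebra k H] [WeakBialgebra k H]
    (f : H →ₗ[k] M) (m : M) (h : ∀ g : H, f (epsSbar k H g) = epsSbar k H g • m) :
    f.rTensor H (Coalgebra.comul (R := k) (1 : H)) =
      (orbit M m).rTensor H (Coalgebra.comul (R := k) (1 : H)) := by
  have e : f ∘ₗ epsSbar k H = orbit M m ∘ₗ epsSbar k H := LinearMap.ext h
  rw [← rTensor_epsSbar_comul_one, ← LinearMap.comp_apply, ← LinearMap.rTensor_comp, e,
    LinearMap.rTensor_comp, LinearMap.comp_apply]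

/-- The map `v ⊗ m ↦ m₍₀₎ ⊗ m₍₁₎ v`. -/
def fwd {M : LMod k H} (ρ : M →ₗ[k] M ⊗[k] H) (V : LMod k H) : V ⊗[k] M →ₗ[k] M ⊗[k] V :=
  twist ρ V ∘ₗ (TensorProduct.comm k V M).toLinearMap

@[simp] lemma fwd_tmul {M : LMod k H} (ρ : M →ₗ[k] M ⊗[k] H) (V : LMod k H) (v : V) (m : M) :
    fwd ρ V (v ⊗ₜ m) = (orbit V v).lTensor M (ρ m) :=
  twist_tmul ρ V m v

/-- The expression `(b m)₍₀₎ ⊗ (b m)₍₁₎ a` for `a ⊗ b ∈ H ⊗ H`. -/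
def crossR {M : LMod k H} (ρ : M →ₗ[k] M ⊗[k] H) (m : M) : H ⊗[k] H →ₗ[k] M ⊗[k] H :=
  (LinearMap.mul' k H).lTensor M ∘ₗ (TensorProduct.assoc k M H H).toLinearMap ∘ₗ
    (ρ ∘ₗ orbit M m).rTensor H ∘ₗ (TensorProduct.comm k H H).toLinearMap

lemma crossR_tmul {M : LMod k H} (ρ : M →ₗ[k] M ⊗[k] H) (m : M) (a b : H) :
    crossR ρ m (a ⊗ₜ b) = (LinearMap.mulRight k a).lTensor M (ρ (b • m)) := by
  simp only [crossR, LinearMap.comp_apply, LinearEquiv.coe_coe, TensorProduct.comm_tmul,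
    LinearMap.rTensor_tmul, orbit_apply]
  induction ρ (b • m) with
  | zero => simp
  | add x y hx hy => simp only [map_add, TensorProduct.add_tmul, hx, hy]
  | tmul c d => simp

/-- For t = Δ(h), `crossR` is the right side of the Yetter-Drinfeld condition. Pushed forward along
h ↦ h v it becomes `fwd` at t (v ⊗ m), which is how that condition turns into H-linearity of `fwd`.
-/
lemma lTensor_orbit_crossR {M : LMod k H} (ρ : M →ₗ[k] M ⊗[k] H) (V : LMod k H) (m : M) (v : V)
    (t : H ⊗[k] H) : (orbit V v).lTensor M (crossR ρ m t) =
      fwd ρ V (tensorAct k H V M t (v ⊗ₜ m)) := by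
  obtain ⟨T, rfl⟩ := exists_repr t
  simp only [map_sum, LinearMap.sum_apply, tensorAct_tmul, fwd_tmul, crossR_tmul]
  refine Finset.sum_congr rfl fun i _ => ?_
  rw [← LinearMap.comp_apply, ← LinearMap.lTensor_comp]
  congr 2
  ext h
  simp [mul_smul]

lemma crossR_mul_tmul_one {M : LMod k H} (ρ : M →ₗ[k] M ⊗[k] H) (m : M) (y : H) (t : H ⊗[k] H) :
    crossR ρ m (t * (y ⊗ₜ 1)) = (LinearMap.mulRight k y).lTensor M (crossR ρ m t) := by
  obtain ⟨T, rfl⟩ := exists_repr t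
  simp only [Finset.sum_mul, map_sum, Algebra.TensorProduct.tmul_mul_tmul, crossR_tmul, mul_one]
  refine Finset.sum_congr rfl fun i _ => ?_
  rw [← LinearMap.comp_apply ((LinearMap.mulRight k y).lTensor M), ← LinearMap.lTensor_comp,
    LinearMap.mulRight_mul]

lemma crossR_mul_one_tmul {M : LMod k H} (ρ : M →ₗ[k] M ⊗[k] H) (m : M) (x : H) (t : H ⊗[k] H) :
    crossR ρ m (t * (1 ⊗ₜ x)) = crossR ρ (x • m) t := by
  obtain ⟨T, rfl⟩ := exists_repr t
  simp [Finset.sum_mul, crossR_tmul, mul_smul]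

variable [Coalgebra k H]

lemma LRYDStr.compat_crossR {M : LMod k H} (s : LRYDStr M) (h : H) (m : M) :
    tensorAct k H M (regular k H) (Coalgebra.comul (R := k) h) (s.ρ m) =
      crossR s.ρ m (Coalgebra.comul (R := k) h) := s.compat h m

lemma LRYDStr.fwd_linear {M : LMod k H} (s : LRYDStr M) (V : LMod k H) (h : H) (x : V ⊗[k] M) :
    fwd s.ρ V (tensorAct k H V M (Coalgebra.comul (R := k) h) x) =
      tensorAct k H M V (Coalgebra.comul (R := k) h) (fwd s.ρ V x) := by
  induction x with
  | zero => simp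
  | add x y hx hy => simp only [map_add, hx, hy]
  | tmul v m =>
    rw [← lTensor_orbit_crossR, ← s.compat_crossR, lTensor_orbit_tensorAct, fwd_tmul]

variable [WeakBialgebra k H]

lemma LRYDStr.tensorAct_comul_one {M : LMod k H} (s : LRYDStr M) (m : M) :
    tensorAct k H M (regular k H) (Coalgebra.comul (R := k) (1 : H)) (s.ρ m) = s.ρ m :=
  tensorAct_comul_one_of_mem (s.mem m)

lemma LRYDStr.crossR_comul_one {M : LMod k H} (s : LRYDStr M) (m : M) :
    crossR s.ρ m (Coalgebra.comul (R := k) (1 : H)) = s.ρ m := by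
  rw [← s.compat_crossR, s.tensorAct_comul_one]

/-- The Yetter-Drinfeld condition at h = 1, together with ρ(m) ∈ M ⊗_t H, gives (1₍₂₎ m)₍₀₎ ⊗ (1₍₂₎
m)₍₁₎ 1₍₁₎ = ρ(m). Hence τ(1₍₁₎ v ⊗ 1₍₂₎ m) is m₍₀₎ ⊗ m₍₁₎ v with no correction by Δ(1). -/
lemma LRYDStr.fwd_tensorAct_comul_one {M : LMod k H} (s : LRYDStr M) (V : LMod k H)
    (x : V ⊗[k] M) :
    fwd s.ρ V (tensorAct k H V M (Coalgebra.comul (R := k) (1 : H)) x) = fwd s.ρ V x := by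
  induction x with
  | zero => simp
  | add x y hx hy => simp only [map_add, hx, hy]
  | tmul v m => rw [← lTensor_orbit_crossR, s.crossR_comul_one, fwd_tmul]

/-- `ε(m₍₁₎ y) m₍₀₎ = y m` for `y` in the target space. -/
lemma LRYDStr.pairR_epsT {M : LMod k H} (s : LRYDStr M) (m : M) (g : H) :
    pairR (Coalgebra.counit (R := k)) (s.ρ m) (epsT k H g) = epsT k H g • m := by
  rw [epsT_eq_targetElt]
  set y : H := targetElt (Coalgebra.counit (R := k) ∘ₗ LinearMap.mulRight k g) with hy
  have h1 := s.compat_crossR y m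
  rw [hy] at h1
  -- Writing Δ(y) as (y ⊗ 1)Δ(1) on the left side and as Δ(1)(y ⊗ 1) on the right reduces the
  -- condition to y m₍₀₎ ⊗ m₍₁₎ = m₍₀₎ ⊗ m₍₁₎ y; it remains to apply ε to the second leg.
  nth_rw 1 [comul_targetElt'] at h1
  rw [comul_targetElt, crossR_mul_tmul_one, s.crossR_comul_one, map_mul, Module.End.mul_apply,
    s.tensorAct_comul_one, ← hy] at h1
  rw [pairR_apply, ← h1]
  conv_rhs => rw [← s.counit m]
  induction s.ρ m with
  | zero => simp
  | add a b ha hb => simp only [map_add, ha, hb, smul_add]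
  | tmul a b =>
    rw [tensorAct_tmul, one_smul]
    exact smul_comm _ _ _

/-- `ε(x m₍₁₎) m₍₀₎ = x m` for `x` in the source space. -/
lemma LRYDStr.pairL_epsSbar {M : LMod k H} (s : LRYDStr M) (m : M) (g : H) :
    pairL (Coalgebra.counit (R := k)) (s.ρ m) (epsSbar k H g) = epsSbar k H g • m := by
  rw [epsSbar_eq_sourceElt]
  set x : H := sourceElt (Coalgebra.counit (R := k) ∘ₗ LinearMap.mulRight k g) with hx
  have h1 := s.compat_crossR x m
  rw [hx] at h1
  -- For a source element the same device gives m₍₀₎ ⊗ x m₍₁₎ = ρ(x m).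
  nth_rw 1 [comul_sourceElt] at h1
  rw [comul_sourceElt', crossR_mul_one_tmul, s.crossR_comul_one, map_mul, Module.End.mul_apply,
    s.tensorAct_comul_one, ← hx] at h1
  rw [pairL_apply]
  conv_rhs => rw [← s.counit (x • m), ← h1]
  congr 2
  induction s.ρ m with
  | zero => simp
  | add a b ha hb => simp only [map_add, ha, hb]
  | tmul a b =>
    rw [tensorAct_tmul, one_smul]
    rfl

lemma LRYDStr.lTensor_epsS {M : LMod k H} (s : LRYDStr M) (m : M) :
    (epsS k H).lTensor M (s.ρ m) =
      TensorProduct.comm k H M ((orbit M m).lTensor H (Coalgebra.comul (R := k) (1 : H))) :=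
  (WeakHopf.lTensor_epsS _).trans (rTensor_comm_comul_one_of_epsT _ _ (s.pairR_epsT m))

lemma LRYDStr.lTensor_epsT {M : LMod k H} (s : LRYDStr M) (m : M) :
    (epsT k H).lTensor M (s.ρ m) =
      (orbit M m).rTensor H (Coalgebra.comul (R := k) (1 : H)) :=
  (WeakHopf.lTensor_epsT _).trans (rTensor_comul_one_of_epsSbar _ _ (s.pairL_epsSbar m))

end Right

/-! ### Invertibility of τ. -/

section RightAntipode

variable {k : Type u} {H : Type v} [CommRing k] [Ring H] [Algebra k H] [Coalgebra k H]
  [WeakHopfAlgebra k H]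

/-- The map `m ⊗ v ↦ S(m₍₁₎) v ⊗ m₍₀₎`. -/
def LRYDStr.bwd {M : LMod k H} (s : LRYDStr M) (V : LMod k H) : M ⊗[k] V →ₗ[k] V ⊗[k] M :=
  (TensorProduct.comm k M V).toLinearMap ∘ₗ twist ((anti k H).lTensor M ∘ₗ s.ρ) V

lemma LRYDStr.bwd_tmul {M : LMod k H} (s : LRYDStr M) (V : LMod k H) (m : M) (v : V) :
    s.bwd V (m ⊗ₜ v) = TensorProduct.comm k M V
      ((orbit V v).lTensor M ((anti k H).lTensor M (s.ρ m))) := by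
  simp [LRYDStr.bwd, twist_tmul]

/-- The convolution identity S * id = ε_s evaluated on the coaction; the next two lemmas do this for
id * S = ε_t and S * ε_t = S. -/
lemma LRYDStr.twistComp_anti_id {M : LMod k H} (s : LRYDStr M) :
    twistComp ((anti k H).lTensor M ∘ₗ s.ρ) s.ρ = (epsS k H).lTensor M ∘ₗ s.ρ := by
  ext m : 1
  have h1 := twistComp_of_coassoc (s.coassoc m) (anti k H) LinearMap.id
  rw [LinearMap.lTensor_id, LinearMap.id_comp] at h1
  rw [h1, LinearMap.comp_apply]
  congr 2
  ext h
  exact WeakHopfAlgebra.antipode_mul_id h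

lemma LRYDStr.twistComp_id_anti {M : LMod k H} (s : LRYDStr M) :
    twistComp s.ρ ((anti k H).lTensor M ∘ₗ s.ρ) = (epsT k H).lTensor M ∘ₗ s.ρ := by
  ext m : 1
  have h1 := twistComp_of_coassoc (s.coassoc m) LinearMap.id (anti k H)
  rw [LinearMap.lTensor_id, LinearMap.id_comp] at h1
  rw [h1, LinearMap.comp_apply]
  congr 2
  ext h
  exact WeakHopfAlgebra.id_mul_antipode h

lemma LRYDStr.twistComp_anti_epsT {M : LMod k H} (s : LRYDStr M) :
    twistComp ((anti k H).lTensor M ∘ₗ s.ρ) ((epsT k H).lTensor M ∘ₗ s.ρ) =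
      (anti k H).lTensor M ∘ₗ s.ρ := by
  ext m : 1
  rw [twistComp_of_coassoc (s.coassoc m), LinearMap.comp_apply]
  congr 2
  ext h
  exact anti_mul_epsT h

/-- The composite sends v ⊗ m to the flip of m₍₀₎ ⊗ ε_s(m₍₁₎) v, and m₍₀₎ ⊗ ε_s(m₍₁₎) = 1₍₂₎ m ⊗
1₍₁₎ by `LRYDStr.lTensor_epsS`. -/
lemma LRYDStr.bwd_fwd {M : LMod k H} (s : LRYDStr M) (V : LMod k H) (x : V ⊗[k] M) :
    s.bwd V (fwd s.ρ V x) = tensorAct k H V M (Coalgebra.comul (R := k) (1 : H)) x := by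
  simp only [LRYDStr.bwd, fwd, LinearMap.comp_apply]
  rw [twist_twist, s.twistComp_anti_id]
  induction x with
  | zero => simp
  | add x y hx hy => simp only [map_add, hx, hy]
  | tmul v m =>
    change TensorProduct.comm k M V (twist _ V (m ⊗ₜ v)) = _
    rw [twist_tmul, LinearMap.comp_apply, s.lTensor_epsS, tensorAct_apply_tmul]
    obtain ⟨S, hS⟩ := exists_repr (k := k) (Coalgebra.comul (R := k) (1 : H))
    simp [hS]

lemma LRYDStr.fwd_bwd {M : LMod k H} (s : LRYDStr M) (V : LMod k H) (x : M ⊗[k] V) :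
    fwd s.ρ V (s.bwd V x) = tensorAct k H M V (Coalgebra.comul (R := k) (1 : H)) x := by
  simp only [LRYDStr.bwd, fwd, LinearMap.comp_apply, LinearEquiv.coe_coe]
  rw [← TensorProduct.comm_symm, LinearEquiv.symm_apply_apply, twist_twist, s.twistComp_id_anti]
  induction x with
  | zero => simp
  | add x y hx hy => simp only [map_add, hx, hy]
  | tmul m v =>
    rw [twist_tmul, LinearMap.comp_apply, s.lTensor_epsT, tensorAct_apply_tmul]
    obtain ⟨S, hS⟩ := exists_repr (k := k) (Coalgebra.comul (R := k) (1 : H))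
    simp [hS]

/-- As Δ(1) acts as `fwd` after `bwd`, the claim is `bwd` ∘ `fwd` ∘ `bwd` = `bwd`, that is, S * ε_t
= S. It makes τ⁻¹ equal to m ⊗_t v ↦ S(m₍₁₎) v ⊗ m₍₀₎ exactly, which yields the formula for λ. -/
lemma LRYDStr.bwd_tensorAct_comul_one {M : LMod k H} (s : LRYDStr M) (V : LMod k H)
    (x : M ⊗[k] V) :
    s.bwd V (tensorAct k H M V (Coalgebra.comul (R := k) (1 : H)) x) = s.bwd V x := by
  rw [← s.fwd_bwd]
  simp only [LRYDStr.bwd, fwd, LinearMap.comp_apply, LinearEquiv.coe_coe]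
  rw [← TensorProduct.comm_symm, LinearEquiv.apply_symm_apply, twist_twist s.ρ,
    s.twistComp_id_anti, twist_twist, s.twistComp_anti_epsT]

lemma LRYDStr.tensorAct_comul_one_bwd {M : LMod k H} (s : LRYDStr M) (V : LMod k H)
    (x : M ⊗[k] V) :
    tensorAct k H V M (Coalgebra.comul (R := k) (1 : H)) (s.bwd V x) = s.bwd V x := by
  rw [← s.bwd_fwd, s.fwd_bwd, s.bwd_tensorAct_comul_one]

/-- The isomorphism `τ_{V,M}`. -/
def LRYDStr.tau {M : LMod k H} (s : LRYDStr M) (V : LMod k H) : V ⊗ M ≅ M ⊗ V :=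
  crossIso (fwd s.ρ V) (s.bwd V) (s.fwd_linear V) (s.bwd_fwd V) (s.fwd_bwd V)

lemma LRYDStr.incl_tau {M : LMod k H} (s : LRYDStr M) (V : LMod k H) (y : TensorT V M) :
    incl M V (klin (s.tau V).hom y) = fwd s.ρ V (incl V M y) :=
  incl_crossIso_hom ..

lemma LRYDStr.incl_tau_tm {M : LMod k H} (s : LRYDStr M) (V : LMod k H) (v : V) (m : M) :
    incl M V (klin (s.tau V).hom (tm v m : TensorT V M)) = (orbit V v).lTensor M (s.ρ m) := by
  refine (s.incl_tau V _).trans ?_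
  rw [incl_tm', s.fwd_tensorAct_comul_one, fwd_tmul]

lemma LRYDStr.incl_tau_inv_tm {M : LMod k H} (s : LRYDStr M) (V : LMod k H) (m : M) (v : V) :
    incl V M (klin (s.tau V).inv (tm m v : TensorT M V)) = TensorProduct.comm k M V
      ((orbit V v).lTensor M ((anti k H).lTensor M (s.ρ m))) := by
  refine (incl_crossIso_inv _ _ _ _ _ _).trans ?_
  rw [incl_tm', s.bwd_tensorAct_comul_one, s.tensorAct_comul_one_bwd, s.bwd_tmul]

end RightAntipode

/-! ### The tensor axiom of a right half-braiding, evaluated on elements. -/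

section RightMonoidal

variable {k : Type u} {H : Type v} [CommRing k] [Ring H] [Algebra k H] [Coalgebra k H]
  [WeakBialgebra k H]

lemma rTensor_fwd_assoc_symm {M : LMod k H} (ρ : M →ₗ[k] M ⊗[k] H) {U U' : LMod k H} (u : U)
    (u' : U') (t : M ⊗[k] H) :
    (fwd ρ U).rTensor U' ((TensorProduct.assoc k U M U').symm
      (u ⊗ₜ (orbit U' u').lTensor M t)) =
      TensorProduct.map ((orbit U u).lTensor M) (orbit U' u') (ρ.rTensor H t) := by
  induction t with
  | zero => simp
  | add x y hx hy => simp only [map_add, TensorProduct.tmul_add, hx, hy]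
  | tmul a b => simp

lemma assoc_symm_lTensor_map {M : LMod k H} {U U' : LMod k H} (u : U) (u' : U')
    (t : M ⊗[k] (H ⊗[k] H)) :
    (TensorProduct.assoc k M U U').symm
      ((TensorProduct.map (orbit U u) (orbit U' u')).lTensor M t) =
      TensorProduct.map ((orbit U u).lTensor M) (orbit U' u')
        ((TensorProduct.assoc k M H H).symm t) := by
  have : (TensorProduct.assoc k M U U').symm.toLinearMap ∘ₗ
      (TensorProduct.map (orbit U u) (orbit U' u')).lTensor M =
      TensorProduct.map ((orbit U u).lTensor M) (orbit U' u') ∘ₗ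
        (TensorProduct.assoc k M H H).symm.toLinearMap := by
    refine TensorProduct.ext (LinearMap.ext fun m => TensorProduct.ext' fun a b => ?_)
    rfl
  exact LinearMap.congr_fun this t

variable {M : LMod k H} (t : ∀ U : LMod k H, U ⊗ M ⟶ M ⊗ U) (ρ : M →ₗ[k] M ⊗[k] H)
  (ht : ∀ (U : LMod k H) (y : TensorT U M), incl M U (klin (t U) y) = fwd ρ U (incl U M y))
  (htm : ∀ (U : LMod k H) (u : U) (m : M),
    incl M U (klin (t U) (tm u m : TensorT U M)) = (orbit U u).lTensor M (ρ m))
include ht htm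

/-- H acts on u ⊗_t u' through Δ, so this side of the tensor axiom is m₍₀₎ ⊗ Δ(m₍₁₎)(u ⊗ u'). The
family t is only assumed to be given by a map ρ, so that the computation serves both the passage
from modules to the center and the way back. -/
lemma inclL_braiding_tensor (U U' : LMod k H) (u : U) (u' : U') (m : M) :
    inclL M U U' (klin ((α_ U U' M).inv ≫ t (U ⊗ U') ≫ (α_ M U U').inv)
      (tm u (tm u' m : TensorT U' M) : TensorT U (tensorObj U' M))) =
      TensorProduct.map ((orbit U u).lTensor M) (orbit U' u')
        ((TensorProduct.assoc k M H H).symm ((Coalgebra.comul (R := k)).lTensor M (ρ m))) := by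
  change inclL M U U' (assocInvLin M U U' (klin (t (U ⊗ U'))
    (assocInvLin U U' M (tm u (tm u' m : TensorT U' M))))) = _
  rw [assocInvLin_tm, inclL_assocInvLin]
  simp only [inclR, LinearMap.comp_apply]
  have h1 := htm (tensorObj U U') (tm u u' : TensorT U U') m
  refine (congrArg (fun x => (TensorProduct.assoc k M U U').symm ((incl U U').lTensor M x))
    h1).trans ?_
  rw [← LinearMap.comp_apply, ← LinearMap.lTensor_comp, incl_orbit_tm, LinearMap.lTensor_comp,
    LinearMap.comp_apply, assoc_symm_lTensor_map]

/-- The other side of the axiom iterates ρ. Comparison with `inclL_braiding_tensor` shows that the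
axiom is coassociativity of ρ. -/
lemma inclL_braiding_braiding (U U' : LMod k H) (u : U) (u' : U') (m : M) :
    inclL M U U' (klin ((U ◁ t U') ≫ (α_ U M U').inv ≫ (t U ▷ U'))
      (tm u (tm u' m : TensorT U' M) : TensorT U (tensorObj U' M))) =
      TensorProduct.map ((orbit U u).lTensor M) (orbit U' u') (ρ.rTensor H (ρ m)) := by
  -- `ht` and `htm` give two values at u ⊗_t m; their equality lets `fwd` absorb the Δ(1) that
  -- `assoc_symm_inclR_tm` leaves behind.
  have hP : fwd ρ U ∘ₗ tensorAct k H U M (Coalgebra.comul (R := k) (1 : H)) = fwd ρ U := by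
    ext u m : 3
    have h1 := htm U u m
    rw [ht, incl_tm'] at h1
    simpa using h1
  change inclL M U U' (tensorLin (t U) (𝟙 U') (assocInvLin U M U' (tensorLin (𝟙 U) (t U')
    (tm u (tm u' m : TensorT U' M))))) = _
  have e0 : ∀ z : TensorT (tensorObj U M) U', inclL M U U' (tensorLin (t U) (𝟙 U') z) =
      (fwd ρ U).rTensor U' (inclL U M U' z) := by
    intro z
    simp only [inclL, LinearMap.comp_apply]
    have h1 := incl_tensorLin (t U) (𝟙 U') z
    refine (congrArg ((incl M U).rTensor U') h1).trans ?_
    have h2 : ∀ w : (TensorT U M) ⊗[k] U', (incl M U).rTensor U'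
        (TensorProduct.map (klin (t U)) (klin (𝟙 U')) w) =
        (fwd ρ U).rTensor U' ((incl U M).rTensor U' w) := by
      intro w
      induction w with
      | zero => simp
      | add x y hx hy => simp only [map_add, hx, hy]
      | tmul a b =>
        change incl M U (klin (t U) a) ⊗ₜ b = fwd ρ U (incl U M a) ⊗ₜ b
        rw [ht]
    exact h2 _
  rw [e0, tensorLin_tm, inclL_assocInvLin, assoc_symm_inclR_tm, ← LinearMap.comp_apply,
    ← LinearMap.rTensor_comp, hP]
  change (fwd ρ U).rTensor U' ((TensorProduct.assoc k U M U').symm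
    (u ⊗ₜ incl M U' (klin (t U') (tm u' m)))) = _
  rw [htm, rTensor_fwd_assoc_symm]

end RightMonoidal

/-! ### Testing morphisms on generators. -/

section Evaluation

variable {k : Type u} {H : Type v} [CommRing k] [Ring H] [Algebra k H] [Coalgebra k H]
  [WeakBialgebra k H]

lemma RightHalfBraiding.ext' {C : Type*} [Category C] [MonoidalCategory C] {X : C}
    {a b : RightHalfBraiding X} (h : ∀ U, (a.τ U).hom = (b.τ U).hom) : a = b := by
  cases a; cases b
  congr
  funext U
  exact Iso.ext (h U)

/-- A morphism out of `M ⊗ N`, with values in `P ⊗ Q`, is determined by its values in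
`P ⊗ Q` on the elements `m ⊗_t n`. -/
lemma hom_ext_incl {M N P Q : LMod k H} {f g : M ⊗ N ⟶ P ⊗ Q}
    (w : ∀ (m : M) (n : N), incl P Q (klin f (tm m n : TensorT M N)) =
      incl P Q (klin g (tm m n : TensorT M N))) : f = g :=
  hom_ext₂ fun m n => incl_injective P Q (w m n)

/-- A morphism out of `M ⊗ (N ⊗ P)` is determined by its values on the elements
`m ⊗_t (n ⊗_t p)`. -/
lemma hom_ext₃' {M N P Q : LMod k H} {f g : M ⊗ (N ⊗ P) ⟶ Q}
    (w : ∀ (m : M) (n : N) (p : P),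
      klin f (tm m (tm n p : TensorT N P) : TensorT M (tensorObj N P)) =
        klin g (tm m (tm n p : TensorT N P) : TensorT M (tensorObj N P))) :
    f = g := by
  rw [← cancel_epi (α_ M N P).hom]
  refine hom_ext₃ fun m n p => ?_
  have h : klin (α_ M N P).hom (tm (tm m n : TensorT M N) p : TensorT (tensorObj M N) P) =
      (tm m (tm n p : TensorT N P) : TensorT M (tensorObj N P)) := klin_assocIso_tm m n p
  rw [klin_comp, klin_comp, LinearMap.comp_apply, LinearMap.comp_apply]
  refine (congrArg (klin f) h).trans ((w m n p).trans (congrArg (klin g) h).symm)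

/-- A morphism out of `H_t ⊗ M` is determined by its values on the elements `1 ⊗_t m`. -/
lemma hom_ext_unit_left {M P : LMod k H} {f g : 𝟙_ (LMod k H) ⊗ M ⟶ P}
    (w : ∀ m : M, klin f (tm (tOne k H) m : TensorT (unitObj k H) M) =
      klin g (tm (tOne k H) m : TensorT (unitObj k H) M)) : f = g :=
  hom_ext₂ fun z m => by
    have h := w (tIncl k H z • m)
    rwa [tm_tOne_smul] at h

lemma klin_whiskerLeft_tm {M N N' : LMod k H} (f : N ⟶ N') (m : M) (n : N) :
    klin (M ◁ f) (tm m n : TensorT M N) = (tm m (klin f n) : TensorT M N') :=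
  tensorLin_tm (𝟙 M) f m n

lemma klin_whiskerRight_tm {M M' N : LMod k H} (f : M ⟶ M') (m : M) (n : N) :
    klin (f ▷ N) (tm m n : TensorT M N) = (tm (klin f m) n : TensorT M' N) :=
  tensorLin_tm f (𝟙 N) m n

lemma incl_whiskerLeft {M N N' : LMod k H} (f : N ⟶ N') (y : TensorT M N) :
    incl M N' (klin (M ◁ f) y) = (klin f).lTensor M (incl M N y) :=
  incl_tensorLin (𝟙 M) f y

lemma incl_whiskerRight {M M' N : LMod k H} (f : M ⟶ M') (y : TensorT M N) :
    incl M' N (klin (f ▷ N) y) = (klin f).rTensor N (incl M N y) :=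
  incl_tensorLin f (𝟙 N) y

lemma klin_comp_orbit {M N : LMod k H} (f : M ⟶ N) (m : M) :
    klin f ∘ₗ orbit M m = orbit N (klin f m) := by
  ext h
  simp

/-- The `H`-linear map `h ↦ h m`. -/
def orbitHom (M : LMod k H) (m : M) : regular k H ⟶ M := ⟨LinearMap.toSpanSingleton H M m⟩

lemma klin_orbitHom (M : LMod k H) (m : M) : klin (orbitHom M m) = orbit M m := rfl

@[simp] lemma orbit_regular_one : orbit (regular k H) (1 : H) = LinearMap.id := by
  ext h
  exact mul_one h

lemma orbit_tOne : orbit (unitObj k H) (tOne k H) = tProj k H := by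
  ext h
  exact smul_tOne h

/-- The right side of the unit axiom, evaluated at 1 ⊗_t m: the element 1₍₁₎ m ⊗ ε_t(1₍₂₎). -/
lemma incl_leftUnitor_comp_inv (M : LMod k H) (m : M) :
    incl M (unitObj k H) (klin ((λ_ M).hom ≫ (ρ_ M).inv)
      (tm (tOne k H) m : TensorT (unitObj k H) M)) =
      TensorProduct.map (orbit M m) (tProj k H) (Coalgebra.comul (R := k) (1 : H)) := by
  change incl M (unitObj k H) (rightUnitInvLin M (leftUnitLin M (tm (tOne k H) m))) = _
  rw [leftUnitLin_tm, tIncl_tOne, one_smul, rightUnitInvLin_apply, incl_tm, orbit_tOne]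

lemma incl_rightUnitor_comp_inv (M : LMod k H) (m : M) :
    incl (unitObj k H) M (klin ((ρ_ M).hom ≫ (λ_ M).inv)
      (tm m (tOne k H) : TensorT M (unitObj k H))) =
      TensorProduct.map (tProj k H) (orbit M m) (Coalgebra.comul (R := k) (1 : H)) := by
  change incl (unitObj k H) M (leftUnitInvLin M (rightUnitLin M (tm m (tOne k H)))) = _
  rw [rightUnitLin_tm, tIncl_tOne, epsSbar_one, one_smul, leftUnitInvLin_apply, incl_tm, orbit_tOne]

/-- Because ε ∘ ε_t = ε, the counit axiom of the coaction can be recovered from the component of a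
half-braiding at the unit object. -/
lemma counit_tIncl_tProj (h : H) : Coalgebra.counit (R := k) (tIncl k H (tProj k H h)) =
    Coalgebra.counit (R := k) h := by
  have := counit_mul_epsT (k := k) 1 h
  rwa [one_mul, one_mul] at this

end Evaluation

/-! ### Left-right Yetter-Drinfeld structures are right half-braidings. -/

section RightBraiding

variable {k : Type u} {H : Type v} [CommRing k] [Ring H] [Algebra k H] [Coalgebra k H]
  [WeakHopfAlgebra k H]

/-- The right half-braiding of a left-right Yetter-Drinfeld module. -/
def LRYDStr.toHalfBraiding {M : LMod k H} (s : LRYDStr M) : RightHalfBraiding M where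
  τ := s.tau
  naturality {U U'} f := hom_ext_incl fun u m => by
    rw [klin_comp, klin_comp, LinearMap.comp_apply, LinearMap.comp_apply, incl_whiskerLeft,
      klin_whiskerRight_tm, s.incl_tau_tm, s.incl_tau_tm, ← klin_comp_orbit,
      LinearMap.lTensor_comp, LinearMap.comp_apply]
  unit := hom_ext_unit_left fun m => by
    apply incl_injective M (unitObj k H)
    refine (s.incl_tau_tm (unitObj k H) (tOne k H) m).trans
      (Eq.trans ?_ (incl_leftUnitor_comp_inv M m).symm)
    -- An idempotent ε_t is inserted so that m₍₀₎ ⊗ ε_t(m₍₁₎) = 1₍₁₎ m ⊗ 1₍₂₎ becomes applicable.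
    have h1 : orbit (unitObj k H) (tOne k H) = tProj k H ∘ₗ epsT k H := by
      rw [orbit_tOne]
      ext h
      rw [LinearMap.comp_apply, tProj_epsT]
    rw [h1, LinearMap.lTensor_comp, LinearMap.comp_apply, s.lTensor_epsT]
    exact LinearMap.congr_fun (LinearMap.lTensor_comp_rTensor _ _ _) _
  monoidal U U' := hom_ext₃' fun u u' m => by
    apply inclL_injective M U U'
    have h1 := inclL_braiding_tensor (fun U => (s.tau U).hom) s.ρ s.incl_tau s.incl_tau_tm
      U U' u u' m
    have h2 := inclL_braiding_braiding (fun U => (s.tau U).hom) s.ρ s.incl_tau s.incl_tau_tm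
      U U' u u' m
    refine h1.trans (Eq.trans ?_ h2.symm)
    rw [← s.coassoc, LinearEquiv.symm_apply_apply]

/-- The right coaction of an object of the right center. -/
def RightHalfBraiding.coaction {M : LMod k H} (b : RightHalfBraiding M) : M →ₗ[k] M ⊗[k] H :=
  incl M (regular k H) ∘ₗ klin (b.τ (regular k H)).hom ∘ₗ proj (regular k H) M ∘ₗ
    TensorProduct.mk k H M 1

/-- Naturality along the H-linear map H → U, h ↦ h u, which sends 1 to u: the component at the
regular module determines the whole half-braiding. -/
lemma RightHalfBraiding.incl_tm {M : LMod k H} (b : RightHalfBraiding M) (U : LMod k H) (u : U)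
    (m : M) : incl M U (klin (b.τ U).hom (tm u m : TensorT U M)) =
      (orbit U u).lTensor M (b.coaction m) := by
  have h1 := congrArg (fun f => incl M U (klin f (tm (1 : H) m : TensorT (regular k H) M)))
    (b.naturality (orbitHom U u))
  simp only [klin_comp, LinearMap.comp_apply] at h1
  rw [klin_whiskerRight_tm, incl_whiskerLeft, klin_orbitHom] at h1
  refine Eq.trans ?_ h1
  rw [orbit_apply, one_smul]

lemma RightHalfBraiding.incl_proj {M : LMod k H} (b : RightHalfBraiding M) (U : LMod k H)
    (x : U ⊗[k] M) : incl M U (klin (b.τ U).hom (proj U M x)) = fwd b.coaction U x := by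
  have : incl M U ∘ₗ klin (b.τ U).hom ∘ₗ proj U M = fwd b.coaction U :=
    TensorProduct.ext' fun u m => (b.incl_tm U u m).trans (fwd_tmul _ _ _ _).symm
  exact LinearMap.congr_fun this x

lemma RightHalfBraiding.incl_eq_fwd {M : LMod k H} (b : RightHalfBraiding M) (U : LMod k H)
    (y : TensorT U M) : incl M U (klin (b.τ U).hom y) = fwd b.coaction U (incl U M y) := by
  rw [← b.incl_proj, WeakHopf.proj_incl]

/-- The left-right Yetter-Drinfeld structure given by a right half-braiding. -/
def RightHalfBraiding.toLRYDStr {M : LMod k H} (b : RightHalfBraiding M) : LRYDStr M where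
  ρ := b.coaction
  coassoc m := by
    -- At U = U' = H and the element 1 ⊗_t (1 ⊗_t m) the orbit maps are identities, and the tensor
    -- axiom is literally coassociativity.
    have h := congrArg (fun f => inclL M (regular k H) (regular k H) (klin f
      (tm (1 : H) (tm (1 : H) m : TensorT (regular k H) M) :
        TensorT (regular k H) (tensorObj (regular k H) M)))) (b.monoidal (regular k H)
          (regular k H))
    have h1 := inclL_braiding_tensor (fun U => (b.τ U).hom) b.coaction b.incl_eq_fwd b.incl_tm
      (regular k H) (regular k H) 1 1 m
    have h2 := inclL_braiding_braiding (fun U => (b.τ U).hom) b.coaction b.incl_eq_fwd b.incl_tm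
      (regular k H) (regular k H) 1 1 m
    have h3 := h1.symm.trans (h.trans h2)
    rw [orbit_regular_one, LinearMap.lTensor_id, TensorProduct.map_id, LinearMap.id_apply,
      LinearMap.id_apply, LinearEquiv.symm_apply_eq] at h3
    exact h3.symm
  counit m := by
    -- The unit axiom at 1 ⊗_t m reads m₍₀₎ ⊗ ε_t(m₍₁₎) = 1₍₁₎ m ⊗ ε_t(1₍₂₎); applying ε to the
    -- second leg gives m on the right.
    have h := congrArg (fun f => incl M (unitObj k H) (klin f
      (tm (tOne k H) m : TensorT (unitObj k H) M))) b.unit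
    have h1 := (b.incl_tm (unitObj k H) (tOne k H) m).symm.trans
      (h.trans (incl_leftUnitor_comp_inv M m))
    rw [orbit_tOne] at h1
    have h2 := congrArg (fun x => TensorProduct.rid k M
      ((Coalgebra.counit (R := k) ∘ₗ tIncl k H).lTensor M x)) h1
    have h3 : (Coalgebra.counit (R := k) ∘ₗ tIncl k H) ∘ₗ tProj k H =
        Coalgebra.counit (R := k) := by
      ext h
      exact counit_tIncl_tProj h
    have h4 : (Coalgebra.counit (R := k) ∘ₗ tIncl k H).lTensor M ∘ₗ (tProj k H).lTensor M =
        (Coalgebra.counit (R := k)).lTensor M := by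
      rw [← LinearMap.lTensor_comp, h3]
    have h5 : (Coalgebra.counit (R := k) ∘ₗ tIncl k H).lTensor M ∘ₗ
        TensorProduct.map (orbit M m) (tProj k H) =
        (orbit M m).rTensor k ∘ₗ (Coalgebra.counit (R := k)).lTensor H := by
      rw [LinearMap.lTensor_comp_map, h3, LinearMap.rTensor_comp_lTensor]
    have h6 := (LinearMap.congr_fun h4 (b.coaction m)).symm
    refine (congrArg (TensorProduct.rid k M) h6).trans (h2.trans ?_)
    refine (congrArg (TensorProduct.rid k M) (LinearMap.congr_fun h5 _)).trans ?_
    rw [LinearMap.comp_apply, Coalgebra.lTensor_counit_comul]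
    simp
  mem m := incl_mem _
  compat h m := by
    -- τ_H(h (1 ⊗_t m)) is computed in two ways: by H-linearity it is Δ(h) ρ(m), and by expanding h
    -- (1 ⊗_t m) = h₍₁₎ ⊗ h₍₂₎ m it is the right side of the Yetter-Drinfeld condition.
    have h1 := b.incl_eq_fwd (regular k H) (h • (tm (1 : H) m : TensorT (regular k H) M))
    rw [klin_smul] at h1
    have h2 : ∀ y : TensorT M (regular k H), incl M (regular k H) (h • y) =
        tensorAct k H M (regular k H) (Coalgebra.comul (R := k) h) (incl M (regular k H) y) :=
      fun y => rfl
    refine (h2 _).symm.trans (h1.trans ?_)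
    rw [incl_smul, incl_tm', ← tensorAct_comul_mul, mul_one, ← lTensor_orbit_crossR,
      orbit_regular_one, LinearMap.lTensor_id]
    rfl

lemma RightHalfBraiding.toHalfBraiding_toLRYDStr {M : LMod k H} (b : RightHalfBraiding M) :
    b.toLRYDStr.toHalfBraiding = b :=
  RightHalfBraiding.ext' fun U => hom_ext_incl fun u m =>
    (b.toLRYDStr.incl_tau_tm U u m).trans (b.incl_tm U u m).symm

lemma LRYDStr.ext' {M : LMod k H} {s s' : LRYDStr M} (h : s.ρ = s'.ρ) : s = s' := by
  cases s; cases s'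
  congr

lemma LRYDStr.toLRYDStr_toHalfBraiding {M : LMod k H} (s : LRYDStr M) :
    s.toHalfBraiding.toLRYDStr = s := by
  apply LRYDStr.ext'
  ext m : 1
  refine (s.incl_tau_tm (regular k H) (1 : H) m).trans ?_
  rw [orbit_regular_one, LinearMap.lTensor_id, LinearMap.id_apply]

end RightBraiding

/-! ### Left-left Yetter-Drinfeld modules and the source and target spaces. -/

section Left

variable {k : Type u} {H : Type v} [CommRing k] [Ring H] [Algebra k H]

/-- The map `m ⊗ v ↦ m₍₋₁₎ v ⊗ m₍₀₎`. -/
def fwdL {M : LMod k H} (l : M →ₗ[k] H ⊗[k] M) (V : LMod k H) : M ⊗[k] V →ₗ[k] V ⊗[k] M :=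
  (TensorProduct.comm k M V).toLinearMap ∘ₗ
    twist ((TensorProduct.comm k H M).toLinearMap ∘ₗ l) V

@[simp] lemma fwdL_tmul {M : LMod k H} (l : M →ₗ[k] H ⊗[k] M) (V : LMod k H) (m : M) (v : V) :
    fwdL l V (m ⊗ₜ v) = (orbit V v).rTensor M (l m) := by
  simp only [fwdL, LinearMap.comp_apply, twist_tmul, LinearEquiv.coe_coe]
  induction l m with
  | zero => simp
  | add x y hx hy => simp only [map_add, hx, hy]
  | tmul a b => simp

/-- The expression `(a m)₍₋₁₎ b ⊗ (a m)₍₀₎` for `a ⊗ b ∈ H ⊗ H`. -/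
def crossL {M : LMod k H} (l : M →ₗ[k] H ⊗[k] M) (m : M) : H ⊗[k] H →ₗ[k] H ⊗[k] M :=
  (LinearMap.mul' k H).rTensor M ∘ₗ (TensorProduct.rightComm k H M H).toLinearMap ∘ₗ
    (l ∘ₗ orbit M m).rTensor H

lemma crossL_tmul {M : LMod k H} (l : M →ₗ[k] H ⊗[k] M) (m : M) (a b : H) :
    crossL l m (a ⊗ₜ b) = (LinearMap.mulRight k b).rTensor M (l (a • m)) := by
  simp only [crossL, LinearMap.comp_apply, LinearEquiv.coe_coe, LinearMap.rTensor_tmul,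
    orbit_apply]
  induction l (a • m) with
  | zero => simp
  | add x y hx hy => simp only [map_add, TensorProduct.add_tmul, hx, hy]
  | tmul c d => simp

lemma rTensor_orbit_crossL {M : LMod k H} (l : M →ₗ[k] H ⊗[k] M) (V : LMod k H) (m : M) (v : V)
    (t : H ⊗[k] H) : (orbit V v).rTensor M (crossL l m t) =
      fwdL l V (tensorAct k H M V t (m ⊗ₜ v)) := by
  obtain ⟨T, rfl⟩ := exists_repr t
  simp only [map_sum, LinearMap.sum_apply, tensorAct_tmul, fwdL_tmul, crossL_tmul]
  refine Finset.sum_congr rfl fun i _ => ?_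
  rw [← LinearMap.comp_apply, ← LinearMap.rTensor_comp]
  congr 2
  ext h
  simp [mul_smul]

lemma crossL_mul_one_tmul {M : LMod k H} (l : M →ₗ[k] H ⊗[k] M) (m : M) (x : H) (t : H ⊗[k] H) :
    crossL l m (t * (1 ⊗ₜ x)) = (LinearMap.mulRight k x).rTensor M (crossL l m t) := by
  obtain ⟨T, rfl⟩ := exists_repr t
  simp only [Finset.sum_mul, map_sum, Algebra.TensorProduct.tmul_mul_tmul, crossL_tmul, mul_one]
  refine Finset.sum_congr rfl fun i _ => ?_
  rw [← LinearMap.comp_apply ((LinearMap.mulRight k x).rTensor M), ← LinearMap.rTensor_comp,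
    LinearMap.mulRight_mul]

lemma crossL_mul_tmul_one {M : LMod k H} (l : M →ₗ[k] H ⊗[k] M) (m : M) (y : H) (t : H ⊗[k] H) :
    crossL l m (t * (y ⊗ₜ 1)) = crossL l (y • m) t := by
  obtain ⟨T, rfl⟩ := exists_repr t
  simp [Finset.sum_mul, crossL_tmul, mul_smul]

variable [Coalgebra k H]

/-- The left coaction with the factors exchanged, `m ↦ m₍₀₎ ⊗ m₍₋₁₎`. -/
def LLYDStr.flip {M : LMod k H} (s : LLYDStr M) : M →ₗ[k] M ⊗[k] H :=
  (TensorProduct.comm k H M).toLinearMap ∘ₗ s.coact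

lemma LLYDStr.flip_apply {M : LMod k H} (s : LLYDStr M) (m : M) :
    s.flip m = TensorProduct.comm k H M (s.coact m) := rfl

/-- A flipped left coaction is a right coaction over the coopposite coalgebra. This lets the
calculus of twists apply, and it is the reason that S⁻¹ replaces S. -/
lemma LLYDStr.flip_coassoc {M : LMod k H} (s : LLYDStr M) (m : M) :
    TensorProduct.assoc k M H H (s.flip.rTensor H (s.flip m)) =
      ((TensorProduct.comm k H H).toLinearMap ∘ₗ Coalgebra.comul (R := k)).lTensor M
        (s.flip m) := by
  let p : H ⊗[k] (H ⊗[k] M) →ₗ[k] M ⊗[k] (H ⊗[k] H) :=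
    (TensorProduct.assoc k M H H).toLinearMap ∘ₗ (TensorProduct.comm k H (M ⊗[k] H)).toLinearMap ∘ₗ
      (TensorProduct.comm k H M).toLinearMap.lTensor H
  have h := congrArg p (s.coassoc m)
  have e1 : ∀ t : H ⊗[k] M, TensorProduct.assoc k M H H (s.flip.rTensor H
      (TensorProduct.comm k H M t)) = p (s.coact.lTensor H t) := by
    intro t
    induction t with
    | zero => simp
    | add x y hx hy => simp only [map_add, hx, hy]
    | tmul a b => simp [p, LLYDStr.flip]
  have e2 : ∀ t : H ⊗[k] M, ((TensorProduct.comm k H H).toLinearMap ∘ₗ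
      Coalgebra.comul (R := k)).lTensor M (TensorProduct.comm k H M t) =
      p (TensorProduct.assoc k H H M ((Coalgebra.comul (R := k)).rTensor M t)) := by
    intro t
    induction t with
    | zero => simp
    | add x y hx hy => simp only [map_add, hx, hy]
    | tmul a b =>
      simp only [TensorProduct.comm_tmul, LinearMap.lTensor_tmul, LinearMap.rTensor_tmul,
        LinearMap.comp_apply]
      induction Coalgebra.comul (R := k) a with
      | zero => simp
      | add x y hx hy => simp only [map_add, TensorProduct.add_tmul, TensorProduct.tmul_add, hx, hy]
      | tmul c d => simp [p]
  rw [LLYDStr.flip_apply, e1, e2, h]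

lemma LLYDStr.compat_crossL {M : LMod k H} (s : LLYDStr M) (h : H) (m : M) :
    tensorAct k H (regular k H) M (Coalgebra.comul (R := k) h) (s.coact m) =
      crossL s.coact m (Coalgebra.comul (R := k) h) := s.compat h m

lemma LLYDStr.fwdL_linear {M : LMod k H} (s : LLYDStr M) (V : LMod k H) (h : H)
    (x : M ⊗[k] V) :
    fwdL s.coact V (tensorAct k H M V (Coalgebra.comul (R := k) h) x) =
      tensorAct k H V M (Coalgebra.comul (R := k) h) (fwdL s.coact V x) := by
  induction x with
  | zero => simp
  | add x y hx hy => simp only [map_add, hx, hy]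
  | tmul m v =>
    rw [← rTensor_orbit_crossL, ← s.compat_crossL, rTensor_orbit_tensorAct, fwdL_tmul]

variable [WeakBialgebra k H]

lemma LLYDStr.tensorAct_comul_one {M : LMod k H} (s : LLYDStr M) (m : M) :
    tensorAct k H (regular k H) M (Coalgebra.comul (R := k) (1 : H)) (s.coact m) = s.coact m :=
  tensorAct_comul_one_of_mem (s.mem m)

lemma LLYDStr.crossL_comul_one {M : LMod k H} (s : LLYDStr M) (m : M) :
    crossL s.coact m (Coalgebra.comul (R := k) (1 : H)) = s.coact m := by
  rw [← s.compat_crossL, s.tensorAct_comul_one]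

lemma LLYDStr.fwdL_tensorAct_comul_one {M : LMod k H} (s : LLYDStr M) (V : LMod k H)
    (x : M ⊗[k] V) :
    fwdL s.coact V (tensorAct k H M V (Coalgebra.comul (R := k) (1 : H)) x) =
      fwdL s.coact V x := by
  induction x with
  | zero => simp
  | add x y hx hy => simp only [map_add, hx, hy]
  | tmul v m => rw [← rTensor_orbit_crossL, s.crossL_comul_one, fwdL_tmul]

/-- `ε(m₍₋₁₎ x) m₍₀₎ = x m` for `x` in the source space. -/
lemma LLYDStr.pairR_epsSbar {M : LMod k H} (s : LLYDStr M) (m : M) (g : H) :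
    pairR (Coalgebra.counit (R := k)) (s.flip m) (epsSbar k H g) = epsSbar k H g • m := by
  rw [epsSbar_eq_sourceElt]
  set x : H := sourceElt (Coalgebra.counit (R := k) ∘ₗ LinearMap.mulRight k g) with hx
  have h1 := s.compat_crossL x m
  rw [hx] at h1
  -- The outcome is m₍₋₁₎ ⊗ x m₍₀₎ = m₍₋₁₎ x ⊗ m₍₀₎. Compared with right coactions, source and
  -- target exchange their roles.
  nth_rw 1 [comul_sourceElt] at h1
  rw [comul_sourceElt', crossL_mul_one_tmul, s.crossL_comul_one, map_mul, Module.End.mul_apply,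
    s.tensorAct_comul_one, ← hx] at h1
  have e1 : ∀ t : H ⊗[k] M, TensorProduct.rid k M ((Coalgebra.counit (R := k)).lTensor M
      ((LinearMap.mulRight k x).lTensor M (TensorProduct.comm k H M t))) =
      TensorProduct.lid k M ((Coalgebra.counit (R := k)).rTensor M
        ((LinearMap.mulRight k x).rTensor M t)) := by
    intro t
    induction t with
    | zero => simp
    | add a b ha hb => simp only [map_add, ha, hb]
    | tmul a b => simp
  rw [pairR_apply, LLYDStr.flip_apply, e1, ← h1]
  conv_rhs => rw [← s.counit m]
  induction s.coact m with
  | zero => simp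
  | add a b ha hb => simp only [map_add, ha, hb, smul_add]
  | tmul a b =>
    rw [tensorAct_tmul, one_smul]
    exact smul_comm _ _ _

/-- `ε(y m₍₋₁₎) m₍₀₎ = y m` for `y` in the target space. -/
lemma LLYDStr.pairL_epsT {M : LMod k H} (s : LLYDStr M) (m : M) (g : H) :
    pairL (Coalgebra.counit (R := k)) (s.flip m) (epsT k H g) = epsT k H g • m := by
  rw [epsT_eq_targetElt]
  set y : H := targetElt (Coalgebra.counit (R := k) ∘ₗ LinearMap.mulRight k g) with hy
  have h1 := s.compat_crossL y m
  rw [hy] at h1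
  -- The outcome is y m₍₋₁₎ ⊗ m₍₀₎ = λ(y m).
  nth_rw 1 [comul_targetElt'] at h1
  rw [comul_targetElt, crossL_mul_tmul_one, s.crossL_comul_one, map_mul, Module.End.mul_apply,
    s.tensorAct_comul_one, ← hy] at h1
  rw [pairL_apply, LLYDStr.flip_apply]
  conv_rhs => rw [← s.counit (y • m), ← h1]
  induction s.coact m with
  | zero => simp
  | add a b ha hb => simp only [map_add, ha, hb]
  | tmul a b =>
    rw [tensorAct_tmul, one_smul]
    rfl

lemma LLYDStr.lTensor_epsTbar {M : LMod k H} (s : LLYDStr M) (m : M) :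
    (epsTbar k H).lTensor M (s.flip m) =
      (orbit M m).rTensor H (Coalgebra.comul (R := k) (1 : H)) :=
  (WeakHopf.lTensor_epsTbar _).trans (rTensor_comul_one_of_epsSbar _ _ (s.pairR_epsSbar m))

lemma LLYDStr.lTensor_epsSbar {M : LMod k H} (s : LLYDStr M) (m : M) :
    (epsSbar k H).lTensor M (s.flip m) =
      TensorProduct.comm k H M ((orbit M m).lTensor H (Coalgebra.comul (R := k) (1 : H))) :=
  (WeakHopf.lTensor_epsSbar _).trans (rTensor_comm_comul_one_of_epsT _ _ (s.pairL_epsT m))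

end Left

/-! ### Invertibility of σ. -/

section LeftAntipode

variable {k : Type u} {H : Type v} [CommRing k] [Ring H] [Algebra k H] [Coalgebra k H]
  [WeakHopfAlgebra k H] (hS : Function.Bijective (anti k H))

/-- The map `v ⊗ m ↦ m₍₀₎ ⊗ S⁻¹(m₍₋₁₎) v`. -/
def LLYDStr.bwdL {M : LMod k H} (s : LLYDStr M) (V : LMod k H) : V ⊗[k] M →ₗ[k] M ⊗[k] V :=
  twist ((antiInv hS).lTensor M ∘ₗ s.flip) V ∘ₗ (TensorProduct.comm k V M).toLinearMap

/-- For the coopposite comultiplication the convolution of S⁻¹ with the identity is S⁻¹(h₍₂₎) h₍₁₎ =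
ε̄_t(h). In the other order, in the next lemma, it is h₍₂₎ S⁻¹(h₍₁₎) = ε̄_s(h). -/
lemma LLYDStr.twistComp_antiInv_id {M : LMod k H} (s : LLYDStr M) :
    twistComp ((antiInv hS).lTensor M ∘ₗ s.flip) s.flip = (epsTbar k H).lTensor M ∘ₗ s.flip := by
  ext m : 1
  have h1 := twistComp_of_coassoc (s.flip_coassoc m) (antiInv hS) LinearMap.id
  rw [LinearMap.lTensor_id, LinearMap.id_comp] at h1
  rw [h1, LinearMap.comp_apply]
  congr 2
  ext h
  exact antiInv_mul_comul hS h

lemma LLYDStr.twistComp_id_antiInv {M : LMod k H} (s : LLYDStr M) :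
    twistComp s.flip ((antiInv hS).lTensor M ∘ₗ s.flip) = (epsSbar k H).lTensor M ∘ₗ s.flip := by
  ext m : 1
  have h1 := twistComp_of_coassoc (s.flip_coassoc m) LinearMap.id (antiInv hS)
  rw [LinearMap.lTensor_id, LinearMap.id_comp] at h1
  rw [h1, LinearMap.comp_apply]
  congr 2
  ext h
  exact comul_mul_antiInv hS h

lemma LLYDStr.bwdL_fwdL {M : LMod k H} (s : LLYDStr M) (V : LMod k H) (x : M ⊗[k] V) :
    s.bwdL hS V (fwdL s.coact V x) =
      tensorAct k H M V (Coalgebra.comul (R := k) (1 : H)) x := by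
  have h0 : fwdL s.coact V x = TensorProduct.comm k M V (twist s.flip V x) := rfl
  rw [h0]
  clear h0
  simp only [LLYDStr.bwdL, LinearMap.comp_apply, LinearEquiv.coe_coe]
  rw [← TensorProduct.comm_symm, LinearEquiv.symm_apply_apply, twist_twist,
    s.twistComp_antiInv_id]
  induction x with
  | zero => simp
  | add x y hx hy => simp only [map_add, hx, hy]
  | tmul m v =>
    rw [twist_tmul, LinearMap.comp_apply, s.lTensor_epsTbar, tensorAct_apply_tmul]
    obtain ⟨S, hS⟩ := exists_repr (k := k) (Coalgebra.comul (R := k) (1 : H))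
    simp [hS]

lemma LLYDStr.fwdL_bwdL {M : LMod k H} (s : LLYDStr M) (V : LMod k H) (x : V ⊗[k] M) :
    fwdL s.coact V (s.bwdL hS V x) =
      tensorAct k H V M (Coalgebra.comul (R := k) (1 : H)) x := by
  have h0 : ∀ x, fwdL s.coact V x = TensorProduct.comm k M V (twist s.flip V x) := fun x => rfl
  rw [h0]
  simp only [LLYDStr.bwdL, LinearMap.comp_apply]
  rw [twist_twist, s.twistComp_id_antiInv]
  induction x with
  | zero => simp
  | add x y hx hy => simp only [map_add, hx, hy]
  | tmul v m =>
    change TensorProduct.comm k M V (twist _ V (m ⊗ₜ v)) = _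
    rw [twist_tmul, LinearMap.comp_apply, s.lTensor_epsSbar, tensorAct_apply_tmul]
    obtain ⟨S, hS⟩ := exists_repr (k := k) (Coalgebra.comul (R := k) (1 : H))
    simp [hS]

/-- The isomorphism `σ_{M,V}`. -/
def LLYDStr.sigma {M : LMod k H} (s : LLYDStr M) (V : LMod k H) : M ⊗ V ≅ V ⊗ M :=
  crossIso (fwdL s.coact V) (s.bwdL hS V) (s.fwdL_linear V) (s.bwdL_fwdL hS V) (s.fwdL_bwdL hS V)

lemma LLYDStr.incl_sigma {M : LMod k H} (s : LLYDStr M) (V : LMod k H) (y : TensorT M V) :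
    incl V M (klin (s.sigma hS V).hom y) = fwdL s.coact V (incl M V y) :=
  incl_crossIso_hom ..

lemma LLYDStr.incl_sigma_tm {M : LMod k H} (s : LLYDStr M) (V : LMod k H) (m : M) (v : V) :
    incl V M (klin (s.sigma hS V).hom (tm m v : TensorT M V)) =
      (orbit V v).rTensor M (s.coact m) := by
  refine (s.incl_sigma hS V _).trans ?_
  rw [incl_tm', s.fwdL_tensorAct_comul_one, fwdL_tmul]

end LeftAntipode

/-! ### The tensor axiom of a left half-braiding, evaluated on elements. -/

section LeftMonoidal

variable {k : Type u} {H : Type v} [CommRing k] [Ring H] [Algebra k H] [Coalgebra k H]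
  [WeakBialgebra k H]

lemma lTensor_fwdL_assoc {M : LMod k H} (l : M →ₗ[k] H ⊗[k] M) {U U' : LMod k H} (u : U)
    (u' : U') (t : H ⊗[k] M) :
    (fwdL l U').lTensor U (TensorProduct.assoc k U M U'
      ((orbit U u).rTensor M t ⊗ₜ u')) =
      TensorProduct.map (orbit U u) ((orbit U' u').rTensor M) (l.lTensor H t) := by
  induction t with
  | zero => simp
  | add x y hx hy => simp only [map_add, TensorProduct.add_tmul, hx, hy]
  | tmul a b => simp

lemma assoc_rTensor_map {M : LMod k H} {U U' : LMod k H} (u : U) (u' : U')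
    (t : (H ⊗[k] H) ⊗[k] M) :
    TensorProduct.assoc k U U' M
      ((TensorProduct.map (orbit U u) (orbit U' u')).rTensor M t) =
      TensorProduct.map (orbit U u) ((orbit U' u').rTensor M) (TensorProduct.assoc k H H M t) := by
  have : (TensorProduct.assoc k U U' M).toLinearMap ∘ₗ
      (TensorProduct.map (orbit U u) (orbit U' u')).rTensor M =
      TensorProduct.map (orbit U u) ((orbit U' u').rTensor M) ∘ₗ
        (TensorProduct.assoc k H H M).toLinearMap := by
    refine TensorProduct.ext (TensorProduct.ext' fun a b => LinearMap.ext fun m => ?_)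
    rfl
  exact LinearMap.congr_fun this t

variable {M : LMod k H} (t : ∀ U : LMod k H, M ⊗ U ⟶ U ⊗ M) (l : M →ₗ[k] H ⊗[k] M)
  (ht : ∀ (U : LMod k H) (y : TensorT M U), incl U M (klin (t U) y) = fwdL l U (incl M U y))
  (htm : ∀ (U : LMod k H) (m : M) (u : U),
    incl U M (klin (t U) (tm m u : TensorT M U)) = (orbit U u).rTensor M (l m))
include ht htm

lemma assoc_inclL_braiding_tensor (U U' : LMod k H) (m : M) (u : U) (u' : U') :
    TensorProduct.assoc k U U' M (inclL U U' M (klin (t (U ⊗ U'))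
      (tm m (tm u u' : TensorT U U') : TensorT M (tensorObj U U')))) =
      TensorProduct.map (orbit U u) ((orbit U' u').rTensor M)
        (TensorProduct.assoc k H H M ((Coalgebra.comul (R := k)).rTensor M (l m))) := by
  simp only [inclL, LinearMap.comp_apply]
  have h1 := htm (tensorObj U U') m (tm u u' : TensorT U U')
  refine (congrArg (fun x => TensorProduct.assoc k U U' M ((incl U U').rTensor M x))
    h1).trans ?_
  rw [← LinearMap.comp_apply, ← LinearMap.rTensor_comp, incl_orbit_tm, LinearMap.rTensor_comp,
    LinearMap.comp_apply, assoc_rTensor_map]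

/-- This side of the axiom iterates the coaction, while `assoc_inclL_braiding_tensor` applies Δ to
it; their equality is coassociativity. -/
lemma assoc_inclL_braiding_braiding (U U' : LMod k H) (m : M) (u : U) (u' : U') :
    TensorProduct.assoc k U U' M (inclL U U' M (klin ((α_ M U U').inv ≫ (t U ▷ U') ≫
        (α_ U M U').hom ≫ (U ◁ t U') ≫ (α_ U U' M).inv)
      (tm m (tm u u' : TensorT U U') : TensorT M (tensorObj U U')))) =
      TensorProduct.map (orbit U u) ((orbit U' u').rTensor M) (l.lTensor H (l m)) := by
  have hP : fwdL l U' ∘ₗ tensorAct k H M U' (Coalgebra.comul (R := k) (1 : H)) = fwdL l U' := by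
    ext m u : 3
    have h1 := htm U' m u
    rw [ht, incl_tm'] at h1
    simpa using h1
  change TensorProduct.assoc k U U' M (inclL U U' M (assocInvLin U U' M (tensorLin (𝟙 U) (t U')
    (assocLin U M U' (tensorLin (t U) (𝟙 U') (assocInvLin M U U'
      (tm m (tm u u' : TensorT U U')))))))) = _
  have e0 : ∀ z : TensorT U (tensorObj M U'), inclR U U' M (tensorLin (𝟙 U) (t U') z) =
      (fwdL l U').lTensor U (inclR U M U' z) := by
    intro z
    simp only [inclR, LinearMap.comp_apply]
    have h1 := incl_tensorLin (𝟙 U) (t U') z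
    refine (congrArg ((incl U' M).lTensor U) h1).trans ?_
    have h2 : ∀ w : U ⊗[k] (TensorT M U'), (incl U' M).lTensor U
        (TensorProduct.map (klin (𝟙 U)) (klin (t U')) w) =
        (fwdL l U').lTensor U ((incl M U').lTensor U w) := by
      intro w
      induction w with
      | zero => simp
      | add x y hx hy => simp only [map_add, hx, hy]
      | tmul a b =>
        change a ⊗ₜ incl U' M (klin (t U') b) = a ⊗ₜ fwdL l U' (incl M U' b)
        rw [ht]
    exact h2 _
  rw [inclL_assocInvLin, LinearEquiv.apply_symm_apply, e0, assocInvLin_tm, tensorLin_tm,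
    inclR_assocLin, assoc_inclL_tm, ← LinearMap.comp_apply, ← LinearMap.lTensor_comp, hP]
  change (fwdL l U').lTensor U (TensorProduct.assoc k U M U'
    (incl U M (klin (t U) (tm m u)) ⊗ₜ u')) = _
  rw [htm, lTensor_fwdL_assoc]

end LeftMonoidal

/-! ### Half-braidings and left-left Yetter-Drinfeld structures. -/

section LeftBraiding

lemma HalfBraiding.ext' {C : Type*} [Category C] [MonoidalCategory C] {X : C}
    {a b : HalfBraiding X} (h : ∀ U, (a.β U).hom = (b.β U).hom) : a = b := by
  cases a; cases b
  congr
  funext U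
  exact Iso.ext (h U)

/-- The unit condition is not a field of `HalfBraiding` but follows from the tensor axiom. It is
read off from the unit coherence of the braiding in the left center. -/
lemma HalfBraiding.β_unit {C : Type*} [Category C] [MonoidalCategory C] {X : C}
    (b : HalfBraiding X) : (b.β (𝟙_ C)).hom = (ρ_ X).hom ≫ (λ_ X).inv := by
  let Y : Center C := ⟨X, b⟩
  have h := congrArg Center.Hom.f (braiding_leftUnitor Y)
  rw [Iso.eq_comp_inv]
  exact h

variable {k : Type u} {H : Type v} [CommRing k] [Ring H] [Algebra k H] [Coalgebra k H]

section

variable [WeakHopfAlgebra k H] (hS : Function.Bijective (anti k H))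

/-- The half-braiding of a left-left Yetter-Drinfeld module. -/
def LLYDStr.toHalfBraiding {M : LMod k H} (s : LLYDStr M) : HalfBraiding M where
  β := s.sigma hS
  naturality {U U'} f := hom_ext_incl fun m u => by
    rw [klin_comp, klin_comp, LinearMap.comp_apply, LinearMap.comp_apply, incl_whiskerRight,
      klin_whiskerLeft_tm, s.incl_sigma_tm, s.incl_sigma_tm, ← klin_comp_orbit,
      LinearMap.rTensor_comp, LinearMap.comp_apply]
  monoidal U U' := hom_ext₃' fun m u u' => by
    apply inclL_injective U U' M
    apply (TensorProduct.assoc k U U' M).injective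
    have h1 := assoc_inclL_braiding_tensor (fun U => (s.sigma hS U).hom) s.coact
      (s.incl_sigma hS) (s.incl_sigma_tm hS) U U' m u u'
    have h2 := assoc_inclL_braiding_braiding (fun U => (s.sigma hS U).hom) s.coact
      (s.incl_sigma hS) (s.incl_sigma_tm hS) U U' m u u'
    refine h1.trans (Eq.trans ?_ h2.symm)
    rw [s.coassoc]

end

variable [WeakBialgebra k H]

/-- The left coaction of an object of the left center. -/
def HalfBraiding.coaction {M : LMod k H} (b : HalfBraiding M) : M →ₗ[k] H ⊗[k] M :=
  incl (regular k H) M ∘ₗ klin (b.β (regular k H)).hom ∘ₗ proj M (regular k H) ∘ₗ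
    (TensorProduct.mk k M H).flip 1

lemma HalfBraiding.incl_tm {M : LMod k H} (b : HalfBraiding M) (U : LMod k H) (m : M)
    (u : U) : incl U M (klin (b.β U).hom (tm m u : TensorT M U)) =
      (orbit U u).rTensor M (HalfBraiding.coaction b m) := by
  have h1 := congrArg (fun f => incl U M (klin f (tm m (1 : H) : TensorT M (regular k H))))
    (b.naturality (orbitHom U u))
  simp only [klin_comp, LinearMap.comp_apply] at h1
  rw [klin_whiskerLeft_tm, incl_whiskerRight, klin_orbitHom] at h1
  refine Eq.trans ?_ h1
  rw [orbit_apply, one_smul]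

lemma HalfBraiding.incl_proj {M : LMod k H} (b : HalfBraiding M) (U : LMod k H)
    (x : M ⊗[k] U) :
    incl U M (klin (b.β U).hom (proj M U x)) = fwdL (HalfBraiding.coaction b) U x := by
  have : incl U M ∘ₗ klin (b.β U).hom ∘ₗ proj M U = fwdL (HalfBraiding.coaction b) U :=
    TensorProduct.ext' fun m u => (HalfBraiding.incl_tm b U m u).trans (fwdL_tmul _ _ _ _).symm
  exact LinearMap.congr_fun this x

lemma HalfBraiding.incl_eq_fwdL {M : LMod k H} (b : HalfBraiding M) (U : LMod k H)
    (y : TensorT M U) :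
    incl U M (klin (b.β U).hom y) = fwdL (HalfBraiding.coaction b) U (incl M U y) := by
  rw [← HalfBraiding.incl_proj, WeakHopf.proj_incl]

/-- The left-left Yetter-Drinfeld structure given by a half-braiding. -/
def HalfBraiding.toLLYDStr {M : LMod k H} (b : HalfBraiding M) : LLYDStr M where
  coact := HalfBraiding.coaction b
  coassoc m := by
    have h := congrArg (fun f => TensorProduct.assoc k (regular k H) (regular k H) M
      (inclL (regular k H) (regular k H) M (klin f
      (tm m (tm (1 : H) (1 : H) : TensorT (regular k H) (regular k H)) :
        TensorT M (tensorObj (regular k H) (regular k H))))))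
        (b.monoidal (regular k H) (regular k H))
    have h1 := assoc_inclL_braiding_tensor (fun U => (b.β U).hom) (HalfBraiding.coaction b)
      (HalfBraiding.incl_eq_fwdL b) (HalfBraiding.incl_tm b) (regular k H) (regular k H) m 1 1
    have h2 := assoc_inclL_braiding_braiding (fun U => (b.β U).hom) (HalfBraiding.coaction b)
      (HalfBraiding.incl_eq_fwdL b) (HalfBraiding.incl_tm b) (regular k H) (regular k H) m 1 1
    have h3 := h1.symm.trans (h.trans h2)
    rwa [orbit_regular_one, LinearMap.rTensor_id, TensorProduct.map_id, LinearMap.id_apply,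
      LinearMap.id_apply] at h3
  counit m := by
    have h := congrArg (fun f => incl (unitObj k H) M (klin f
      (tm m (tOne k H) : TensorT M (unitObj k H)))) (HalfBraiding.β_unit b)
    have h1 := (HalfBraiding.incl_tm b (unitObj k H) m (tOne k H)).symm.trans
      (h.trans (incl_rightUnitor_comp_inv M m))
    rw [orbit_tOne] at h1
    have h2 := congrArg (fun x => TensorProduct.lid k M
      ((Coalgebra.counit (R := k) ∘ₗ tIncl k H).rTensor M x)) h1
    have h3 : (Coalgebra.counit (R := k) ∘ₗ tIncl k H) ∘ₗ tProj k H =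
        Coalgebra.counit (R := k) := by
      ext h
      exact counit_tIncl_tProj h
    have h4 : (Coalgebra.counit (R := k) ∘ₗ tIncl k H).rTensor M ∘ₗ (tProj k H).rTensor M =
        (Coalgebra.counit (R := k)).rTensor M := by
      rw [← LinearMap.rTensor_comp, h3]
    have h5 : (Coalgebra.counit (R := k) ∘ₗ tIncl k H).rTensor M ∘ₗ
        TensorProduct.map (tProj k H) (orbit M m) =
        (orbit M m).lTensor k ∘ₗ (Coalgebra.counit (R := k)).rTensor H := by
      rw [LinearMap.rTensor_comp_map, h3, LinearMap.lTensor_comp_rTensor]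
    have h6 := (LinearMap.congr_fun h4 (HalfBraiding.coaction b m)).symm
    refine (congrArg (TensorProduct.lid k M) h6).trans (h2.trans ?_)
    refine (congrArg (TensorProduct.lid k M) (LinearMap.congr_fun h5 _)).trans ?_
    rw [LinearMap.comp_apply, Coalgebra.rTensor_counit_comul]
    simp
  mem m := incl_mem _
  compat h m := by
    have h1 := HalfBraiding.incl_eq_fwdL b (regular k H)
      (h • (tm m (1 : H) : TensorT M (regular k H)))
    rw [klin_smul] at h1
    have h2 : ∀ y : TensorT (regular k H) M, incl (regular k H) M (h • y) =
        tensorAct k H (regular k H) M (Coalgebra.comul (R := k) h) (incl (regular k H) M y) :=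
      fun y => rfl
    refine (h2 _).symm.trans (h1.trans ?_)
    rw [incl_smul, incl_tm', ← tensorAct_comul_mul, mul_one, ← rTensor_orbit_crossL,
      orbit_regular_one, LinearMap.rTensor_id]
    rfl

lemma LLYDStr.ext' {M : LMod k H} {s s' : LLYDStr M} (h : s.coact = s'.coact) : s = s' := by
  cases s; cases s'
  congr

end LeftBraiding

/-! ### The two passages on the left are mutually inverse. -/

section LeftInverse

variable {k : Type u} {H : Type v} [CommRing k] [Ring H] [Algebra k H] [Coalgebra k H]
  [WeakHopfAlgebra k H] (hS : Function.Bijective (anti k H))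

lemma HalfBraiding.toHalfBraiding_toLLYDStr {M : LMod k H} (b : HalfBraiding M) :
    (HalfBraiding.toLLYDStr b).toHalfBraiding hS = b :=
  HalfBraiding.ext' fun U => hom_ext_incl fun m u =>
    ((HalfBraiding.toLLYDStr b).incl_sigma_tm hS U m u).trans (HalfBraiding.incl_tm b U m u).symm

lemma LLYDStr.toLLYDStr_toHalfBraiding {M : LMod k H} (s : LLYDStr M) :
    HalfBraiding.toLLYDStr (s.toHalfBraiding hS) = s := by
  apply LLYDStr.ext'
  ext m : 1
  refine (s.incl_sigma_tm hS (regular k H) m (1 : H)).trans ?_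
  rw [orbit_regular_one, LinearMap.rTensor_id, LinearMap.id_apply]

end LeftInverse

/-! ### Isomorphisms of categories and strict braided functors. -/

section StrictFunctors

universe v₁ v₂ v₃ u₁ u₂ u₃

variable {C : Type u₁} [Category.{v₁} C] {D : Type u₂} [Category.{v₂} D]

lemma isCatIso_of_bijective (F : C ⥤ D) [F.Full] [F.Faithful] (h : Function.Bijective F.obj) :
    IsCatIso F := by
  have hG : ∀ Y, F.obj (Function.surjInv h.2 Y) = Y := Function.surjInv_eq h.2
  -- The chosen preimage G Y satisfies F (G Y) = Y only as a propositional equality, so morphisms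
  -- are conjugated by `eqToHom` before being lifted along F.
  refine ⟨{ obj := Function.surjInv h.2
            map := fun {X Y} f => F.preimage (eqToHom (hG X) ≫ f ≫ eqToHom (hG Y).symm)
            map_id := fun X => F.map_injective (by simp)
            map_comp := fun f g => F.map_injective (by simp) }, ?_, ?_⟩
  · exact CategoryTheory.Functor.ext (fun X => h.1 (hG (F.obj X))) fun X Y f => F.map_injective (by
      simp [eqToHom_map])
  · exact CategoryTheory.Functor.ext hG fun X Y f => by simp

/-- A braided monoidal functor that preserves the unit object and the tensor product, and whose
structure morphisms are identities. -/
def IsStrictBraided [MonoidalCategory C] [MonoidalCategory D] (bC : BraidedCategory C)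
    (bD : BraidedCategory D) (F : C ⥤ D) : Prop :=
  ∃ (hunit : 𝟙_ D = F.obj (𝟙_ C))
    (htensor : ∀ X Y : C, F.obj X ⊗ F.obj Y = F.obj (X ⊗ Y)) (_ : F.Braided),
    Functor.LaxMonoidal.ε F = eqToHom hunit ∧
      ∀ X Y : C, Functor.LaxMonoidal.μ F X Y = eqToHom (htensor X Y)

lemma IsStrictBraided.comp {E : Type u₃} [Category.{v₃} E] [MonoidalCategory C]
    [MonoidalCategory D] [MonoidalCategory E] {bC : BraidedCategory C} {bD : BraidedCategory D}
    {bE : BraidedCategory E} {F : C ⥤ D} {G : D ⥤ E} (hF : IsStrictBraided bC bD F)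
    (hG : IsStrictBraided bD bE G) : IsStrictBraided bC bE (F ⋙ G) := by
  obtain ⟨u, t, iF, hu, ht⟩ := hF
  obtain ⟨u', t', iG, hu', ht'⟩ := hG
  refine ⟨u'.trans (congrArg G.obj u), fun X Y => (t' _ _).trans (congrArg G.obj (t X Y)),
    inferInstance, ?_, fun X Y => ?_⟩
  · rw [Functor.LaxMonoidal.comp_ε, hu, hu', eqToHom_map, eqToHom_trans]
  · rw [Functor.LaxMonoidal.comp_μ, ht, ht', eqToHom_map, eqToHom_trans]

/-- The monoidal data stay the same; only the braiding square has to be inverted, at the exchanged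
pair of objects. -/
lemma IsStrictBraided.reverse [MonoidalCategory C]
    [MonoidalCategory D] [bC : BraidedCategory C] [bD : BraidedCategory D]
    {F : C ⥤ D} (hF : IsStrictBraided bC bD F) :
    IsStrictBraided (reverseBraiding C) (reverseBraiding D) F := by
  obtain ⟨u, t, iF, hu, ht⟩ := hF
  refine ⟨u, t, @Functor.Braided.mk C _ _ (reverseBraiding C) D _ _ (reverseBraiding D) F
    iF.toMonoidal fun X Y => ?_, hu, ht⟩
  have h := iF.braided Y X
  change Functor.LaxMonoidal.μ F X Y ≫ F.map (β_ Y X).inv =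
    (β_ (F.obj Y) (F.obj X)).inv ≫ Functor.LaxMonoidal.μ F Y X
  rw [Iso.eq_inv_comp, ← Category.assoc, ← h, Category.assoc, ← F.map_comp, Iso.hom_inv_id,
    F.map_id, Category.comp_id]

/-- Braided monoidal structures can be transported along isomorphisms of categories. -/
theorem exists_isBraidedMonoidalIso (F : C ⥤ D) [F.Full] [F.Faithful]
    (h : Function.Bijective F.obj) [MonoidalCategory D] (bD : BraidedCategory D) :
    ∃ (_ : MonoidalCategory C) (bC : BraidedCategory C), IsBraidedMonoidalIso bC bD F := by
  have hG : ∀ Y, F.obj (Function.surjInv h.2 Y) = Y := Function.surjInv_eq h.2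
  -- The product of X and Y is defined as G (F X ⊗ F Y). As F ∘ G is the identity on objects, F
  -- preserves it on the nose and the structure morphisms are `eqToHom`s; the axioms are reflected
  -- by the faithful F.
  let G : D → C := Function.surjInv h.2
  let m : ∀ X Y : C, F.obj X ⊗ F.obj Y ≅ F.obj (G (F.obj X ⊗ F.obj Y)) :=
    fun X Y => eqToIso (hG _).symm
  let e : 𝟙_ D ≅ F.obj (G (𝟙_ D)) := eqToIso (hG _).symm
  let : MonoidalCategoryStruct C :=
    { tensorObj := fun X Y => G (F.obj X ⊗ F.obj Y)
      whiskerLeft := fun X _ _ f => F.preimage ((m _ _).inv ≫ (F.obj X ◁ F.map f) ≫ (m _ _).hom)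
      whiskerRight := fun f Y => F.preimage ((m _ _).inv ≫ (F.map f ▷ F.obj Y) ≫ (m _ _).hom)
      tensorHom := fun f g => F.preimage ((m _ _).inv ≫ (F.map f ⊗ₘ F.map g) ≫ (m _ _).hom)
      tensorUnit := G (𝟙_ D)
      associator := fun X Y Z => F.preimageIso
        (((m _ _).symm ≪≫ ((m X Y).symm ⊗ᵢ .refl _)) ≪≫ α_ (F.obj X) (F.obj Y) (F.obj Z) ≪≫
          ((.refl _ ⊗ᵢ m Y Z) ≪≫ m _ _))
      leftUnitor := fun X => F.preimageIso
        (((m _ _).symm ≪≫ (e.symm ⊗ᵢ .refl _)) ≪≫ λ_ (F.obj X))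
      rightUnitor := fun X => F.preimageIso
        (((m _ _).symm ≪≫ (.refl _ ⊗ᵢ e.symm)) ≪≫ ρ_ (F.obj X)) }
  let data : Monoidal.InducingFunctorData F :=
    { μIso := m
      εIso := e
      whiskerLeft_eq := fun X _ _ f => F.map_preimage _
      whiskerRight_eq := fun f Y => F.map_preimage _
      tensorHom_eq := fun f g => F.map_preimage _
      associator_eq := fun X Y Z => F.map_preimage _
      leftUnitor_eq := fun X => F.map_preimage _
      rightUnitor_eq := fun X => F.map_preimage _ }
  let : MonoidalCategory C := Monoidal.induced F data
  let : F.Monoidal := (Monoidal.fromInducedCoreMonoidal F data).toMonoidal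
  let bC : BraidedCategory C := BraidedCategory.ofFullyFaithful F
  let : F.Braided :=
    { braided := fun X Y => by
        change _ ≫ F.map (F.preimage _) = _
        rw [F.map_preimage]
        simp }
  exact ⟨inferInstance, bC, isCatIso_of_bijective F h, (hG _).symm, fun X Y => (hG _).symm,
    inferInstance, rfl, fun X Y => rfl⟩

end StrictFunctors

/-! ### Inverting half-braidings: from the left to the right center. -/

section Centers

universe v₁ u₁

variable {C : Type u₁} [Category.{v₁} C] [MonoidalCategory C]

/-- The right half-braiding inverse to a half-braiding. -/
def HalfBraiding.inverse {X : C} (b : HalfBraiding X) : RightHalfBraiding X where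
  τ U := (b.β U).symm
  naturality {U U'} f := by
    rw [Iso.symm_hom, Iso.symm_hom, Iso.eq_inv_comp, ← Category.assoc, ← b.naturality,
      Category.assoc, Iso.hom_inv_id, Category.comp_id]
  unit := by
    rw [Iso.symm_hom, ← cancel_epi (b.β (𝟙_ C)).hom, Iso.hom_inv_id, HalfBraiding.β_unit]
    simp
  monoidal U U' := by
    have h : (b.β (U ⊗ U')).inv = (α_ U U' X).hom ≫ (U ◁ (b.β U').inv) ≫ (α_ U X U').inv ≫
        ((b.β U).inv ▷ U') ≫ (α_ X U U').hom := by
      rw [← cancel_epi (b.β (U ⊗ U')).hom, Iso.hom_inv_id, b.monoidal]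
      simp
    rw [Iso.symm_hom, Iso.symm_hom, Iso.symm_hom, h]
    simp

/-- The half-braiding inverse to a right half-braiding. -/
def RightHalfBraiding.inverse {X : C} (b : RightHalfBraiding X) : HalfBraiding X where
  β U := (b.τ U).symm
  naturality {U U'} f := by
    rw [Iso.symm_hom, Iso.symm_hom, Iso.eq_inv_comp, ← Category.assoc, ← b.naturality,
      Category.assoc, Iso.hom_inv_id, Category.comp_id]
  monoidal U U' := by
    rw [Iso.symm_hom, Iso.symm_hom, Iso.symm_hom, ← cancel_epi (b.τ (U ⊗ U')).hom,
      Iso.hom_inv_id, RightCenter.monoidal']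
    simp

variable (C) in
/-- The functor from the left center to the right center that inverts the half-braidings. -/
def centerInverse : Center C ⥤ RightCenter C where
  obj M := ⟨M.1, HalfBraiding.inverse M.2⟩
  map {M N} f := ⟨f.f, fun U => by
    change (U ◁ f.f) ≫ (N.2.β U).inv = (M.2.β U).inv ≫ (f.f ▷ U)
    rw [Iso.eq_inv_comp, ← Category.assoc, ← f.comm, Category.assoc, Iso.hom_inv_id,
      Category.comp_id]⟩

/-- When two objects differ only in their half-braidings, a transport between them is the identity
in C. This reduces the coherence of `centerInverse` to trivial identities in C. -/
lemma RightCenter.eqToHom_f {X : C} {a b : RightHalfBraiding X}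
    (h : (⟨X, a⟩ : RightCenter C) = ⟨X, b⟩) : (eqToHom h).f = 𝟙 X := by
  cases h
  rfl

lemma centerInverse_unit : 𝟙_ (RightCenter C) = (centerInverse C).obj (𝟙_ (Center C)) := by
  change (⟨𝟙_ C, RightCenter.unitHB⟩ : RightCenter C) =
    ⟨𝟙_ C, HalfBraiding.inverse (𝟙_ (Center C)).2⟩
  congr 1

/-- The half-braiding of M ⊗ N moves U past N and next past M. Its inverse uses the inverses in the
opposite order, which is how `RightCenter.tensorHB` composes them. -/
lemma centerInverse_tensor (M N : Center C) :
    (centerInverse C).obj M ⊗ (centerInverse C).obj N = (centerInverse C).obj (M ⊗ N) := by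
  change (⟨M.1 ⊗ N.1, RightCenter.tensorHB (HalfBraiding.inverse M.2)
    (HalfBraiding.inverse N.2)⟩ : RightCenter C) =
    ⟨M.1 ⊗ N.1, HalfBraiding.inverse (M ⊗ N).2⟩
  congr 1
  apply RightHalfBraiding.ext'
  intro U
  change _ = ((M ⊗ N).2.β U).inv
  rw [Center.tensor_β]
  simp [RightCenter.tensorHB, HalfBraiding.inverse]

lemma eqToHom_centerInverse_unit : (eqToHom (centerInverse_unit (C := C))).f = 𝟙 (𝟙_ C) :=
  RightCenter.eqToHom_f _

lemma eqToHom_centerInverse_tensor (M N : Center C) :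
    (eqToHom (centerInverse_tensor M N)).f = 𝟙 (M.1 ⊗ N.1) :=
  RightCenter.eqToHom_f _

/-- The monoidal structure of `centerInverse`. -/
def centerInverseCoreMonoidal : (centerInverse C).CoreMonoidal where
  εIso := eqToIso centerInverse_unit
  μIso M N := eqToIso (centerInverse_tensor M N)
  μIso_hom_natural_left {M N} f P := RightCenter.ext' (by
    change (f.f ▷ P.1) ≫ (eqToHom (centerInverse_tensor N P)).f =
      (eqToHom (centerInverse_tensor M P)).f ≫ (f.f ▷ P.1)
    rw [eqToHom_centerInverse_tensor, eqToHom_centerInverse_tensor]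
    exact (Category.comp_id _).trans (Category.id_comp _).symm)
  μIso_hom_natural_right {M N} P f := RightCenter.ext' (by
    change (P.1 ◁ f.f) ≫ (eqToHom (centerInverse_tensor P N)).f =
      (eqToHom (centerInverse_tensor P M)).f ≫ (P.1 ◁ f.f)
    rw [eqToHom_centerInverse_tensor, eqToHom_centerInverse_tensor]
    exact (Category.comp_id _).trans (Category.id_comp _).symm)
  associativity M N P := RightCenter.ext' (by
    change ((eqToHom (centerInverse_tensor M N)).f ▷ P.1) ≫
        (eqToHom (centerInverse_tensor (M ⊗ N) P)).f ≫ (α_ M.1 N.1 P.1).hom =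
      (α_ M.1 N.1 P.1).hom ≫ (M.1 ◁ (eqToHom (centerInverse_tensor N P)).f) ≫
        (eqToHom (centerInverse_tensor M (N ⊗ P))).f
    rw [eqToHom_centerInverse_tensor, eqToHom_centerInverse_tensor, eqToHom_centerInverse_tensor,
      eqToHom_centerInverse_tensor]
    change (𝟙 (M.1 ⊗ N.1) ▷ P.1) ≫ 𝟙 ((M.1 ⊗ N.1) ⊗ P.1) ≫ (α_ M.1 N.1 P.1).hom =
      (α_ M.1 N.1 P.1).hom ≫ (M.1 ◁ 𝟙 (N.1 ⊗ P.1)) ≫ 𝟙 (M.1 ⊗ (N.1 ⊗ P.1))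
    simp)
  left_unitality M := RightCenter.ext' (by
    change (λ_ M.1).hom = ((eqToHom (centerInverse_unit (C := C))).f ▷ M.1) ≫
        (eqToHom (centerInverse_tensor (𝟙_ (Center C)) M)).f ≫ (λ_ M.1).hom
    rw [eqToHom_centerInverse_tensor, eqToHom_centerInverse_unit]
    change (λ_ M.1).hom = (𝟙 (𝟙_ C) ▷ M.1) ≫ 𝟙 (𝟙_ C ⊗ M.1) ≫ (λ_ M.1).hom
    simp)
  right_unitality M := RightCenter.ext' (by
    change (ρ_ M.1).hom = (M.1 ◁ (eqToHom (centerInverse_unit (C := C))).f) ≫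
        (eqToHom (centerInverse_tensor M (𝟙_ (Center C)))).f ≫ (ρ_ M.1).hom
    rw [eqToHom_centerInverse_tensor, eqToHom_centerInverse_unit]
    change (ρ_ M.1).hom = (M.1 ◁ 𝟙 (𝟙_ C)) ≫ 𝟙 (M.1 ⊗ 𝟙_ C) ≫ (ρ_ M.1).hom
    simp)

lemma Center.braiding_inv_f (M N : Center C) : (β_ M N).inv.f = (M.2.β N.1).inv := by
  have h : (M.2.β N.1).hom ≫ (β_ M N).inv.f = 𝟙 (M.1 ⊗ N.1) :=
    congrArg Center.Hom.f (β_ M N).hom_inv_id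
  exact ((Iso.eq_inv_comp _).mpr h).trans (Category.comp_id _)

/-- The braiding of the right center at (M, N) is the half-braiding of N at M, here σ_{N,M}⁻¹ =
c_{N,M}⁻¹; this is the reversed braiding of the left center. -/
lemma isStrictBraided_centerInverse :
    IsStrictBraided (reverseBraiding (Center C)) inferInstance (centerInverse C) := by
  let i : (centerInverse C).Monoidal := centerInverseCoreMonoidal.toMonoidal
  refine ⟨centerInverse_unit, centerInverse_tensor,
    @Functor.Braided.mk _ _ _ (reverseBraiding (Center C)) _ _ _ _ (centerInverse C) i
      fun M N => RightCenter.ext' ?_, rfl, fun M N => rfl⟩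
  change (eqToHom (centerInverse_tensor M N)).f ≫ (β_ N M).inv.f =
    (N.2.β M.1).inv ≫ (eqToHom (centerInverse_tensor N M)).f
  rw [eqToHom_centerInverse_tensor, eqToHom_centerInverse_tensor, Center.braiding_inv_f]
  exact (Category.id_comp _).trans (Category.comp_id _).symm

end Centers

/-! ### The functors between Yetter-Drinfeld modules and centers. -/

section Functors

variable {k : Type u} {H : Type v} [CommRing k] [Ring H] [Algebra k H] [Coalgebra k H]
  [WeakHopfAlgebra k H]

lemma lTensor_rTensor_apply {A B C D : Type*} [AddCommGroup A] [Module k A] [AddCommGroup B]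
    [Module k B] [AddCommGroup C] [Module k C] [AddCommGroup D] [Module k D]
    (f : A →ₗ[k] B) (g : C →ₗ[k] D) (t : A ⊗[k] C) :
    g.lTensor B (f.rTensor C t) = f.rTensor D (g.lTensor A t) :=
  LinearMap.congr_fun ((LinearMap.lTensor_comp_rTensor _ _ _).trans
    (LinearMap.rTensor_comp_lTensor _ _ _).symm) t

lemma LRYD.toHalfBraiding_comm {M N : LRYD k H} (f : M ⟶ N) (U : LMod k H) :
    (U ◁ f.f) ≫ (N.str.toHalfBraiding.τ U).hom =
      (M.str.toHalfBraiding.τ U).hom ≫ (f.f ▷ U) :=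
  hom_ext_incl fun u m => by
    change incl N.X U (klin (N.str.tau U).hom (klin (U ◁ f.f) (tm u m))) =
      incl N.X U (klin (f.f ▷ U) (klin (M.str.tau U).hom (tm u m)))
    rw [incl_whiskerRight, klin_whiskerLeft_tm, N.str.incl_tau_tm, M.str.incl_tau_tm, f.colinear]
    exact lTensor_rTensor_apply _ _ _

/-- Colinearity is compatibility with the half-braidings at the regular module, evaluated at 1 ⊗_t
m; this gives fullness. -/
lemma LRYD.colinear_of_comm {M N : LRYD k H} (f : M.X ⟶ N.X)
    (h : ∀ U : LMod k H, (U ◁ f) ≫ (N.str.toHalfBraiding.τ U).hom =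
      (M.str.toHalfBraiding.τ U).hom ≫ (f ▷ U)) (m : M.X) :
    N.str.ρ (klin f m) = (klin f).rTensor H (M.str.ρ m) := by
  have h1 := congrArg (fun g => incl N.X (regular k H) (klin g
    (tm (1 : H) m : TensorT (regular k H) M.X))) (h (regular k H))
  change incl N.X (regular k H) (klin (N.str.tau (regular k H)).hom
      (klin (regular k H ◁ f) (tm (1 : H) m))) =
    incl N.X (regular k H) (klin (f ▷ regular k H) (klin (M.str.tau (regular k H)).hom
      (tm (1 : H) m))) at h1
  rwa [incl_whiskerRight, klin_whiskerLeft_tm, N.str.incl_tau_tm, M.str.incl_tau_tm,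
    orbit_regular_one, LinearMap.lTensor_id, LinearMap.lTensor_id] at h1

variable (k H) in
/-- The functor from left-right Yetter-Drinfeld modules to the right center. -/
abbrev toRightCenterFunctor : LRYD k H ⥤ RightCenter (LMod k H) :=
  LRYD.toRightCenter (fun M => M.str.toHalfBraiding) LRYD.toHalfBraiding_comm

instance : (toRightCenterFunctor k H).Faithful where
  map_injective {_ _ _ _} h := LRYD.Hom.ext (congrArg RightCenter.Hom.f h)

instance : (toRightCenterFunctor k H).Full where
  map_surjective {M N} g := ⟨⟨g.f, LRYD.colinear_of_comm (M := M) (N := N) g.f g.comm⟩, rfl⟩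

lemma toRightCenterFunctor_bijective : Function.Bijective (toRightCenterFunctor k H).obj := by
  refine Function.bijective_iff_has_inverse.mpr ⟨fun X => ⟨X.X, X.hb.toLRYDStr⟩, ?_, ?_⟩
  · rintro ⟨X, s⟩
    exact congrArg (LRYD.mk X) s.toLRYDStr_toHalfBraiding
  · rintro ⟨X, b⟩
    exact congrArg (RightCenter.mk X) b.toHalfBraiding_toLRYDStr

section

variable (hS : Function.Bijective (anti k H))

lemma LLYD.toHalfBraiding_comm {M N : LLYD k H} (f : M ⟶ N) (U : LMod k H) :
    (f.f ▷ U) ≫ ((N.str.toHalfBraiding hS).β U).hom =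
      ((M.str.toHalfBraiding hS).β U).hom ≫ (U ◁ f.f) :=
  hom_ext_incl fun m u => by
    change incl U N.X (klin (N.str.sigma hS U).hom (klin (f.f ▷ U) (tm m u))) =
      incl U N.X (klin (U ◁ f.f) (klin (M.str.sigma hS U).hom (tm m u)))
    rw [incl_whiskerLeft, klin_whiskerRight_tm, N.str.incl_sigma_tm, M.str.incl_sigma_tm,
      f.colinear]
    exact (lTensor_rTensor_apply _ _ _).symm

lemma LLYD.colinear_of_comm {M N : LLYD k H} (f : M.X ⟶ N.X)
    (h : ∀ U : LMod k H, (f ▷ U) ≫ ((N.str.toHalfBraiding hS).β U).hom =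
      ((M.str.toHalfBraiding hS).β U).hom ≫ (U ◁ f)) (m : M.X) :
    N.str.coact (klin f m) = (klin f).lTensor H (M.str.coact m) := by
  have h1 := congrArg (fun g => incl (regular k H) N.X (klin g
    (tm m (1 : H) : TensorT M.X (regular k H)))) (h (regular k H))
  change incl (regular k H) N.X (klin (N.str.sigma hS (regular k H)).hom
      (klin (f ▷ regular k H) (tm m (1 : H)))) =
    incl (regular k H) N.X (klin (regular k H ◁ f) (klin (M.str.sigma hS (regular k H)).hom
      (tm m (1 : H)))) at h1
  rwa [incl_whiskerLeft, klin_whiskerRight_tm, N.str.incl_sigma_tm, M.str.incl_sigma_tm,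
    orbit_regular_one, LinearMap.rTensor_id, LinearMap.rTensor_id] at h1

/-- The functor from left-left Yetter-Drinfeld modules to the left center. -/
abbrev toLeftCenterFunctor : LLYD k H ⥤ Center (LMod k H) :=
  LLYD.toLeftCenter (fun M => M.str.toHalfBraiding hS) (LLYD.toHalfBraiding_comm hS)

instance : (toLeftCenterFunctor hS).Faithful where
  map_injective {_ _ _ _} h := LLYD.Hom.ext (congrArg Center.Hom.f h)

instance : (toLeftCenterFunctor hS).Full where
  map_surjective {M N} g := ⟨⟨g.f, LLYD.colinear_of_comm hS (M := M) (N := N) g.f g.comm⟩, rfl⟩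

lemma toLeftCenterFunctor_bijective : Function.Bijective (toLeftCenterFunctor hS).obj := by
  refine Function.bijective_iff_has_inverse.mpr
    ⟨fun X => ⟨X.1, HalfBraiding.toLLYDStr X.2⟩, ?_, ?_⟩
  · rintro ⟨X, s⟩
    exact congrArg (LLYD.mk X) (s.toLLYDStr_toHalfBraiding hS)
  · rintro ⟨X, b⟩
    exact congrArg (Sigma.mk X) (HalfBraiding.toHalfBraiding_toLLYDStr hS b)

end

/-- The left-left Yetter-Drinfeld structure `λ(m) = S(m₍₁₎) ⊗ m₍₀₎`. -/
def LRYDStr.toLLYDStr {M : LMod k H} (s : LRYDStr M) : LLYDStr M :=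
  HalfBraiding.toLLYDStr s.toHalfBraiding.inverse

/-- The structure is defined through the inverse half-braiding, so its axioms need no computation
with S; the formula is τ_{H,M}⁻¹ evaluated at m ⊗_t 1. -/
lemma LRYDStr.toLLYDStr_coact {M : LMod k H} (s : LRYDStr M) (m : M) :
    s.toLLYDStr.coact m = TensorProduct.comm k M H ((anti k H).lTensor M (s.ρ m)) := by
  refine (s.incl_tau_inv_tm (regular k H) m (1 : H)).trans ?_
  rw [orbit_regular_one, LinearMap.lTensor_id, LinearMap.id_apply]

lemma LRYD.toLLYDStr_colinear {M N : LRYD k H} (f : M ⟶ N) (m : M.X) :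
    N.str.toLLYDStr.coact (klin f.f m) = (klin f.f).lTensor H (M.str.toLLYDStr.coact m) := by
  rw [LRYDStr.toLLYDStr_coact, LRYDStr.toLLYDStr_coact, f.colinear]
  induction M.str.ρ m with
  | zero => simp
  | add x y hx hy => simp only [map_add, hx, hy]
  | tmul a b => simp

variable (k H) in
/-- The functor `(M, ρ) ↦ (M, λ)`. -/
abbrev toLLYDFunctor : LRYD k H ⥤ LLYD k H :=
  LRYD.toLLYD (fun M => M.str.toLLYDStr) LRYD.toLLYDStr_colinear

variable (hS : Function.Bijective (anti k H))

lemma inverse_toLLYDStr {M : LMod k H} (s : LRYDStr M) :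
    HalfBraiding.inverse (s.toLLYDStr.toHalfBraiding hS) = s.toHalfBraiding :=
  congrArg HalfBraiding.inverse (HalfBraiding.toHalfBraiding_toLLYDStr hS s.toHalfBraiding.inverse)

lemma LRYD.toRightCenter_congr {τ τ' : ∀ M : LRYD k H, RightHalfBraiding M.X}
    (hτ : ∀ {M N : LRYD k H} (f : M ⟶ N) (U : LMod k H),
      (U ◁ f.f) ≫ ((τ N).τ U).hom = ((τ M).τ U).hom ≫ (f.f ▷ U))
    (hτ' : ∀ {M N : LRYD k H} (f : M ⟶ N) (U : LMod k H),
      (U ◁ f.f) ≫ ((τ' N).τ U).hom = ((τ' M).τ U).hom ≫ (f.f ▷ U))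
    (h : ∀ M, τ M = τ' M) : LRYD.toRightCenter τ hτ = LRYD.toRightCenter τ' hτ' := by
  obtain rfl : τ = τ' := funext h
  rfl

/-- Both sides are functors given by families of right half-braidings on the same modules, and the
families agree because inverting a half-braiding twice changes nothing. -/
lemma toRightCenterFunctor_eq :
    toLLYDFunctor k H ⋙ toLeftCenterFunctor hS ⋙ centerInverse (LMod k H) =
      toRightCenterFunctor k H := by
  have h := LRYD.toRightCenter_congr (k := k) (H := H)
    (τ := fun M => HalfBraiding.inverse (M.str.toLLYDStr.toHalfBraiding hS))
    (fun f U => ((toLLYDFunctor k H ⋙ toLeftCenterFunctor hS ⋙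
      centerInverse (LMod k H)).map f).comm U)
    LRYD.toHalfBraiding_comm (fun M => inverse_toLLYDStr hS M.str)
  exact h

include hS in
lemma toLLYDFunctor_bijective : Function.Bijective (toLLYDFunctor k H).obj := by
  refine Function.bijective_iff_has_inverse.mpr
    ⟨fun X => ⟨X.X, (HalfBraiding.inverse (X.str.toHalfBraiding hS)).toLRYDStr⟩, ?_, ?_⟩
  · rintro ⟨X, s⟩
    refine congrArg (LRYD.mk X) ?_
    change (HalfBraiding.inverse (s.toLLYDStr.toHalfBraiding hS)).toLRYDStr = s
    rw [inverse_toLLYDStr, s.toLRYDStr_toHalfBraiding]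
  · rintro ⟨X, s⟩
    refine congrArg (LLYD.mk X) ?_
    change HalfBraiding.toLLYDStr
      (HalfBraiding.inverse (s.toHalfBraiding hS)).toLRYDStr.toHalfBraiding.inverse = s
    rw [RightHalfBraiding.toHalfBraiding_toLRYDStr]
    exact s.toLLYDStr_toHalfBraiding hS

instance : (toLLYDFunctor k H).Faithful where
  map_injective {_ _ _ _} h := LRYD.Hom.ext (congrArg LLYD.Hom.f h)

-- Bijectivity of S allows ρ to be recovered from λ by applying S⁻¹ to the H-leg, so left
-- colinearity implies right colinearity.
include hS in
lemma LRYD.colinear_of_toLLYDStr {M N : LRYD k H} (f : M.X ⟶ N.X)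
    (h : ∀ m : M.X, N.str.toLLYDStr.coact (klin f m) =
      (klin f).lTensor H (M.str.toLLYDStr.coact m)) (m : M.X) :
    N.str.ρ (klin f m) = (klin f).rTensor H (M.str.ρ m) := by
  have h1 := h m
  rw [LRYDStr.toLLYDStr_coact, LRYDStr.toLLYDStr_coact] at h1
  have h2 : ∀ t : M.X ⊗[k] H, (klin f).lTensor H (TensorProduct.comm k M.X H
      ((anti k H).lTensor M.X t)) = TensorProduct.comm k N.X H
        ((anti k H).lTensor N.X ((klin f).rTensor H t)) := by
    intro t
    induction t with
    | zero => simp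
    | add x y hx hy => simp only [map_add, hx, hy]
    | tmul a b => simp
  rw [h2] at h1
  have h3 : ∀ t : N.X ⊗[k] H, (antiInv hS).lTensor N.X ((anti k H).lTensor N.X t) = t := by
    intro t
    induction t with
    | zero => simp
    | add x y hx hy => simp only [map_add, hx, hy]
    | tmul a b =>
      exact congrArg (a ⊗ₜ[k] ·) ((LinearEquiv.ofBijective (anti k H) hS).symm_apply_apply b)
  have h4 := congrArg ((antiInv hS).lTensor N.X) ((TensorProduct.comm k N.X H).injective h1)
  rwa [h3, h3] at h4

include hS in
lemma toLLYDFunctor_full : (toLLYDFunctor k H).Full where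
  map_surjective {M N} g :=
    ⟨⟨g.f, LRYD.colinear_of_toLLYDStr hS (M := M) (N := N) g.f g.colinear⟩, rfl⟩

end Functors

end WeakHopf

end

/-! ### Assembly. -/

theorem proposition2p6 {k : Type u} {H : Type v} [CommRing k] [Ring H] [Algebra k H]
    [Coalgebra k H] [WeakHopfAlgebra k H]
    (hS : Function.Bijective (WeakHopfAlgebra.antipode (k := k) (H := H))) :
    ∃ (τ : ∀ M : LRYD k H, RightHalfBraiding M.X)
      (hτ : ∀ {M N : LRYD k H} (f : M ⟶ N) (U : LMod k H),
        (U ◁ f.f) ≫ ((τ N).τ U).hom = ((τ M).τ U).hom ≫ (f.f ▷ U))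
      (σ : ∀ M : LLYD k H, HalfBraiding M.X)
      (hσ : ∀ {M N : LLYD k H} (f : M ⟶ N) (U : LMod k H),
        (f.f ▷ U) ≫ ((σ N).β U).hom = ((σ M).β U).hom ≫ (U ◁ f.f))
      (s : ∀ M : LRYD k H, LLYDStr M.X)
      (hs : ∀ {M N : LRYD k H} (f : M ⟶ N) (m : M.X),
        (s N).coact (klin f.f m) = (klin f.f).lTensor H ((s M).coact m)),
      -- the half-braidings: `τ(1₍₁₎ v ⊗ 1₍₂₎ m) = m₍₀₎ ⊗ m₍₁₎ v`
      (∀ (M : LRYD k H) (V : LMod k H) (v : V) (m : M.X),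
        incl M.X V (klin ((τ M).τ V).hom (tm v m : TensorT V M.X)) =
          (orbit V v).lTensor M.X (M.str.ρ m)) ∧
      -- and `σ(1₍₁₎ m ⊗ 1₍₂₎ v) = m₍₋₁₎ v ⊗ m₍₀₎`
      (∀ (M : LLYD k H) (V : LMod k H) (m : M.X) (v : V),
        incl V M.X (klin ((σ M).β V).hom (tm m v : TensorT M.X V)) =
          (orbit V v).rTensor M.X (M.str.coact m)) ∧
      -- the left coaction `λ(m) = S(m₍₁₎) ⊗ m₍₀₎`
      (∀ (M : LRYD k H) (m : M.X),
        (s M).coact m = TensorProduct.comm k M.X H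
          ((WeakHopfAlgebra.antipode (k := k) (H := H)).lTensor M.X (M.str.ρ m))) ∧
      IsCatIso (LRYD.toRightCenter τ hτ) ∧
      ∃ (_ : MonoidalCategory (LRYD k H)) (bLR : BraidedCategory (LRYD k H))
        (_ : MonoidalCategory (LLYD k H)) (bLL : BraidedCategory (LLYD k H)),
        IsBraidedMonoidalIso bLR inferInstance (LRYD.toRightCenter τ hτ) ∧
        IsBraidedMonoidalIso bLL inferInstance (LLYD.toLeftCenter σ hσ) ∧
        IsBraidedMonoidalIso bLR (reverseBraiding (LLYD k H)) (LRYD.toLLYD s hs) := by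
  have hR := isCatIso_of_bijective (toRightCenterFunctor k H) toRightCenterFunctor_bijective
  refine ⟨fun M => M.str.toHalfBraiding, LRYD.toHalfBraiding_comm,
    fun M => M.str.toHalfBraiding hS, LLYD.toHalfBraiding_comm hS, fun M => M.str.toLLYDStr,
    LRYD.toLLYDStr_colinear, fun M V v m => M.str.incl_tau_tm V v m,
    fun M V m v => M.str.incl_sigma_tm hS V m v, fun M m => M.str.toLLYDStr_coact m, hR, ?_⟩
  obtain ⟨mLL, bLL, hLL⟩ := exists_isBraidedMonoidalIso (toLeftCenterFunctor hS)
    (toLeftCenterFunctor_bijective hS) inferInstance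
  have := toLLYDFunctor_full hS
  -- The left-right structure is pulled back from the reversed left-left one rather than from the
  -- right center: strictness over the right center then follows by composition, with no
  -- cancellation of strict functors.
  obtain ⟨mLR, bLR, hLR⟩ := exists_isBraidedMonoidalIso (toLLYDFunctor k H)
    (toLLYDFunctor_bijective hS) (reverseBraiding (LLYD k H))
  refine ⟨mLR, bLR, mLL, bLL, ⟨hR, ?_⟩, hLL, hLR⟩
  have h1 : IsStrictBraided bLR (reverseBraiding (LLYD k H)) (toLLYDFunctor k H) := hLR.strict
  have h2 : IsStrictBraided bLL inferInstance (toLeftCenterFunctor hS) := hLL.strict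
  -- The middle functor is used with both braidings reversed, so that its target matches the source
  -- of `centerInverse`.
  have h3 := h1.comp (h2.reverse.comp isStrictBraided_centerInverse)
  rw [toRightCenterFunctor_eq] at h3
  exact h3
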